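/- **Setting.** Let $E\subset\mathbb R$ be open, or countable without accumulation points, and let $\mu$ be a Radon measure on $E$. Let $\mathrm{Conf}(E)$ be the space of configurations, i.e. of subsets $X\subset E$ with finitely many points in every bounded set. For $W\subset E$ let $\mathcal F_W$ be the $\sigma$-algebra on $\mathrm{Conf}(E)$ generated by the maps $\#_B:X\mapsto\#(X\cap B)$, $B\subset W$ bounded Borel; $\mathrm{Conf}(E)$ carries $\mathcal F_E$. Let $\mathbb P$ be a determinantal point process on $(E,\mu)$ whose correlation kernel $K$ is the kernel of a locally trace class orthogonal projection of $L^2(E,\mu)$, so that, with the usual normalization on the diagonal, $\mathrm{Tr}(\chi_BK\chi_B)=\int_B K(x,x)\,d\mu(x)<\infty$ for bounded Borel $B\subset E$. Write $\mathcal F_W^{\mathbb P}$ for the completion of $\mathcal F_W$ with respect to $\mathbb P$. Assume that $\mathbb P$ is rigid: for every bounded Borel $B\subset E$ the variable $\#_B$ is $\mathcal F^{\mathbb P}_{E\setminus B}$-measurable. For $T>0$ put $\mathcal F_T^{\mathbb P}=\mathcal F^{\mathbb P}_{E\setminus[-T,T]}$, and let $\mathbb P(\cdot\,|X,T)$ be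 the conditional measure of $\mathbb P$ given the configuration outside $[-T,T]$, viewed as the law of the (finite) configuration in $E\cap[-T,T]$. Let $R>0$ and let $f_k:E\to\mathbb C$, $k\ge 1$, be bounded Borel functions with $\sup_{k}R^k\|f_k\|_{L^\infty(\mu)}<\infty$; put $f_u(x)=\sum_{k\ge1}\frac{f_k(x)}{k}u^k$ for $|u|<R$. Assume that 1. $\int_E|f_1(x)|^2K(x,x)\,d\mu(x)<\infty$, and $\int_E|f_k(x)|K(x,x)\,d\mu(x)<\infty$ for $k\ge2$; 2. there is a $\mu$-measurable $h:E\to[0,\infty)$ with $\int_E h(x)K(x,x)\,d\mu(x)<\infty$ and $|f_u(x)-uf_1(x)|=O(h(x))$ as $|x|\to\infty$, uniformly for $u$ in compact subsets of the disk $D(0,R)$; 3. for all $l,l'\ge0$ and all $w_1,\dots,w_l,z_1,\dots,z_{l'}\in D(0,R)$, $$\int_E\Big|\exp\Big(\sum_{j=1}^{l}f_{w_j}(x)-\sum_{j=1}^{l'}f_{z_j}(x)\Big)-1\Big|^2K(x,x)\,d\mu(x)<\infty .$$ Let $\Lambda$ be the algebra of symmetric functions over $\mathbb C$, freely generated by the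 Newton power sums $\mathbf p_k$, $k\ge1$. Let $\mathbf s_\lambda$ be the Schur functions. A specialization is an algebra homomorphism $\rho$ from $\Lambda$ to (random variables that are) functions on $\mathrm{Conf}(E)$; it is determined by the $\rho(\mathbf p_k)$. For a point process $\mathbb Q$ the pair $(\mathbb Q,\rho)$ is *Giambelli compatible* if $\rho(\Lambda)\subset L^1(\mathbb Q)$ and, for every partition with Frobenius coordinates $\lambda=(p_1,\dots,p_d|q_1,\dots,q_d)$, $$\mathbb E_{\mathbb Q}[\rho(\mathbf s_\lambda)]=\det\big(\mathbb E_{\mathbb Q}[\rho(\mathbf s_{(p_i|q_j)})]\big)_{i,j=1}^d .$$ Define - $\rho_0(\mathbf p_k)(X)=\sum_{x\in X}f_k(x)$, $k\ge1$, for finite $X$; - $\rho(\mathbf p_k)(X)=\sum_{x\in X}f_k(x)-\mathbb E_{\mathbb P}\sum_{x\in X}f_k(x)$, $k\ge1$, where for $k=1$ the right-hand side is the limit in $L^1(\mathbb P)$, as $T\to\infty$, of $\sum_{x\in X\cap[-T,T]}f_1(x)-\mathbb E_{\mathbb P}\sum_{x\in X\cap[-T,T]}f_1(x)$; - $\tilde\rho(\mathbf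 p_1)=\rho(\mathbf p_1)$ and $\tilde\rho(\mathbf p_k)(X)=\sum_{x\in X}f_k(x)$ for $k\ge2$. **Lemma.** Assume that the tail $\sigma$-algebra $\mathcal F^{\mathbb P}_\infty=\bigcap_{T>0}\mathcal F_T^{\mathbb P}$ is trivial, and that for every $T>0$ and $\mathbb P$-almost every $X\in\mathrm{Conf}(E)$ the pair $(\mathbb P(\cdot\,|X,T),\rho_0)$ is Giambelli compatible. Then the limit defining $\rho(\mathbf p_1)$ exists, and $(\mathbb P,\rho)$ and $(\mathbb P,\tilde\rho)$ are Giambelli compatible. -/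

import Mathlib

open MeasureTheory Filter Topology

noncomputable section

namespace PointProcess

/-! ### Symmetric functions -/

/-- The algebra `Λ` of symmetric functions over `ℂ`, presented on its free generators, the Newton
power sums `p₁, p₂, …`. -/
abbrev SymFunc : Type := MvPolynomial ℕ+ ℂ

/-- The Newton power sum `p_k`, `k ≥ 1`. -/
def powerSum (k : ℕ+) : SymFunc := MvPolynomial.X k

/-- The series `∑_{k ≥ 1} p_k u^k / k` in `Λ[[u]]`. -/
def powerSumSeries : PowerSeries SymFunc :=
  PowerSeries.mk fun n => if h : 0 < n then (n : ℂ)⁻¹ • powerSum ⟨n, h⟩ else 0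

/-- The generating series `H(u) = ∑ h_k u^k = exp (∑_{k ≥ 1} p_k u^k / k)`. -/
def completeSeries : PowerSeries SymFunc :=
  (PowerSeries.exp SymFunc).subst powerSumSeries

/-- The complete homogeneous symmetric function `h_m`, with `h_m = 0` for `m < 0`. -/
def complete (m : ℤ) : SymFunc :=
  if 0 ≤ m then PowerSeries.coeff m.toNat completeSeries else 0

/-- The Schur function `s_lam = det (h_{lam_i - i + j})`, of size the number of rows of `lam`
(Jacobi-Trudi). -/
def schur (lam : YoungDiagram) : SymFunc :=
  Matrix.det (Matrix.of fun i j : Fin (lam.colLen 0) =>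
    complete ((lam.rowLen i : ℤ) - (i : ℤ) + (j : ℤ)))

/-- The hook `(p | q)`, that is, the Young diagram `(p + 1, 1^q)`. -/
def hook (p q : ℕ) : YoungDiagram :=
  YoungDiagram.ofRowLens ((p + 1) :: List.replicate q 1) (by
    rw [List.sortedGE_iff_pairwise, List.pairwise_cons]
    refine ⟨fun a ha => ?_, ?_⟩
    · rw [List.eq_of_mem_replicate ha]; omega
    · rw [List.pairwise_replicate]; right; exact le_refl 1)

/-- The number `d` of diagonal boxes. -/
def diagLength (lam : YoungDiagram) : ℕ := (lam.cells.filter fun c => c.1 = c.2).card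

/-- The Frobenius coordinate `p_i = lam_i - i` (rows are numbered from `0` here). -/
def frobP (lam : YoungDiagram) (i : ℕ) : ℕ := lam.rowLen i - (i + 1)

/-- The Frobenius coordinate `q_i = lam'_i - i` (columns are numbered from `0` here). -/
def frobQ (lam : YoungDiagram) (i : ℕ) : ℕ := lam.colLen i - (i + 1)

/-! ### Configurations -/

/-- `E` is open, or countable and without accumulation points. -/
def IsGroundSet (E : Set ℝ) : Prop :=
  IsOpen E ∨ (E.Countable ∧ ∀ x : ℝ, ¬ AccPt x (𝓟 E))

lemma IsGroundSet.measurableSet {E : Set ℝ} (hE : IsGroundSet E) : MeasurableSet E :=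
  hE.elim (fun h => h.measurableSet) fun h => h.1.measurableSet

/-- The space `Conf(E)` of configurations: subsets of `E` without accumulation points, i.e.
with finitely many points in every bounded set. -/
def Configuration (E : Set ℝ) : Type :=
  {X : Set E // ∀ r : ℝ, {x | x ∈ X ∧ |(x : ℝ)| ≤ r}.Finite}

variable {E : Set ℝ}

/-- The number `#_B(X)` of points of `X` in `B`. -/
def count (B : Set E) (X : Configuration E) : ℕ := (X.1 ∩ B).ncard

/-- The sigma-algebra `F_W` generated by the counts `#_B`, `B ⊆ W` bounded Borel. -/
@[reducible] def sigmaOn (W : Set E) : MeasurableSpace (Configuration E) :=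
  ⨆ (B : Set E) (_ : B ⊆ W ∧ MeasurableSet B ∧ Bornology.IsBounded B),
    MeasurableSpace.comap (count B) ⊤

instance : MeasurableSpace (Configuration E) := sigmaOn Set.univ

/-- The part `E ∩ [-T, T]` of the ground set. -/
def window (E : Set ℝ) (T : ℝ) : Set E := {x | |(x : ℝ)| ≤ T}

/-- The configuration `X ∩ W`. -/
def Configuration.restrict (W : Set E) (X : Configuration E) : Configuration E :=
  ⟨X.1 ∩ W, fun r => (X.2 r).subset fun _ hx => ⟨hx.1.1, hx.2⟩⟩

/-- The sum `∑_{x ∈ X} φ(x)`. -/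
def linearStatistic (φ : E → ℂ) (X : Configuration E) : ℂ := ∑' x : X.1, φ x

/-- The completion `F_W^P` of `F_W` with respect to `P`. -/
@[reducible] def completedSigma (P : Measure (Configuration E)) (W : Set E) :
    MeasurableSpace (Configuration E) :=
  eventuallyMeasurableSpace (sigmaOn W) (ae P)

/-- Rigidity in the sense of Ghosh and Peres. -/
def IsRigid (P : Measure (Configuration E)) : Prop :=
  ∀ B : Set E, MeasurableSet B → Bornology.IsBounded B →
    Measurable[completedSigma P Bᶜ] (count B)

/-- The tail sigma-algebra `⋂_{T > 0} F_T^P`, where `F_T = F_W` for `W = E \ [-T, T]`. -/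
@[reducible] def tailSigma (P : Measure (Configuration E)) : MeasurableSpace (Configuration E) :=
  ⨅ (T : ℝ) (_ : 0 < T), completedSigma P (window E T)ᶜ

/-- Every tail event has probability `0` or `1`. -/
def IsTailTrivial (P : Measure (Configuration E)) : Prop :=
  ∀ A : Set (Configuration E), MeasurableSet[tailSigma P] A → P A = 0 ∨ P A = 1

lemma measurable_count {B : Set E} (hB : MeasurableSet B) (hb : Bornology.IsBounded B) :
    Measurable (count B : Configuration E → ℕ) := by
  have h : MeasurableSpace.comap (count B) ⊤ ≤ (sigmaOn Set.univ : MeasurableSpace (Configuration E)) :=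
    le_iSup₂_of_le (f := fun (B : Set E)
      (_ : B ⊆ Set.univ ∧ MeasurableSet B ∧ Bornology.IsBounded B) =>
        MeasurableSpace.comap (count B) ⊤) B ⟨Set.subset_univ _, hB, hb⟩ le_rfl
  exact fun s _ => h _ ⟨s, trivial, rfl⟩

lemma measurable_of_count {Z : Type*} [MeasurableSpace Z] {g : Z → Configuration E}
    (h : ∀ B : Set E, MeasurableSet B → Bornology.IsBounded B →
      Measurable fun z => count B (g z)) : Measurable g := by
  rw [measurable_iff_comap_le]
  change MeasurableSpace.comap g (sigmaOn Set.univ) ≤ _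
  simp only [sigmaOn, MeasurableSpace.comap_iSup, iSup_le_iff, MeasurableSpace.comap_comp]
  rintro B ⟨-, hB, hb⟩
  exact measurable_iff_comap_le.1 (h B hB hb)

lemma Configuration.finite_inter (X : Configuration E) {B : Set E} (hb : Bornology.IsBounded B) :
    (X.1 ∩ B).Finite := by
  obtain ⟨r, hr⟩ := (isBounded_iff_forall_norm_le (E := ℝ)).1
    ((isometry_subtype_coe (s := E)).lipschitz.isBounded_image hb)
  exact (X.2 r).subset fun x hx => ⟨hx.1, hr _ ⟨x, hx.2, rfl⟩⟩

lemma measurable_restrict {W : Set E} (hW : MeasurableSet W) :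
    Measurable (Configuration.restrict W) := by
  refine measurable_of_count fun B hB hb => ?_
  have : (fun X : Configuration E => count B (X.restrict W)) = count (W ∩ B) := by
    funext X; simp [count, Configuration.restrict, Set.inter_assoc]
  rw [this]
  exact measurable_count (hW.inter hB) (hb.subset Set.inter_subset_right)

instance countablySeparated_configuration : MeasurableSpace.CountablySeparated (Configuration E) := by
  rw [MeasurableSpace.countablySeparated_def]
  let D : ℚ × ℚ → Set E := fun q => {x | (q.1 : ℝ) < x ∧ (x : ℝ) < q.2}
  have hD : ∀ q, MeasurableSet (D q) := fun q =>
    (measurableSet_lt measurable_const measurable_subtype_coe).inter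
      (measurableSet_lt measurable_subtype_coe measurable_const)
  have hDb : ∀ q, Bornology.IsBounded (D q) := fun q => by
    refine Metric.isBounded_iff.2 ⟨(q.2 : ℝ) - q.1, fun x hx y hy => ?_⟩
    rw [Subtype.dist_eq, Real.dist_eq, abs_le]
    constructor <;> linarith [hx.1, hx.2, hy.1, hy.2]
  have key : ∀ (X Y : Configuration E) (x : E), x ∈ X.1 → x ∉ Y.1 →
      ∃ q, count (D q) X ≠ 0 ∧ count (D q) Y = 0 := by
    intro X Y x hX hY
    have hfin : (Subtype.val '' (Y.1 ∩ {y : E | |(y : ℝ)| ≤ |(x : ℝ)| + 1})).Finite :=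
      (Y.2 (|(x : ℝ)| + 1)).image _
    have hopen : IsOpen ((Subtype.val '' (Y.1 ∩ {y : E | |(y : ℝ)| ≤ |(x : ℝ)| + 1}))ᶜ ∩
        Set.Ioo ((x : ℝ) - 1) (x + 1)) := hfin.isClosed.isOpen_compl.inter isOpen_Ioo
    have hx : (x : ℝ) ∈ ((Subtype.val '' (Y.1 ∩ {y : E | |(y : ℝ)| ≤ |(x : ℝ)| + 1}))ᶜ ∩
        Set.Ioo ((x : ℝ) - 1) (x + 1)) := by
      refine ⟨?_, by constructor <;> linarith⟩
      rintro ⟨y, hy, hyx⟩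
      exact hY (Subtype.val_injective hyx ▸ hy.1)
    obtain ⟨ε, hε, hball⟩ := Metric.isOpen_iff.1 hopen _ hx
    obtain ⟨a, ha1, ha2⟩ := exists_rat_btwn (show (x : ℝ) - ε < x by linarith)
    obtain ⟨b, hb1, hb2⟩ := exists_rat_btwn (show (x : ℝ) < x + ε by linarith)
    refine ⟨(a, b), ?_, ?_⟩
    · rw [count, ← Nat.pos_iff_ne_zero, Set.ncard_pos (X.finite_inter (hDb _))]
      exact ⟨x, hX, ha2, hb1⟩
    · rw [count, Set.ncard_eq_zero (Y.finite_inter (hDb _)), Set.eq_empty_iff_forall_notMem]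
      rintro y ⟨hyY, hy1, hy2⟩
      have hy := hball (show (y : ℝ) ∈ Metric.ball (x : ℝ) ε by
        rw [Metric.mem_ball, Real.dist_eq, abs_lt]
        constructor <;> simp only at hy1 hy2 <;> linarith)
      refine hy.1 ⟨y, ⟨hyY, ?_⟩, rfl⟩
      have h1 := hy.2.1
      have h2 := hy.2.2
      change |(y : ℝ)| ≤ _
      rw [abs_le]
      constructor <;> linarith [le_abs_self (x : ℝ), neg_abs_le (x : ℝ)]
  refine ⟨Set.range fun q => {X : Configuration E | count (D q) X ≠ 0},
    Set.countable_range _, ?_, ?_⟩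
  · rintro _ ⟨q, rfl⟩
    exact measurable_count (hD q) (hDb q) (measurableSet_singleton 0).compl
  · intro X _ Y _ h
    apply Subtype.ext
    ext x
    constructor
    · intro hx
      by_contra hy
      obtain ⟨q, h1, h2⟩ := key X Y x hx hy
      exact (h _ ⟨q, rfl⟩).1 h1 h2
    · intro hy
      by_contra hx
      obtain ⟨q, h1, h2⟩ := key Y X x hy hx
      exact (h _ ⟨q, rfl⟩).2 h1 h2

/-- Codes of configurations: in each unit interval `[n, n + 1)` the number of points and their
increasing enumeration, padded by zeros. -/
def codes (E : Set ℝ) : Set (ℤ → ℕ × (ℕ → ℝ)) :=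
  {z | ∀ n, (∀ i, i < (z n).1 → (z n).2 i ∈ E ∧ ⌊(z n).2 i⌋ = n) ∧
    (∀ i j, i < j → j < (z n).1 → (z n).2 i < (z n).2 j) ∧
    ∀ i, (z n).1 ≤ i → (z n).2 i = 0}

lemma measurableSet_codes (hE : MeasurableSet E) : MeasurableSet (codes E) := by
  have h1 : ∀ n : ℤ, Measurable fun z : ℤ → ℕ × (ℕ → ℝ) => (z n).1 :=
    fun n => measurable_fst.comp (measurable_pi_apply n)
  have h2 : ∀ (n : ℤ) (i : ℕ), Measurable fun z : ℤ → ℕ × (ℕ → ℝ) => (z n).2 i :=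
    fun n i => (measurable_pi_apply i).comp (measurable_snd.comp (measurable_pi_apply n))
  refine measurableSet_setOfPred.2 (Measurable.forall fun n => .and ?_ (.and ?_ ?_))
  · refine .forall fun i => .imp (measurableSet_setOfPred.1 (measurableSet_lt measurable_const (h1 n)))
      (.and (measurableSet_setOfPred.1 (h2 n i hE)) ?_)
    exact measurableSet_setOfPred.1 ((Int.measurable_floor.comp (h2 n i)) (measurableSet_singleton n))
  · exact .forall fun i => .forall fun j => .imp measurable_const (.imp
      (measurableSet_setOfPred.1 (measurableSet_lt measurable_const (h1 n)))
      (measurableSet_setOfPred.1 (measurableSet_lt (h2 n i) (h2 n j))))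
  · exact .forall fun i => .imp
      (measurableSet_setOfPred.1 (measurableSet_le (h1 n) measurable_const))
      (measurableSet_setOfPred.1 (h2 n i (measurableSet_singleton 0)))

/-- The configuration with a given code. -/
def decode (z : codes E) : Configuration E :=
  ⟨{x | ∃ i, i < (z.1 ⌊(x : ℝ)⌋).1 ∧ (z.1 ⌊(x : ℝ)⌋).2 i = x}, fun r => by
    refine Set.Finite.of_finite_image (f := Subtype.val) ?_ Subtype.val_injective.injOn
    refine (((Set.finite_Icc ⌊-r⌋ ⌊r⌋).biUnion fun n _ =>
      ((Set.finite_lt_nat (z.1 n).1).image (z.1 n).2))).subset ?_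
    rintro _ ⟨x, ⟨⟨i, hi, hx⟩, hr⟩, rfl⟩
    rw [abs_le] at hr
    exact Set.mem_biUnion (x := ⌊(x : ℝ)⌋) ⟨Int.floor_mono hr.1, Int.floor_mono hr.2⟩ ⟨i, hi, hx⟩⟩

lemma mem_decode_iff (z : codes E) (x : E) :
    x ∈ (decode z).1 ↔ ∃ i, i < (z.1 ⌊(x : ℝ)⌋).1 ∧ (z.1 ⌊(x : ℝ)⌋).2 i = x := Iff.rfl

/-- The points of `X` in `[n, n + 1)`. -/
def unitPoints (X : Configuration E) (n : ℤ) : Finset ℝ :=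
  Set.Finite.toFinset (s := Subtype.val '' {x | x ∈ X.1 ∧ ⌊(x : ℝ)⌋ = n})
    (((X.2 (|(n : ℝ)| + 1)).subset fun x hx => ⟨hx.1, by
      have h1 := Int.floor_le (x : ℝ)
      have h2 := Int.lt_floor_add_one (x : ℝ)
      rw [hx.2] at h1 h2
      rw [abs_le]
      constructor <;> linarith [le_abs_self (n : ℝ), neg_abs_le (n : ℝ)]⟩).image _)

lemma mem_unitPoints (X : Configuration E) (n : ℤ) (y : ℝ) :
    y ∈ unitPoints X n ↔ ∃ h : y ∈ E, (⟨y, h⟩ : E) ∈ X.1 ∧ ⌊y⌋ = n := by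
  simp only [unitPoints, Set.Finite.mem_toFinset, Set.mem_image]
  constructor
  · rintro ⟨x, hx, rfl⟩
    exact ⟨x.2, hx⟩
  · rintro ⟨h, h1, h2⟩
    exact ⟨⟨y, h⟩, ⟨h1, h2⟩, rfl⟩

lemma unitPoints_decode (z : codes E) (n : ℤ) :
    unitPoints (decode z) n = (Finset.range (z.1 n).1).image (z.1 n).2 := by
  ext y
  rw [mem_unitPoints, Finset.mem_image]
  constructor
  · rintro ⟨h, ⟨i, hi, hy⟩, rfl⟩
    exact ⟨i, Finset.mem_range.2 hi, hy⟩
  · rintro ⟨i, hi, rfl⟩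
    have hi' := Finset.mem_range.1 hi
    obtain ⟨h1, h2⟩ := (z.2 n).1 i hi'
    refine ⟨h1, ⟨i, ?_, ?_⟩, h2⟩
    · simp only [h2]; exact hi'
    · simp only [h2]

lemma injOn_code (z : codes E) (n : ℤ) :
    Set.InjOn (z.1 n).2 (Finset.range (z.1 n).1 : Set ℕ) := by
  intro i hi j hj h
  simp only [Finset.coe_range, Set.mem_Iio] at hi hj
  rcases lt_trichotomy i j with hlt | heq | hlt
  · exact absurd h ((z.2 n).2.1 i j hlt hj).ne
  · exact heq
  · exact absurd h ((z.2 n).2.1 j i hlt hi).ne'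

lemma decode_injective : Function.Injective (decode : codes E → Configuration E) := by
  intro z w hzw
  apply Subtype.ext
  funext n
  have himg : (Finset.range (z.1 n).1).image (z.1 n).2 =
      (Finset.range (w.1 n).1).image (w.1 n).2 := by
    rw [← unitPoints_decode, ← unitPoints_decode, hzw]
  have hk : (z.1 n).1 = (w.1 n).1 := by
    have := congrArg Finset.card himg
    rwa [Finset.card_image_of_injOn (injOn_code z n), Finset.card_image_of_injOn (injOn_code w n),
      Finset.card_range, Finset.card_range] at this
  have hrange : Set.range (fun i : Fin (z.1 n).1 => (z.1 n).2 i) =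
      Set.range (fun i : Fin (z.1 n).1 => (w.1 n).2 i) := by
    ext y
    have hy := Finset.ext_iff.1 himg y
    simp only [Finset.mem_image, Finset.mem_range] at hy
    simp only [Set.mem_range]
    constructor
    · rintro ⟨i, hi⟩
      obtain ⟨j, hj, h⟩ := hy.1 ⟨i, i.2, hi⟩
      exact ⟨⟨j, hk ▸ hj⟩, h⟩
    · rintro ⟨i, hi⟩
      obtain ⟨j, hj, h⟩ := hy.2 ⟨i, hk ▸ i.2, hi⟩
      exact ⟨⟨j, hj⟩, h⟩
  have hfun := (StrictMono.range_inj (f := fun i : Fin (z.1 n).1 => (z.1 n).2 i)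
    (g := fun i : Fin (z.1 n).1 => (w.1 n).2 i)
    (fun i j hij => (z.2 n).2.1 i j hij j.2)
    (fun i j hij => (w.2 n).2.1 i j hij (hk ▸ j.2))).1 hrange
  refine Prod.ext hk (funext fun i => ?_)
  rcases lt_or_ge i (z.1 n).1 with hi | hi
  · exact congrFun hfun ⟨i, hi⟩
  · rw [(z.2 n).2.2 i hi, (w.2 n).2.2 i (hk ▸ hi)]

open Classical in
lemma measurable_decode (hE : MeasurableSet E) :
    Measurable (decode : codes E → Configuration E) := by
  refine measurable_of_count fun B hB hb => ?_
  have hB' : MeasurableSet (Subtype.val '' B : Set ℝ) := hE.subtype_image hB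
  obtain ⟨r, hr⟩ := (isBounded_iff_forall_norm_le (E := ℝ)).1
    ((isometry_subtype_coe (s := E)).lipschitz.isBounded_image hb)
  have hcount : (fun z : codes E => count B (decode z)) = fun z : codes E =>
      ∑ n ∈ Finset.Icc ⌊-r⌋ ⌊r⌋, ((Finset.range (z.1 n).1).filter
        fun i => (z.1 n).2 i ∈ (Subtype.val '' B : Set ℝ)).card := by
    funext z
    have h1 : (Subtype.val '' ((decode z).1 ∩ B) : Set ℝ) =
        ((Finset.Icc ⌊-r⌋ ⌊r⌋).biUnion fun n => ((Finset.range (z.1 n).1).filter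
          fun i => (z.1 n).2 i ∈ (Subtype.val '' B : Set ℝ)).image (z.1 n).2 : Finset ℝ) := by
      ext y
      simp only [Set.mem_image, Finset.coe_biUnion, Finset.mem_coe, Set.mem_iUnion,
        Finset.coe_image, Finset.mem_filter, Finset.mem_range, Finset.mem_Icc, exists_prop]
      constructor
      · rintro ⟨x, ⟨⟨i, hi, hx⟩, hxB⟩, rfl⟩
        have hxr := abs_le.1 (hr _ ⟨x, hxB, rfl⟩)
        exact ⟨⌊(x : ℝ)⌋, ⟨Int.floor_mono hxr.1, Int.floor_mono hxr.2⟩, i,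
          ⟨hi, x, hxB, hx.symm⟩, hx⟩
      · rintro ⟨n, -, i, ⟨hi, x, hxB, hx⟩, rfl⟩
        have hn := ((z.2 n).1 i hi).2
        rw [← hx] at hn
        exact ⟨x, ⟨⟨i, by rw [hn]; exact hi, by rw [hn]; exact hx.symm⟩, hxB⟩, hx⟩
    rw [count, ← Set.ncard_image_of_injective _ Subtype.val_injective, h1, Set.ncard_coe_finset,
      Finset.card_biUnion]
    · refine Finset.sum_congr rfl fun n _ => Finset.card_image_of_injOn ?_
      exact (injOn_code z n).mono fun i hi => (Finset.mem_filter.1 hi).1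
    · intro n _ m _ hnm
      rw [Function.onFun, Finset.disjoint_left]
      intro y hy hy'
      obtain ⟨i, hi, rfl⟩ := Finset.mem_image.1 hy
      obtain ⟨j, hj, hij⟩ := Finset.mem_image.1 hy'
      have h1 := ((z.2 n).1 i (Finset.mem_range.1 (Finset.mem_filter.1 hi).1)).2
      have h2 := ((z.2 m).1 j (Finset.mem_range.1 (Finset.mem_filter.1 hj).1)).2
      rw [hij] at h2
      exact hnm (h1.symm.trans h2)
  rw [hcount]
  refine Finset.measurable_sum _ fun n _ => ?_
  have hmeas : Measurable fun p : ℕ × (ℕ → ℝ) =>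
      ((Finset.range p.1).filter fun i => p.2 i ∈ (Subtype.val '' B : Set ℝ)).card := by
    refine measurable_from_prod_countable_right fun k => ?_
    simp only [Finset.card_filter]
    exact Finset.measurable_sum _ fun i _ => Measurable.ite (measurable_pi_apply i hB')
      measurable_const measurable_const
  exact hmeas.comp ((measurable_pi_apply n).comp measurable_subtype_coe)

lemma decode_surjective : Function.Surjective (decode : codes E → Configuration E) := by
  intro X
  let v : ℤ → ℕ → ℝ := fun n i =>
    if h : i < (unitPoints X n).card then (unitPoints X n).orderEmbOfFin rfl ⟨i, h⟩ else 0
  have hv : ∀ n i, i < (unitPoints X n).card → v n i ∈ unitPoints X n := fun n i h => by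
    simp only [v, h, dif_pos]
    exact Finset.orderEmbOfFin_mem _ _ _
  refine ⟨⟨fun n => ((unitPoints X n).card, v n), fun n => ⟨fun i hi => ?_, fun i j hij hj => ?_,
    fun i hi => ?_⟩⟩, ?_⟩
  · obtain ⟨h, -, h2⟩ := (mem_unitPoints X n _).1 (hv n i hi)
    exact ⟨h, h2⟩
  · have hi : i < (unitPoints X n).card := hij.trans hj
    have hj' : j < (unitPoints X n).card := hj
    simp only [v, hi, hj', dif_pos]
    exact (Finset.orderEmbOfFin _ _).strictMono hij
  · simp only [v]
    exact dif_neg (not_lt.2 hi)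
  · apply Subtype.ext
    ext x
    rw [mem_decode_iff]
    constructor
    · rintro ⟨i, hi, hx⟩
      obtain ⟨h, h1, -⟩ := (mem_unitPoints X _ _).1 (hv _ i hi)
      simp only at hx
      have : (⟨v ⌊(x : ℝ)⌋ i, h⟩ : E) = x := Subtype.ext hx
      rwa [this] at h1
    · intro hx
      have hm : (x : ℝ) ∈ unitPoints X ⌊(x : ℝ)⌋ := (mem_unitPoints X _ _).2 ⟨x.2, hx, rfl⟩
      have hr : (x : ℝ) ∈ Set.range ((unitPoints X ⌊(x : ℝ)⌋).orderEmbOfFin rfl) := by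
        rw [Finset.range_orderEmbOfFin]; exact hm
      obtain ⟨i, hi⟩ := hr
      refine ⟨i, i.2, ?_⟩
      simp only [v, i.2, dif_pos]
      exact hi

lemma standardBorelSpace_of_measurableEquiv {α β : Type*} [MeasurableSpace α] [MeasurableSpace β]
    [h : StandardBorelSpace α] (e : α ≃ᵐ β) : StandardBorelSpace β := by
  obtain ⟨τ, hb, hp⟩ := h.polish
  let τ' : TopologicalSpace β := TopologicalSpace.induced e.symm τ
  have : PolishSpace β := e.symm.toEquiv.polishSpace_induced
  refine ⟨τ', ⟨?_⟩, inferInstance⟩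
  have h1 : MeasurableSpace.comap e.symm (@borel α τ) = @borel β τ' := borel_comap.symm
  rw [← h1, ← hb.measurable_eq]
  exact e.symm.measurableEmbedding.comap_eq.symm

/-- `Conf(E)` is a standard Borel space when `E` is Borel. -/
theorem standardBorelSpace_configuration (hE : MeasurableSet E) :
    StandardBorelSpace (Configuration E) := by
  have : StandardBorelSpace (codes E) := (measurableSet_codes hE).standardBorel
  have hemb : MeasurableEmbedding (decode : codes E → Configuration E) :=
    (measurable_decode hE).measurableEmbedding decode_injective
  refine standardBorelSpace_of_measurableEquiv
    { Equiv.ofBijective _ ⟨decode_injective, decode_surjective⟩ with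
      measurable_toFun := hemb.measurable
      measurable_invFun := fun s hs => ?_ }
  rw [← Equiv.image_eq_preimage_symm]
  exact hemb.measurableSet_image.2 hs

/-! ### Conditional measures -/

/-- The conditional measure `P( · | X, T)`: the law of the configuration in `[-T, T]` under `P`
conditioned on the configuration outside `[-T, T]`, evaluated at `X`. -/
def conditionalMeasure (hE : MeasurableSet E) (P : Measure (Configuration E))
    [IsProbabilityMeasure P] (T : ℝ) (X : Configuration E) : Measure (Configuration E) :=
  have : StandardBorelSpace (Configuration E) := standardBorelSpace_configuration hE
  (ProbabilityTheory.condExpKernel P (sigmaOn (window E T)ᶜ) X).map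
    (Configuration.restrict (window E T))

/-! ### Determinantal point processes -/

/-- The kernel `K` is the kernel of a locally trace class orthogonal projection `Q` of `L²(E, μ)`,
with values on the diagonal normalized as usual by
`∫_B K(x, x) dμ(x) = Tr (χ_B Q χ_B) = ∫_B ∫_E |K(x, y)|² dμ(y) dμ(x)`. -/
structure IsProjectionKernel (μ : Measure E) (K : E → E → ℂ) : Prop where
  measurable : Measurable fun z : E × E => K z.1 z.2
  projection : ∃ Q : Lp ℂ 2 μ →L[ℂ] Lp ℂ 2 μ, IsStarProjection Q ∧
    ∀ φ : Lp ℂ 2 μ, ∀ᵐ x ∂μ, Integrable (fun y => K x y * φ y) μ ∧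
      Q φ x = ∫ y, K x y * φ y ∂μ
  diagonal : ∀ᵐ x ∂μ, Integrable (fun y => ‖K x y‖ ^ 2) μ ∧
    K x x = ((∫ y, ‖K x y‖ ^ 2 ∂μ : ℝ) : ℂ)
  locallyTraceClass : ∀ B : Set E, MeasurableSet B → Bornology.IsBounded B →
    IntegrableOn (fun x => K x x) B μ

/-- The sum of `φ` over the `n`-tuples of pairwise distinct points of `X`. -/
def tupleSum {n : ℕ} (φ : (Fin n → E) → ℂ) (X : Configuration E) : ℂ :=
  ∑' x : {x : Fin n → E // Function.Injective x ∧ ∀ i, x i ∈ X.1}, φ x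

/-- `P` is a determinantal point process on `(E, μ)` with correlation kernel `K`. -/
def IsDeterminantal (P : Measure (Configuration E)) (μ : Measure E) (K : E → E → ℂ) : Prop :=
  ∀ (n : ℕ) (φ : (Fin n → E) → ℂ), Measurable φ → (∃ C : ℝ, ∀ x, ‖φ x‖ ≤ C) →
    HasCompactSupport φ →
    Integrable (tupleSum φ) P ∧
    Integrable (fun x => φ x * (Matrix.of fun i j => K (x i) (x j)).det)
      (Measure.pi fun _ : Fin n => μ) ∧
    ∫ X, tupleSum φ X ∂P =
      ∫ x, φ x * (Matrix.of fun i j => K (x i) (x j)).det ∂(Measure.pi fun _ : Fin n => μ)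

/-! ### Specializations -/

/-- A specialization: an algebra homomorphism from `Λ` to functions on `Conf(E)`. -/
abbrev SymFuncSpecialization (E : Set ℝ) : Type := SymFunc →ₐ[ℂ] (Configuration E → ℂ)

/-- The specialization with prescribed images of the power sums. -/
def specialize (a : ℕ+ → Configuration E → ℂ) : SymFuncSpecialization E := MvPolynomial.aeval a

/-- The image of the specialization is contained in `L¹(Conf(E), P)`. -/
def IsL1Specialization (P : Measure (Configuration E)) (ρ : SymFuncSpecialization E) : Prop :=
  ∀ F : SymFunc, Integrable (ρ F) P

/-- The pair `(P, ρ)` is Giambelli compatible: `ρ` is an `L¹`-specialization and, for every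
`lam = (p_1, …, p_d | q_1, …, q_d)`, `E[ρ(s_lam)] = det (E[ρ(s_(p_i | q_j))])`. -/
def GiambelliCompatible (P : Measure (Configuration E)) (ρ : SymFuncSpecialization E) : Prop :=
  IsL1Specialization P ρ ∧ ∀ lam : YoungDiagram,
    ∫ X, ρ (schur lam) X ∂P =
      Matrix.det (Matrix.of fun i j : Fin (diagLength lam) =>
        ∫ X, ρ (schur (hook (frobP lam i) (frobQ lam j))) X ∂P)

/-- The series `f_u(x) = ∑_{k ≥ 1} f_k(x) u^k / k`. -/
def genSeries (f : ℕ+ → E → ℂ) (u : ℂ) (x : E) : ℂ :=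
  ∑' k : ℕ+, f k x / ((k : ℕ) : ℂ) * u ^ (k : ℕ)

/-- The summability conditions on the sequence `(f_k)`. -/
structure IsAdmissible (μ : Measure E) (K : E → E → ℂ) (R : ℝ) (f : ℕ+ → E → ℂ) : Prop where
  measurable : ∀ k, Measurable (f k)
  bounded : ∀ k, ∃ C : ℝ, ∀ x, ‖f k x‖ ≤ C
  geometric : ∃ C : ℝ, ∀ k : ℕ+, ∀ᵐ x ∂μ, R ^ (k : ℕ) * ‖f k x‖ ≤ C
  integrable_one : Integrable (fun x => ‖f 1 x‖ ^ 2 * (K x x).re) μ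
  integrable_two : ∀ k : ℕ+, 2 ≤ k → Integrable (fun x => ‖f k x‖ * (K x x).re) μ
  remainder : ∃ h : E → ℝ, (∀ x, 0 ≤ h x) ∧ AEMeasurable h μ ∧
    Integrable (fun x => h x * (K x x).re) μ ∧
    ∀ C : Set ℂ, IsCompact C → C ⊆ Metric.ball 0 R → ∃ A M : ℝ, ∀ᵐ x : E ∂μ, M ≤ |(x : ℝ)| →
      ∀ u ∈ C, ‖genSeries f u x - u * f 1 x‖ ≤ A * h x
  exponential : ∀ (l l' : ℕ) (w : Fin l → ℂ) (z : Fin l' → ℂ),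
    (∀ j, w j ∈ Metric.ball 0 R) → (∀ j, z j ∈ Metric.ball 0 R) →
    Integrable (fun x => ‖Complex.exp (∑ j, genSeries f (w j) x - ∑ j, genSeries f (z j) x) - 1‖ ^ 2
      * (K x x).re) μ

/-- `Y` is the regularized sum `∑_{x ∈ X} φ(x) - E ∑_{x ∈ X} φ(x)`: the limit in `L¹(P)`, as
`T → ∞`, of the centered sums over `X ∩ [-T, T]`. -/
def IsCenteredSum (P : Measure (Configuration E)) (φ : E → ℂ) (Y : Configuration E → ℂ) : Prop :=
  Integrable Y P ∧
  Tendsto (fun T : ℝ => eLpNorm (fun X => linearStatistic φ (X.restrict (window E T)) -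
    ∫ Z, linearStatistic φ (Z.restrict (window E T)) ∂P - Y X) 1 P) atTop (𝓝 0)

/-- The uncentered specialization `ρ₀(p_k)(X) = ∑_{x ∈ X} f_k(x)` (used for finite `X`). -/
def uncentered (f : ℕ+ → E → ℂ) : SymFuncSpecialization E :=
  specialize fun k => linearStatistic (f k)

/-- The specialization `ρ(p_k)(X) = ∑_{x ∈ X} f_k(x) - E ∑_{x ∈ X} f_k(x)`, where for `k = 1` the
right-hand side is the given regularized sum `Y`. -/
def centered (P : Measure (Configuration E)) (f : ℕ+ → E → ℂ) (Y : Configuration E → ℂ) :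
    SymFuncSpecialization E :=
  specialize fun k X => if k = 1 then Y X else
    linearStatistic (f k) X - ∫ Z, linearStatistic (f k) Z ∂P

/-- The specialization `ρ̃` with `ρ̃(p_1) = ρ(p_1) = Y` and `ρ̃(p_k)(X) = ∑_{x ∈ X} f_k(x)` for
`k ≥ 2`. -/
def semiCentered (f : ℕ+ → E → ℂ) (Y : Configuration E → ℂ) : SymFuncSpecialization E :=
  specialize fun k X => if k = 1 then Y X else linearStatistic (f k) X

end PointProcess

end

open PointProcess

noncomputable section

namespace PointProcess

section


/-! ### Frobenius coordinates and minors -/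

/-! Giambelli compatibility is a statement about minors. By Jacobi-Trudi, a linear functional `L` on
`Λ` satisfies the Giambelli identities exactly when all values `L (s_λ)` are minors, with rows at
`λ_i - i`, of one infinite matrix that is unitriangular at the nonpositive row indices
(`IsGiambelliFunctional.apply_det`, `det_unitriangular_giambelli`). Adding constants `c_k` to the
power sums multiplies `∑ h_n u^n` by the scalar series `exp (∑ c_k u^k / k)`, whose constant term is
1. The rows of the matrix are thereby convolved with a sequence starting with 1, and
unitriangularity survives. Hence compatibility is invariant under deterministic translations of the
power sums (`GiambelliCompatible.translate`).

For a window `[-T, T]`, each `ρ̃(p_k)` is the sum of `f_k` over the points inside plus a quantity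
depending only on the configuration outside (`exists_outer_part`). Given the outside, that quantity
is a constant, so `ρ̃` is a translate of `ρ₀`, and the hypothesis on the conditional measures gives
the Giambelli identity for conditional expectations (`condExp_schur`). As `T` grows these form a
backward martingale; since the tail is trivial, they converge to the plain expectations
(`tendsto_condExp_of_trivial`), and the determinant is continuous. Finally `ρ` is the translate of
`ρ̃` by the means of the power sums with `k ≥ 2`.

The analytic input is integrability: the sum of `f_1` need not converge, yet its centered version
must exist and have moments of all orders. The expectation of `∏ (1 + g(x))` equals `exp (∫ g(x)
K(x,x))` times a regularized Fredholm determinant controlled by the Hilbert-Schmidt norm of `g K`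
(`IsDeterminantal.expectation_exp`). For a projection kernel the square of that norm is `∫ |g|²
K(x,x)`. Taking `g = e^φ - 1` bounds the exponential moments of a centered linear statistic by `∫ φ²
K(x,x)` alone (`realStatistic_cosh_bound`). This yields uniform moment bounds and an `L²` norm that
is small together with the integral, hence the Cauchy property of the windowed sums. -/

lemma diag_mem_iff (lam : YoungDiagram) (i : ℕ) : (i, i) ∈ lam ↔ i < diagLength lam := by
  let D : Finset ℕ := (lam.cells.filter fun c => c.1 = c.2).image Prod.fst
  have hD : ∀ j, j ∈ D ↔ (j, j) ∈ lam := by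
    intro j
    simp only [D, Finset.mem_image, Finset.mem_filter, YoungDiagram.mem_cells, Prod.exists]
    constructor
    · rintro ⟨a, b, ⟨h1, h2⟩, h3⟩
      obtain rfl : a = b := h2
      obtain rfl : a = j := h3
      exact h1
    · intro h; exact ⟨j, j, ⟨h, rfl⟩, rfl⟩
  have hcard : D.card = diagLength lam := by
    refine Finset.card_image_of_injOn fun a ha b hb hab => ?_
    simp only [Finset.coe_filter, Set.mem_ofPred_eq] at ha hb
    exact Prod.ext hab (by rw [← ha.2, ← hb.2]; exact hab)
  -- Diagrams are closed under moving up and left, so the diagonal indices form an initial segment,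
  -- determined by its cardinality.
  have hlow : IsLowerSet (D : Set ℕ) := by
    intro a b hba ha
    exact (hD b).2 (lam.up_left_mem hba hba ((hD a).1 ha))
  rw [← hD, ← hcard]
  constructor
  · intro hi
    have : Finset.range (i + 1) ⊆ D := fun j hj =>
      hlow (Nat.lt_succ_iff.1 (Finset.mem_range.1 hj)) hi
    simpa using Finset.card_le_card this
  · intro hi
    by_contra h
    have : D ⊆ Finset.range i := fun j hj => by
      rw [Finset.mem_range]
      by_contra hji
      exact h (hlow (not_lt.1 hji) hj)
    have := Finset.card_le_card this
    rw [Finset.card_range] at this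
    omega

lemma lt_rowLen_iff_lt_colLen (lam : YoungDiagram) (i j : ℕ) :
    j < lam.rowLen i ↔ i < lam.colLen j := by
  rw [← YoungDiagram.mem_iff_lt_rowLen, YoungDiagram.mem_iff_lt_colLen]

lemma lt_rowLen_of_lt_diagLength {lam : YoungDiagram} {i : ℕ} (h : i < diagLength lam) :
    i < lam.rowLen i :=
  YoungDiagram.mem_iff_lt_rowLen.1 ((diag_mem_iff lam i).2 h)

lemma lt_colLen_of_lt_diagLength {lam : YoungDiagram} {i : ℕ} (h : i < diagLength lam) :
    i < lam.colLen i :=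
  YoungDiagram.mem_iff_lt_colLen.1 ((diag_mem_iff lam i).2 h)

lemma rowLen_le_of_diagLength_le {lam : YoungDiagram} {i : ℕ} (h : diagLength lam ≤ i) :
    lam.rowLen i ≤ i := by
  by_contra hc
  exact absurd ((diag_mem_iff lam i).1 (YoungDiagram.mem_iff_lt_rowLen.2 (not_le.1 hc)))
    (not_lt.2 h)

lemma diagLength_le_colLen (lam : YoungDiagram) : diagLength lam ≤ lam.colLen 0 := by
  by_contra hc
  push Not at hc
  have h1 := lt_colLen_of_lt_diagLength hc
  have h2 := lam.colLen_anti 0 (lam.colLen 0) (Nat.zero_le _)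
  omega

lemma frobQ_lt {lam : YoungDiagram} {i : ℕ} (h : i < diagLength lam) :
    frobQ lam i < lam.colLen 0 := by
  have h1 := lt_colLen_of_lt_diagLength h
  have h2 := lam.colLen_anti 0 i (Nat.zero_le _)
  unfold frobQ; omega

lemma frobQ_strictAnti {lam : YoungDiagram} {i j : ℕ} (hij : i < j) (hj : j < diagLength lam) :
    frobQ lam j < frobQ lam i := by
  have h1 := lt_colLen_of_lt_diagLength hj
  have h2 := lam.colLen_anti i j hij.le
  unfold frobQ; omega

/-- The position of the unit entry in row `i` of a normalized matrix of minors. -/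
def frobPos (lam : YoungDiagram) (i : ℕ) : ℕ :=
  if i < diagLength lam then frobQ lam i else i - lam.rowLen i

lemma frobPos_lt {lam : YoungDiagram} {N : ℕ} (hN : lam.colLen 0 ≤ N) {i : ℕ} (hi : i < N) :
    frobPos lam i < N := by
  unfold frobPos
  split_ifs with h
  · exact (frobQ_lt h).trans_le hN
  · omega

/-- Within each of the two ranges the values are strictly monotone. An equality across them, `q_i =
j - lam_j`, would mean `lam'_i + lam_j = i + j + 1`. But this sum is at least `i + j + 2` if the box
`(j, i)` belongs to the diagram, and at most `i + j` otherwise. -/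
lemma frobPos_injective (lam : YoungDiagram) : Function.Injective (frobPos lam) := by
  have key : ∀ i j, i < j → frobPos lam i ≠ frobPos lam j := by
    intro i j hij h
    unfold frobPos at h
    split_ifs at h with h1 h2 h2
    · exact (frobQ_strictAnti hij h2).ne' h
    · have h3 := lt_colLen_of_lt_diagLength h1
      have h4 := rowLen_le_of_diagLength_le (not_lt.1 h2)
      have h5 := lt_rowLen_iff_lt_colLen lam j i
      unfold frobQ at h
      omega
    · omega
    · have h3 := rowLen_le_of_diagLength_le (not_lt.1 h1)
      have h4 := rowLen_le_of_diagLength_le (not_lt.1 h2)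
      have h5 := lam.rowLen_anti i j hij.le
      omega
  intro i j h
  rcases lt_trichotomy i j with hij | hij | hij
  · exact absurd h (key i j hij)
  · exact hij
  · exact absurd h.symm (key j i hij)

/-- `frobPos` as a permutation of `{0, …, N - 1}`, when `lam` has at most `N` rows. -/
def frobPerm (lam : YoungDiagram) (N : ℕ) (hN : lam.colLen 0 ≤ N) : Equiv.Perm (Fin N) :=
  Equiv.ofBijective (fun i => ⟨frobPos lam i, frobPos_lt hN i.2⟩)
    (Finite.injective_iff_bijective.1 fun i j h =>
      Fin.ext (frobPos_injective lam (by simpa using h)))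

lemma frobPerm_apply (lam : YoungDiagram) (N : ℕ) (hN : lam.colLen 0 ≤ N) (i : Fin N) :
    (frobPerm lam N hN i : ℕ) = frobPos lam i := rfl

/-- Counts the inversions with first index `i`. For `i < d` the earlier rows take larger values, so
each of the `q_i` values below `q_i` is taken later; for `i ≥ d` the values increase and there are
no inversions. -/
lemma prod_Ioi_frobPerm (lam : YoungDiagram) (N : ℕ) (hN : lam.colLen 0 ≤ N) (i : Fin N) :
    ∏ j ∈ Finset.Ioi i, (if frobPerm lam N hN i < frobPerm lam N hN j then (1 : ℤ) else -1) =
      if (i : ℕ) < diagLength lam then (-1) ^ frobQ lam i else 1 := by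
  set σ := frobPerm lam N hN with hσ
  split_ifs with hi
  · rw [Finset.prod_ite, Finset.prod_const_one, one_mul, Finset.prod_const]
    congr 1
    have himg : ((Finset.Ioi i).filter fun j => ¬ σ i < σ j).image σ = Finset.Iio (σ i) := by
      ext r
      simp only [Finset.mem_image, Finset.mem_filter, Finset.mem_Ioi, Finset.mem_Iio, not_lt]
      constructor
      · rintro ⟨j, ⟨h1, h2⟩, rfl⟩
        exact lt_of_le_of_ne h2 fun h => h1.ne' (σ.injective h)
      · intro hr
        refine ⟨σ.symm r, ⟨?_, by simpa using hr.le⟩, by simp⟩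
        by_contra hc
        push Not at hc
        obtain ⟨s, rfl⟩ := σ.surjective r
        rw [Equiv.symm_apply_apply] at hc
        rcases hc.eq_or_lt with h | h
        · rw [h] at hr; exact lt_irrefl _ hr
        · have h1 : frobPos lam s < frobPos lam i := hr
          have h2 : (s : ℕ) < i := h
          have h3 : (s : ℕ) < diagLength lam := h2.trans hi
          simp only [frobPos, hi, h3, if_true] at h1
          exact absurd (frobQ_strictAnti h2 hi) (not_lt.2 h1.le)
    have hc := congrArg Finset.card himg
    rw [Finset.card_image_of_injective _ σ.injective, Fin.card_Iio] at hc
    rw [hc, hσ, frobPerm_apply, frobPos, if_pos hi]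
  · refine Finset.prod_eq_one fun j hj => if_pos ?_
    have hij' : i < j := Finset.mem_Ioi.1 hj
    have hij : (i : ℕ) < j := hij'
    have hj' : ¬ (j : ℕ) < diagLength lam := by omega
    change frobPos lam i < frobPos lam j
    have h3 := rowLen_le_of_diagLength_le (not_lt.1 hi)
    have h4 := rowLen_le_of_diagLength_le (not_lt.1 hj')
    have h5 := lam.rowLen_anti i j hij.le
    simp only [frobPos, hi, hj', if_false]
    omega

lemma prod_fin_ite_lt {M : Type*} [CommMonoid M] {d N : ℕ} (h : d ≤ N) (g : ℕ → M) :
    ∏ i : Fin N, (if (i : ℕ) < d then g i else 1) = ∏ i : Fin d, g i := by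
  rw [Fin.prod_univ_eq_prod_range (fun i => if i < d then g i else 1), Fin.prod_univ_eq_prod_range,
    ← Finset.prod_filter]
  refine Finset.prod_congr ?_ fun _ _ => rfl
  ext i; simp only [Finset.mem_filter, Finset.mem_range]; omega

lemma sign_frobPerm (lam : YoungDiagram) (N : ℕ) (hN : lam.colLen 0 ≤ N) :
    (Equiv.Perm.sign (frobPerm lam N hN) : ℤ) =
      ∏ i : Fin (diagLength lam), (-1) ^ frobQ lam i := by
  rw [← prod_fin_ite_lt ((diagLength_le_colLen lam).trans hN) fun i => (-1 : ℤ) ^ frobQ lam i,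
    Equiv.Perm.sign_eq_prod_prod_Ioi]
  push_cast
  refine Finset.prod_congr rfl fun i _ => ?_
  rw [← prod_Ioi_frobPerm lam N hN i]
  refine Finset.prod_congr rfl fun j _ => ?_
  split_ifs <;> rfl

/-- The indices below `d` among `N ≥ d` indices. -/
def finLtEquiv {d N : ℕ} (h : d ≤ N) : Fin d ≃ {i : Fin N // (i : ℕ) < d} where
  toFun i := ⟨⟨i, i.2.trans_le h⟩, i.2⟩
  invFun i := ⟨i.1, i.2⟩
  left_inv _ := rfl
  right_inv _ := rfl

/-- The minors of a normalized matrix in terms of Frobenius coordinates. -/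
lemma det_normalized {R : Type*} [CommRing R] (lam : YoungDiagram) (N : ℕ)
    (hN : lam.colLen 0 ≤ N) (b : ℤ → ℕ → R)
    (hb : ∀ i < N, ∀ j < N, b (-(i : ℤ)) j = if i = j then 1 else 0) :
    (Matrix.of fun i j : Fin N => b ((lam.rowLen i : ℤ) - i) j).det =
      (∏ i : Fin (diagLength lam), (-1) ^ frobQ lam i) *
        (Matrix.of fun i j : Fin (diagLength lam) => b ((frobP lam i : ℤ) + 1) (frobQ lam j)).det := by
  set M : Matrix (Fin N) (Fin N) R := Matrix.of fun i j : Fin N => b ((lam.rowLen i : ℤ) - i) j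
  set σ := frobPerm lam N hN with hσ
  have hd := (diagLength_le_colLen lam).trans hN
  -- Rows past the diagonal have index `lam_i - i = -frobPos i ≤ 0`, hence are unit vectors.
  -- Permuting the columns by `σ` makes the lower blocks zero and the identity, and leaves the hook
  -- entries in the upper left block.
  have hlow : ∀ i : Fin N, ¬ (i : ℕ) < diagLength lam → ∀ j, M i (σ j) = if i = j then 1 else 0 := by
    intro i hi j
    have h3 := rowLen_le_of_diagLength_le (not_lt.1 hi)
    have h1 : (lam.rowLen i : ℤ) - i = -((frobPos lam i : ℕ) : ℤ) := by
      simp only [frobPos, hi, if_false]; omega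
    simp only [M, Matrix.of_apply, h1]
    rw [hb _ (frobPos_lt hN i.2) _ (σ j).2, hσ, frobPerm_apply]
    simp only [(frobPos_injective lam).eq_iff, Fin.val_inj]
  have hdet : (M.submatrix id σ).det =
      (Matrix.of fun i j : Fin (diagLength lam) => b ((frobP lam i : ℤ) + 1) (frobQ lam j)).det := by
    rw [Matrix.twoBlockTriangular_det _ (fun i : Fin N => (i : ℕ) < diagLength lam)]
    · have h2 : ((M.submatrix id σ).toSquareBlockProp fun i : Fin N =>
          ¬ (i : ℕ) < diagLength lam) = 1 := by
        ext i j
        simp only [Matrix.toSquareBlockProp_def, Matrix.submatrix_apply, id, Matrix.of_apply]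
        rw [hlow i.1 i.2 j.1, Matrix.one_apply]
        simp only [Subtype.ext_iff]
      rw [h2, Matrix.det_one, mul_one, ← Matrix.det_submatrix_equiv_self (finLtEquiv hd)]
      congr 1
      ext i j
      have hi := lt_rowLen_of_lt_diagLength i.2
      have e1 : (lam.rowLen i : ℤ) - (i : ℕ) = (frobP lam i : ℤ) + 1 := by
        unfold frobP; omega
      have e2 : frobPos lam j = frobQ lam j := by simp [frobPos]
      change b ((lam.rowLen i : ℤ) - (i : ℕ)) (frobPos lam j) = _
      rw [e1, e2]
      rfl
    · intro i hi j hj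
      rw [Matrix.submatrix_apply, id, hlow i hi j, if_neg]
      rintro rfl; exact hi hj
  have hs : ((Equiv.Perm.sign σ : ℤ) : R) * M.det = (M.submatrix id σ).det :=
    (Matrix.det_permute' σ M).symm
  have hsign : ((Equiv.Perm.sign σ : ℤ) : R) = ∏ i : Fin (diagLength lam), (-1) ^ frobQ lam i := by
    rw [sign_frobPerm]; push_cast; rfl
  have hsq : ((Equiv.Perm.sign σ : ℤ) : R) * ((Equiv.Perm.sign σ : ℤ) : R) = 1 := by
    rw [← Int.cast_mul, Int.units_coe_mul_self, Int.cast_one]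
  rw [← hdet, ← hs, ← hsign, ← mul_assoc, hsq, one_mul]

end

/-! ### Minors indexed by partitions and by integer sequences -/

section


lemma exists_youngDiagram {N : ℕ} (g : Fin N → ℕ) (hg : Antitone g) :
    ∃ lam : YoungDiagram, lam.colLen 0 ≤ N ∧ ∀ i : Fin N, lam.rowLen i = g i := by
  have hs : (List.ofFn g).SortedGE := hg.sortedGE_ofFn
  refine ⟨YoungDiagram.ofRowLens (List.ofFn g) hs, ?_, fun i => ?_⟩
  · by_contra h
    push Not at h
    obtain ⟨h1, -⟩ := YoungDiagram.mem_ofRowLens.1 (YoungDiagram.mem_iff_lt_colLen.2 h)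
    simp at h1
  · have := YoungDiagram.rowLen_ofRowLens (hw := hs) ⟨i, by simp⟩
    simpa using this

lemma mem_hook {p q : ℕ} {c : ℕ × ℕ} :
    c ∈ hook p q ↔ (c.1 = 0 ∧ c.2 < p + 1) ∨ (0 < c.1 ∧ c.1 ≤ q ∧ c.2 = 0) := by
  obtain ⟨i, j⟩ := c
  rw [hook, YoungDiagram.mem_ofRowLens]
  rcases i with _ | i
  · simp
  · simp only [List.length_cons, List.length_replicate, List.getElem_cons_succ,
      List.getElem_replicate, exists_prop]
    omega

lemma rowLen_eq_of_mem_iff {lam : YoungDiagram} {i n : ℕ} (h : ∀ j, (i, j) ∈ lam ↔ j < n) :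
    lam.rowLen i = n := by
  have h1 : ∀ j, j < lam.rowLen i ↔ j < n := fun j => by
    rw [← h, YoungDiagram.mem_iff_lt_rowLen]
  have := h1 n
  have := h1 (lam.rowLen i)
  omega

lemma colLen_eq_of_mem_iff {lam : YoungDiagram} {j n : ℕ} (h : ∀ i, (i, j) ∈ lam ↔ i < n) :
    lam.colLen j = n := by
  have h1 : ∀ i, i < lam.colLen j ↔ i < n := fun i => by
    rw [← h, YoungDiagram.mem_iff_lt_colLen]
  have := h1 n
  have := h1 (lam.colLen j)
  omega

lemma hook_rowLen_zero (p q : ℕ) : (hook p q).rowLen 0 = p + 1 :=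
  rowLen_eq_of_mem_iff fun j => by rw [mem_hook]; simp

lemma hook_colLen_zero (p q : ℕ) : (hook p q).colLen 0 = q + 1 :=
  colLen_eq_of_mem_iff fun i => by
    rw [mem_hook]
    simp only [and_true, Order.lt_add_one_iff, Nat.zero_le]
    omega

lemma hook_diagLength (p q : ℕ) : diagLength (hook p q) = 1 := by
  have h0 := (diag_mem_iff (hook p q) 0).1 (by rw [mem_hook]; simp)
  have h1 := (diag_mem_iff (hook p q) 1).not.1 (by rw [mem_hook]; simp)
  omega

lemma hook_frobP (p q : ℕ) : frobP (hook p q) 0 = p := by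
  simp [frobP, hook_rowLen_zero]

lemma hook_frobQ (p q : ℕ) : frobQ (hook p q) 0 = q := by
  simp [frobQ, hook_colLen_zero]

/-- Rows beyond the length of `lam` do not change a unitriangular minor. -/
lemma det_stable {R : Type*} [CommRing R] (c : ℤ → ℕ → R)
    (hneg : ∀ (b : ℤ) (j : ℕ), b < -(j : ℤ) → c b j = 0) (hone : ∀ j : ℕ, c (-(j : ℤ)) j = 1)
    (lam : YoungDiagram) (N : ℕ) (hN : lam.colLen 0 ≤ N) :
    (Matrix.of fun i j : Fin N => c ((lam.rowLen i : ℤ) - i) j).det =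
      (Matrix.of fun i j : Fin (lam.colLen 0) => c ((lam.rowLen i : ℤ) - i) j).det := by
  have hrow : ∀ i, ¬ i < lam.colLen 0 → lam.rowLen i = 0 := fun i hi => by
    have := lt_rowLen_iff_lt_colLen lam i 0
    omega
  -- The additional rows are empty and sit at the indices `-i`: they vanish to the left of column
  -- `i` and equal 1 there, so the new diagonal block is unitriangular.
  rw [Matrix.twoBlockTriangular_det _ (fun i : Fin N => (i : ℕ) < lam.colLen 0)]
  · have h2 : (Matrix.toSquareBlockProp (Matrix.of fun i j : Fin N => c ((lam.rowLen i : ℤ) - i) j)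
        fun i : Fin N => ¬ (i : ℕ) < lam.colLen 0).det = 1 := by
      rw [Matrix.det_of_isUpperTriangular]
      · refine Finset.prod_eq_one fun i _ => ?_
        simp only [Matrix.toSquareBlockProp_def, Matrix.of_apply]
        rw [hrow _ i.2, Nat.cast_zero, zero_sub, hone]
      · intro i j hij
        have hij' : (j.1 : ℕ) < (i.1 : ℕ) := hij
        simp only [Matrix.toSquareBlockProp_def, Matrix.of_apply]
        rw [hrow _ i.2]
        exact hneg _ _ (by push_cast; omega)
    rw [h2, mul_one, ← Matrix.det_submatrix_equiv_self (finLtEquiv hN)]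
    rfl
  · intro i hi j hj
    simp only [Matrix.of_apply]
    rw [hrow _ hi]
    exact hneg _ _ (by push_cast; omega)

/-- A linear relation between two families of minors extends from partitions to arbitrary integer
sequences. -/
lemma det_straighten {A : Type*} [CommRing A] [Algebra ℂ A] (L : A →ₗ[ℂ] ℂ) (N : ℕ)
    (a : ℤ → Fin N → A) (b : ℤ → Fin N → ℂ)
    (ha : ∀ β : ℤ, β + N ≤ 0 → a β = 0) (hb : ∀ β : ℤ, β + N ≤ 0 → b β = 0)
    (h : ∀ lam : YoungDiagram, lam.colLen 0 ≤ N →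
      L (Matrix.of fun i : Fin N => a ((lam.rowLen i : ℤ) - i)).det =
        (Matrix.of fun i : Fin N => b ((lam.rowLen i : ℤ) - i)).det)
    (β : Fin N → ℤ) :
    L (Matrix.of fun i => a (β i)).det = (Matrix.of fun i => b (β i)).det := by
  by_cases hinj : Function.Injective β
  swap
  · simp only [Function.Injective, not_forall] at hinj
    obtain ⟨i, j, hij, hne⟩ := hinj
    rw [Matrix.det_zero_of_row_eq hne (congrArg a hij),
      Matrix.det_zero_of_row_eq hne (congrArg b hij),
      map_zero]
  by_cases hlow : ∃ i, β i + N ≤ 0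
  · obtain ⟨i, hi⟩ := hlow
    rw [Matrix.det_eq_zero_of_row_eq_zero i (by simp [ha _ hi]),
      Matrix.det_eq_zero_of_row_eq_zero i (by simp [hb _ hi]), map_zero]
  push Not at hlow
  set π := Tuple.sort (fun i => -β i) with hπ
  have hmono : StrictMono fun i => -β (π i) := by
    refine Monotone.strictMono_of_injective (Tuple.monotone_sort fun i => -β i) fun i j hij => ?_
    exact π.injective (hinj (neg_injective hij))
  have hanti : StrictAnti (β ∘ π) := fun i j hij => neg_lt_neg_iff.1 (hmono hij)
  -- A strictly decreasing integer sequence drops by at least 1 at each step, so `β (π i) + i` is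
  -- nonincreasing. Its last term is nonnegative because `β + N > 0`, and the terms are therefore
  -- the parts of a partition.
  have hstep : ∀ i j : Fin N, i ≤ j → β (π j) + j ≤ β (π i) + i := by
    have key : ∀ k : ℕ, ∀ i j : Fin N, (i : ℕ) + k = j → β (π j) + j ≤ β (π i) + i := by
      intro k
      induction k with
      | zero => intro i j hij; rw [add_zero] at hij; rw [Fin.ext hij]
      | succ k ih =>
        intro i j hij
        have h1 := ih i ⟨i + k, by omega⟩ rfl
        have h2 := hanti (show (⟨i + k, by omega⟩ : Fin N) < j from by
          rw [Fin.lt_def]; simp only; omega)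
        simp only [Function.comp_apply] at h1 h2
        push_cast at h1
        omega
    intro i j hij
    exact key (j - i) i j (by have : (i : ℕ) ≤ j := hij; omega)
  have hnonneg : ∀ i : Fin N, 0 ≤ β (π i) + i := by
    intro i
    have h3 := i.2
    have h1 := hstep i ⟨N - 1, by omega⟩ (by change (i : ℕ) ≤ N - 1; omega)
    have h2 := hlow (π ⟨N - 1, by omega⟩)
    simp only at h1
    omega
  obtain ⟨lam, hlam, hrow⟩ := exists_youngDiagram (fun i : Fin N => (β (π i) + i).toNat)
    fun i j hij => Int.toNat_le_toNat (hstep i j hij)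
  have hβ : ∀ i : Fin N, (lam.rowLen i : ℤ) - i = β (π i) := fun i => by
    rw [hrow, Int.toNat_of_nonneg (hnonneg i)]; ring
  have := h lam hlam
  simp only [hβ] at this
  have e1 : (Matrix.of fun i => a (β (π i))) = (Matrix.of fun i => a (β i)).submatrix π id := rfl
  have e2 : (Matrix.of fun i => b (β (π i))) = (Matrix.of fun i => b (β i)).submatrix π id := rfl
  rw [e1, e2, Matrix.det_permute, Matrix.det_permute] at this
  rcases Int.units_eq_one_or (Equiv.Perm.sign π) with hs | hs
  · simpa [hs] using this
  · simpa [hs] using this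

/-! ### Translations of the power sums -/

/-- Comparing coefficients of `u^n` expresses `n + 1` times the next coefficient through the
previous ones, and `n + 1` is invertible in a `ℂ`-algebra. -/
lemma powerSeries_ode_unique {A : Type*} [CommRing A] [Algebra ℂ A] {F G S : PowerSeries A}
    (hF : PowerSeries.derivative A F = F * S) (hG : PowerSeries.derivative A G = G * S)
    (h0 : PowerSeries.coeff 0 F = PowerSeries.coeff 0 G) : F = G := by
  ext n
  induction n using Nat.strong_induction_on with
  | _ n ih =>
    rcases n with _ | n
    · exact h0
    · have h1 := congrArg (PowerSeries.coeff n) hF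
      have h2 := congrArg (PowerSeries.coeff n) hG
      rw [PowerSeries.coeff_derivative, PowerSeries.coeff_mul] at h1 h2
      have h3 : ∑ p ∈ Finset.HasAntidiagonal.antidiagonal n, PowerSeries.coeff p.1 F * PowerSeries.coeff p.2 S =
          ∑ p ∈ Finset.HasAntidiagonal.antidiagonal n, PowerSeries.coeff p.1 G * PowerSeries.coeff p.2 S :=
        Finset.sum_congr rfl fun p hp => by
          rw [ih p.1 (by have := Finset.HasAntidiagonal.mem_antidiagonal.1 hp; omega)]
      rw [h3, ← h2] at h1
      have hu : IsUnit ((n : A) + 1) := by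
        have : ((n : A) + 1) = algebraMap ℂ A ((n : ℂ) + 1) := by simp
        rw [this]
        exact (IsUnit.mk0 _ (Nat.cast_add_one_ne_zero n)).map _
      exact hu.mul_left_injective h1

/-- The algebra homomorphism `p_k ↦ p_k + c_k`. -/
def translate (c : ℕ+ → ℂ) : SymFunc →ₐ[ℂ] SymFunc :=
  MvPolynomial.aeval fun k => powerSum k + algebraMap ℂ SymFunc (c k)

lemma translate_powerSum (c : ℕ+ → ℂ) (k : ℕ+) :
    translate c (powerSum k) = powerSum k + algebraMap ℂ SymFunc (c k) := by
  simp [translate, powerSum]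

lemma hasSubst_powerSumSeries : PowerSeries.HasSubst powerSumSeries := by
  refine PowerSeries.HasSubst.of_constantCoeff_zero ?_
  change PowerSeries.constantCoeff powerSumSeries = 0
  rw [← PowerSeries.coeff_zero_eq_constantCoeff_apply, powerSumSeries, PowerSeries.coeff_mk]
  simp

lemma coeff_zero_exp_subst {A : Type*} [CommRing A] [Algebra ℚ A] {F : PowerSeries A}
    (hF : PowerSeries.constantCoeff F = 0) :
    PowerSeries.coeff 0 ((PowerSeries.exp A).subst F) = 1 := by
  rw [PowerSeries.coeff_subst' (PowerSeries.HasSubst.of_constantCoeff_zero hF),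
    finsum_eq_single _ 0]
  · simp
  · intro n hn
    simp [hF, hn]

lemma complete_of_neg {m : ℤ} (hm : m < 0) : complete m = 0 := if_neg (not_le.2 hm)

lemma complete_zero : complete 0 = 1 := by
  rw [complete, if_pos le_rfl]
  refine coeff_zero_exp_subst ?_
  rw [← PowerSeries.coeff_zero_eq_constantCoeff_apply, powerSumSeries, PowerSeries.coeff_mk]
  simp

/-- The `e m` are the coefficients of `C(u) = exp (∑ c_k u^k / k)`: translation sends `H(u)` to
`H(u) C(u)`, both sides solving the same first-order linear equation with constant term 1. The
summation bound `M > n` is left free, since terms with `m > n` vanish; one `M` can then serve all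
entries of a matrix. -/
lemma exists_translate_complete (c : ℕ+ → ℂ) : ∃ e : ℕ → ℂ, e 0 = 1 ∧
    ∀ (n : ℤ) (M : ℕ), n < M →
      translate c (complete n) = ∑ m ∈ Finset.range M, e m • complete (n - m) := by
  set c0 : PowerSeries ℂ := PowerSeries.mk fun n => if h : 0 < n then (n : ℂ)⁻¹ * c ⟨n, h⟩ else 0
  have hc0 : PowerSeries.constantCoeff c0 = 0 := by
    rw [← PowerSeries.coeff_zero_eq_constantCoeff_apply, PowerSeries.coeff_mk]; simp
  set C : PowerSeries ℂ := (PowerSeries.exp ℂ).subst c0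
  have hC : PowerSeries.derivative ℂ C = C * PowerSeries.derivative ℂ c0 := by
    rw [PowerSeries.derivative_subst (PowerSeries.HasSubst.of_constantCoeff_zero hc0),
      PowerSeries.derivative_exp]
  have hH : PowerSeries.derivative SymFunc completeSeries =
      completeSeries * PowerSeries.derivative SymFunc powerSumSeries := by
    rw [completeSeries, PowerSeries.derivative_subst hasSubst_powerSumSeries,
      PowerSeries.derivative_exp]
  set t : SymFunc →+* SymFunc := (translate c : SymFunc →+* SymFunc)
  set al : ℂ →+* SymFunc := algebraMap ℂ SymFunc
  have hmapd : ∀ {A B : Type} [CommRing A] [CommRing B] (φ : A →+* B) (F : PowerSeries A),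
      PowerSeries.derivative B (PowerSeries.map φ F) =
        PowerSeries.map φ (PowerSeries.derivative A F) := by
    intro A B _ _ φ F
    ext n
    simp [PowerSeries.coeff_derivative]
  have hP : PowerSeries.map t powerSumSeries = powerSumSeries + PowerSeries.map al c0 := by
    ext1 n
    simp only [PowerSeries.coeff_map, map_add, powerSumSeries, c0, PowerSeries.coeff_mk]
    split_ifs with h
    · simp only [t, al, RingHom.coe_coe, map_smul, map_mul]
      refine (congrArg (_ • ·) (translate_powerSum c ⟨n, h⟩)).trans ?_
      simp only [Algebra.smul_def]
      exact mul_add _ _ _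
    · simp
  have hkey : PowerSeries.map t completeSeries = completeSeries * PowerSeries.map al C := by
    refine powerSeries_ode_unique (S := PowerSeries.derivative SymFunc
      (PowerSeries.map t powerSumSeries)) ?_ ?_ ?_
    · rw [hmapd, hH, map_mul, hmapd]
    · rw [hP, map_add, Derivation.leibniz, hH, hmapd, hC, map_mul, hmapd]
      simp only [smul_eq_mul]
      ring
    · have h1 : PowerSeries.coeff 0 completeSeries = 1 := by
        have := complete_zero
        rwa [complete, if_pos le_rfl] at this
      have h2 : PowerSeries.coeff 0 C = 1 := coeff_zero_exp_subst hc0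
      rw [PowerSeries.coeff_map, h1, map_one, PowerSeries.coeff_zero_eq_constantCoeff_apply, map_mul,
        ← PowerSeries.coeff_zero_eq_constantCoeff_apply,
        ← PowerSeries.coeff_zero_eq_constantCoeff_apply, PowerSeries.coeff_map, h1, h2, map_one,
        one_mul]
  refine ⟨fun m => PowerSeries.coeff m C, coeff_zero_exp_subst hc0, fun n M hnM => ?_⟩
  rcases lt_or_ge n 0 with hn | hn
  · rw [complete_of_neg hn, map_zero, Finset.sum_eq_zero]
    intro m _
    rw [complete_of_neg (by omega), smul_zero]
  · lift n to ℕ using hn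
    have h1 : translate c (complete n) = PowerSeries.coeff n (PowerSeries.map t completeSeries) := by
      rw [complete, if_pos (Int.natCast_nonneg n), PowerSeries.coeff_map, Int.toNat_natCast]; rfl
    rw [h1, hkey, mul_comm, PowerSeries.coeff_mul, Finset.Nat.sum_antidiagonal_eq_sum_range_succ_mk]
    have h2 : Finset.range n.succ ⊆ Finset.range M := Finset.range_mono (by omega)
    rw [← Finset.sum_subset h2]
    · refine Finset.sum_congr rfl fun m hm => ?_
      have hm' : m ≤ n := Nat.lt_succ_iff.1 (Finset.mem_range.1 hm)
      simp only
      rw [PowerSeries.coeff_map, Algebra.smul_def, complete, if_pos (by omega)]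
      congr 3
      omega
    · intro m _ hm
      rw [complete_of_neg, smul_zero]
      simp only [Finset.mem_range, not_lt] at hm
      omega

end

/-! ### Giambelli functionals and their invariance under translation -/

section


/-- The Giambelli identities for a linear functional on symmetric functions. -/
def IsGiambelliFunctional (L : SymFunc →ₗ[ℂ] ℂ) : Prop :=
  ∀ lam : YoungDiagram, L (schur lam) =
    Matrix.det (Matrix.of fun i j : Fin (diagLength lam) =>
      L (schur (hook (frobP lam i) (frobQ lam j))))

lemma schur_eq_det (lam : YoungDiagram) (N : ℕ) (hN : lam.colLen 0 ≤ N) :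
    schur lam = (Matrix.of fun i j : Fin N => complete ((lam.rowLen i : ℤ) - i + j)).det := by
  have := det_stable (fun (b : ℤ) (j : ℕ) => complete (b + j))
    (fun b j hb => complete_of_neg (by omega)) (fun j => by rw [neg_add_cancel, complete_zero])
    lam N hN
  exact this.symm

/-- The normalized matrix attached to a functional: its rows at `b ≤ 0` are unit vectors, its rows
at `b ≥ 1` are given by the values at hooks. -/
def hookMatrix (L : SymFunc →ₗ[ℂ] ℂ) (b : ℤ) (j : ℕ) : ℂ :=
  if b ≤ 0 then (if b = -(j : ℤ) then 1 else 0) else (-1) ^ j * L (schur (hook (b - 1).toNat j))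

lemma hookMatrix_of_lt (L : SymFunc →ₗ[ℂ] ℂ) {b : ℤ} {j : ℕ} (h : b < -(j : ℤ)) :
    hookMatrix L b j = 0 := by
  rw [hookMatrix, if_pos (by omega), if_neg h.ne]

lemma hookMatrix_neg (L : SymFunc →ₗ[ℂ] ℂ) (i j : ℕ) :
    hookMatrix L (-(i : ℤ)) j = if i = j then 1 else 0 := by
  rw [hookMatrix, if_pos (by omega)]
  simp

/-- For partitions this is the Giambelli identity itself, once `det_normalized` has rewritten the
minor in Frobenius coordinates; the signs `(-1)^(q_j)` from the permutation and from `hookMatrix`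
cancel. Straightening then allows arbitrary integer sequences, which are needed because shifting the
rows of a partition leaves the set of partitions. -/
lemma IsGiambelliFunctional.apply_det {L : SymFunc →ₗ[ℂ] ℂ} (hL : IsGiambelliFunctional L)
    {N : ℕ} (β : Fin N → ℤ) :
    L (Matrix.of fun i j : Fin N => complete (β i + j)).det =
      (Matrix.of fun i j : Fin N => hookMatrix L (β i) j).det := by
  refine det_straighten L N (fun b j => complete (b + j)) (fun b j => hookMatrix L b j) ?_ ?_ ?_ β
  · intro b hb; funext j
    exact complete_of_neg (by have := j.2; omega)
  · intro b hb; funext j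
    exact hookMatrix_of_lt L (by have := j.2; omega)
  · intro lam hlam
    have h1 := schur_eq_det lam N hlam
    have h2 := det_normalized lam N hlam (hookMatrix L) fun i _ j _ => hookMatrix_neg L i j
    refine (congrArg L h1.symm).trans ?_
    refine Eq.trans ?_ h2.symm
    rw [hL lam]
    have h3 : (Matrix.of fun i j : Fin (diagLength lam) =>
        hookMatrix L ((frobP lam i : ℤ) + 1) (frobQ lam j)) =
        Matrix.of fun i j : Fin (diagLength lam) => (-1) ^ frobQ lam j *
          (Matrix.of fun i j : Fin (diagLength lam) =>
            L (schur (hook (frobP lam i) (frobQ lam j)))) i j := by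
      ext i j
      simp only [Matrix.of_apply]
      rw [hookMatrix, if_neg (by omega), add_sub_cancel_right, Int.toNat_natCast]
    rw [h3, Matrix.det_mul_row, ← mul_assoc, ← Finset.prod_mul_distrib]
    simp [← mul_pow]

/-- The rows of the matrix attached to the translated functional. -/
def convolve (e : ℕ → ℂ) (B : ℤ → ℕ → ℂ) (b : ℤ) (j : ℕ) : ℂ :=
  ∑ m ∈ Finset.range ((b + j).toNat + 1), e m * B (b - m) j

lemma convolve_eq_sum {e : ℕ → ℂ} {B : ℤ → ℕ → ℂ}
    (hB : ∀ (b : ℤ) (j : ℕ), b < -(j : ℤ) → B b j = 0) {b : ℤ} {j M : ℕ} (hM : b + j < M) :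
    convolve e B b j = ∑ m ∈ Finset.range M, e m * B (b - m) j := by
  rw [convolve]
  rcases Nat.lt_or_ge M ((b + j).toNat + 1) with h | h
  · have hb : b + j < 0 := by omega
    rw [Finset.sum_eq_zero, Finset.sum_eq_zero]
    all_goals
      intro m _
      rw [hB _ _ (by omega), mul_zero]
  · refine Finset.sum_subset (Finset.range_mono h) fun m _ hm => ?_
    rw [hB, mul_zero]
    simp only [Finset.mem_range, not_lt] at hm
    omega

/-- A translated row is a combination of shifted rows whose coefficients `e m` do not depend on the
column. Expanding both determinants multilinearly in the rows matches them term by term through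
`apply_det`. -/
lemma IsGiambelliFunctional.apply_translate_det {L : SymFunc →ₗ[ℂ] ℂ}
    (hL : IsGiambelliFunctional L) {c : ℕ+ → ℂ} {e : ℕ → ℂ}
    (he : ∀ (n : ℤ) (M : ℕ), n < M →
      translate c (complete n) = ∑ m ∈ Finset.range M, e m • complete (n - m))
    {N : ℕ} (β : Fin N → ℤ) :
    L (translate c (Matrix.of fun i j : Fin N => complete (β i + j)).det) =
      (Matrix.of fun i j : Fin N => convolve e (hookMatrix L) (β i) j).det := by
  obtain ⟨M, hM⟩ : ∃ M : ℕ, ∀ i j : Fin N, β i + j < M := by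
    refine ⟨∑ i, (β i).natAbs + N + 1, fun i j => ?_⟩
    have h1 : (β i).natAbs ≤ ∑ i, (β i).natAbs :=
      Finset.single_le_sum (f := fun i => (β i).natAbs) (fun _ _ => Nat.zero_le _)
        (Finset.mem_univ i)
    have := j.2
    generalize ∑ i, (β i).natAbs = s at h1
    push_cast
    omega
  have h1 : translate c (Matrix.of fun i j : Fin N => complete (β i + j)).det =
      ∑ r ∈ Fintype.piFinset fun _ : Fin N => Finset.range M, (∏ i, e (r i)) •
        (Matrix.of fun i j : Fin N => complete (β i - r i + j)).det := by
    rw [AlgHom.map_det]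
    have h2 : (translate c).mapMatrix (Matrix.of fun i j : Fin N => complete (β i + j)) =
        fun i => ∑ m ∈ Finset.range M, e m • fun j : Fin N => complete (β i - m + j) := by
      funext i j
      rw [Finset.sum_apply]
      change translate c (complete (β i + j)) = _
      rw [he _ M (hM i j)]
      refine Finset.sum_congr rfl fun m _ => ?_
      rw [Pi.smul_apply]
      congr 2; ring
    have h3 := ((Matrix.detRowAlternating (n := Fin N) (R := SymFunc)).toMultilinearMap.restrictScalars
      ℂ).map_sum_finset (fun i m => e m • fun j : Fin N => complete (β i - m + j))
      fun _ => Finset.range M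
    rw [h2]
    refine h3.trans (Finset.sum_congr rfl fun r _ => ?_)
    rw [MultilinearMap.map_smul_univ]
    rfl
  have h4 : (Matrix.of fun i j : Fin N => convolve e (hookMatrix L) (β i) j).det =
      ∑ r ∈ Fintype.piFinset fun _ : Fin N => Finset.range M, (∏ i, e (r i)) •
        (Matrix.of fun i j : Fin N => hookMatrix L (β i - r i) j).det := by
    have h2 : (Matrix.of fun i j : Fin N => convolve e (hookMatrix L) (β i) j) =
        fun i => ∑ m ∈ Finset.range M, e m • fun j : Fin N => hookMatrix L (β i - m) j := by
      funext i j
      rw [Finset.sum_apply]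
      exact convolve_eq_sum (fun b j h => hookMatrix_of_lt L h) (hM i j)
    have h3 := (Matrix.detRowAlternating (n := Fin N) (R := ℂ)).toMultilinearMap.map_sum_finset
      (fun i m => e m • fun j : Fin N => hookMatrix L (β i - m) j) fun _ => Finset.range M
    rw [h2]
    refine h3.trans (Finset.sum_congr rfl fun r _ => ?_)
    rw [MultilinearMap.map_smul_univ]
    rfl
  rw [h1, h4, map_sum]
  refine Finset.sum_congr rfl fun r _ => ?_
  rw [map_smul, hL.apply_det fun i => β i - r i]

/-- Minors of a unitriangular matrix satisfy the Giambelli identities. -/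
lemma det_unitriangular_giambelli (B : ℤ → ℕ → ℂ)
    (hneg : ∀ (b : ℤ) (j : ℕ), b < -(j : ℤ) → B b j = 0) (hone : ∀ j : ℕ, B (-(j : ℤ)) j = 1)
    (D : YoungDiagram → ℂ)
    (hD : ∀ lam, D lam =
      (Matrix.of fun i j : Fin (lam.colLen 0) => B ((lam.rowLen i : ℤ) - i) j).det)
    (lam : YoungDiagram) :
    D lam = (Matrix.of fun i j : Fin (diagLength lam) =>
      D (hook (frobP lam i) (frobQ lam j))).det := by
  set N := lam.colLen 0
  -- Multiplication on the right by `U⁻¹` turns the rows at `0, -1, …, 1 - N` into unit vectors. As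
  -- `det U = 1`, no `N × N` minor changes, and the normalized case applies.
  set U : Matrix (Fin N) (Fin N) ℂ := Matrix.of fun i j => B (-(i : ℤ)) j
  have hU : U.det = 1 := by
    rw [Matrix.det_of_isUpperTriangular]
    · exact Finset.prod_eq_one fun i _ => hone i
    · intro i j hij
      have hij' : (j : ℕ) < i := hij
      exact hneg _ _ (by omega)
  have hUu : IsUnit U.det := by rw [hU]; exact isUnit_one
  let b : ℤ → ℕ → ℂ := fun β j =>
    if h : j < N then ∑ k : Fin N, B β k * U⁻¹ k ⟨j, h⟩ else 0
  have hb : ∀ i < N, ∀ j < N, b (-(i : ℤ)) j = if i = j then 1 else 0 := by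
    intro i hi j hj
    have h1 : (U * U⁻¹) ⟨i, hi⟩ ⟨j, hj⟩ = b (-(i : ℤ)) j := by
      simp only [b, hj, dif_pos, Matrix.mul_apply]
      rfl
    rw [← h1, Matrix.mul_nonsing_inv _ hUu, Matrix.one_apply]
    simp [Fin.ext_iff]
  have hdet : ∀ β : Fin N → ℤ, (Matrix.of fun i j : Fin N => B (β i) j).det =
      (Matrix.of fun i j : Fin N => b (β i) j).det := by
    intro β
    have h1 : (Matrix.of fun i j : Fin N => b (β i) j) =
        (Matrix.of fun i j : Fin N => B (β i) j) * U⁻¹ := by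
      ext i j
      simp [b, Matrix.mul_apply]
    rw [h1, Matrix.det_mul, Matrix.det_nonsing_inv, hU]
    simp
  have hDN : ∀ nu : YoungDiagram, nu.colLen 0 ≤ N → D nu =
      (∏ i : Fin (diagLength nu), (-1) ^ frobQ nu i) *
        (Matrix.of fun i j : Fin (diagLength nu) => b ((frobP nu i : ℤ) + 1) (frobQ nu j)).det := by
    intro nu hnu
    rw [hD, ← det_stable B hneg hone nu N hnu, hdet fun i => (nu.rowLen i : ℤ) - i,
      det_normalized nu N hnu b hb]
  have hhook : ∀ p q, q < N → D (hook p q) = (-1) ^ q * b ((p : ℤ) + 1) q := by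
    intro p q hq
    have h1 := hDN (hook p q) (by rw [hook_colLen_zero]; exact hq)
    rw [h1]
    have h2 := hook_diagLength p q
    -- The size `d` is generalized because the diagonal length of a hook equals 1 only
    -- propositionally.
    have h3 : ∀ (d : ℕ), d = 1 → (∏ i : Fin d, (-1 : ℂ) ^ frobQ (hook p q) i) *
        (Matrix.of fun i j : Fin d =>
          b ((frobP (hook p q) i : ℤ) + 1) (frobQ (hook p q) j)).det =
        (-1) ^ q * b ((p : ℤ) + 1) q := by
      rintro d rfl
      rw [Matrix.det_unique]
      simp [hook_frobP, hook_frobQ]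
    exact h3 _ h2
  rw [hDN lam le_rfl]
  have h5 : (Matrix.of fun i j : Fin (diagLength lam) => D (hook (frobP lam i) (frobQ lam j))) =
      Matrix.of fun i j : Fin (diagLength lam) => (-1) ^ frobQ lam j * (Matrix.of fun i j : Fin (diagLength lam) =>
        b ((frobP lam i : ℤ) + 1) (frobQ lam j)) i j := by
    ext i j
    exact hhook _ _ (frobQ_lt j.2)
  rw [h5, Matrix.det_mul_row]

/-- Convolution with `e`, where `e 0 = 1`, moves rows only towards larger indices. It preserves both
the zeros at `b < -j` and the ones at `b = -j`. -/
theorem IsGiambelliFunctional.translate {L : SymFunc →ₗ[ℂ] ℂ} (hL : IsGiambelliFunctional L)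
    (c : ℕ+ → ℂ) : IsGiambelliFunctional (L ∘ₗ (translate c).toLinearMap) := by
  obtain ⟨e, he0, he⟩ := exists_translate_complete c
  refine det_unitriangular_giambelli (convolve e (hookMatrix L)) ?_ ?_
    (fun lam => L (PointProcess.translate c (schur lam))) ?_
  · intro b j hb
    refine Finset.sum_eq_zero fun m _ => ?_
    rw [hookMatrix_of_lt L (by omega), mul_zero]
  · intro j
    rw [convolve_eq_sum (M := 1) (fun b j h => hookMatrix_of_lt L h) (by simp)]
    simp [he0, hookMatrix_neg]
  · intro lam
    exact hL.apply_translate_det he fun i => (lam.rowLen i : ℤ) - i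

/-- Used twice: with `c k` the contribution of the frozen outer configuration, and with `c k` minus
the mean of a power sum. -/
theorem GiambelliCompatible.translate {E : Set ℝ} {Q : Measure (Configuration E)}
    {a : ℕ+ → Configuration E → ℂ} (h : GiambelliCompatible Q (specialize a)) (c : ℕ+ → ℂ) :
    GiambelliCompatible Q (specialize fun k X => a k X + c k) := by
  obtain ⟨hint, hdet⟩ := h
  have hsp : ∀ F : SymFunc, specialize (fun k X => a k X + c k) F =
      specialize a (PointProcess.translate c F) := by
    intro F
    have : specialize (fun k X => a k X + c k) = (specialize a).comp (PointProcess.translate c) := by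
      refine MvPolynomial.algHom_ext fun k => ?_
      have := translate_powerSum c k
      rw [powerSum] at this
      rw [AlgHom.comp_apply, this, map_add, AlgHom.commutes, specialize, specialize,
        MvPolynomial.aeval_X, MvPolynomial.aeval_X]
      rfl
    rw [this, AlgHom.comp_apply]
  let L : SymFunc →ₗ[ℂ] ℂ :=
    { toFun := fun F => ∫ X, specialize a F X ∂Q
      map_add' := fun F G => by
        simp only [map_add, Pi.add_apply]
        exact integral_add (hint F) (hint G)
      map_smul' := fun z F => by
        simp only [map_smul, Pi.smul_apply, smul_eq_mul, RingHom.id_apply]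
        exact integral_const_mul _ _ }
  have hL : IsGiambelliFunctional L := hdet
  refine ⟨fun F => by rw [hsp]; exact hint _, fun lam => ?_⟩
  simp only [hsp]
  exact hL.translate c lam

end

section


/-! ### Cauchy-Schwarz for products along a permutation -/

section Finner

variable {ι X : Type*} [DecidableEq ι] [MeasurableSpace X]

open scoped ENNReal

/-- The Cauchy-Schwarz inequality for a product of functions on `X^ι`, each variable occurring in
exactly two of the factors. -/
lemma lmarginal_prod_le [Fintype ι] (μ : Measure X) [SigmaFinite μ] (F : ι → (ι → X) → ℝ≥0∞)
    (hF : ∀ i, Measurable (F i)) (D : ι → Finset ι)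
    (hD : ∀ i a, a ∉ D i → ∀ x y, F i (Function.update x a y) = F i x)
    (h2 : ∀ a, ∃ i₁ i₂, i₁ ≠ i₂ ∧ ∀ i, a ∈ D i ↔ i = i₁ ∨ i = i₂) (s : Finset ι) (x : ι → X) :
    lmarginal (fun _ => μ) s (fun x => ∏ i, F i x) x ≤
      ∏ i, (lmarginal (fun _ => μ) (s ∩ D i) (fun x => F i x ^ (2 : ℝ)) x) ^ (1 / 2 : ℝ) := by
  have hF2 : ∀ i, Measurable fun x => F i x ^ (2 : ℝ) := fun i => (hF i).pow_const _
  induction s using Finset.induction generalizing x with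
  | empty =>
    simp only [lmarginal_empty, Finset.empty_inter]
    refine Finset.prod_le_prod' fun i _ => ?_
    rw [← ENNReal.rpow_mul]; norm_num
  | insert a s ha ih =>
    obtain ⟨i₁, i₂, hne, h2a⟩ := h2 a
    rw [lmarginal_insert _ (Finset.measurable_fun_prod _ fun i _ => hF i) ha]
    set G : ι → X → ℝ≥0∞ := fun i y =>
      lmarginal (fun _ => μ) (s ∩ D i) (fun x => F i x ^ (2 : ℝ)) (Function.update x a y) with hG
    have hGm : ∀ i, Measurable (G i) := fun i =>
      ((hF2 i).lmarginal _).comp (measurable_update x)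
    have hGc : ∀ i, a ∉ D i → ∀ y, G i y =
        lmarginal (fun _ => μ) (insert a s ∩ D i) (fun x => F i x ^ (2 : ℝ)) x := by
      intro i hi y
      rw [Finset.insert_inter_of_notMem hi]
      simp only [hG]
      rw [lmarginal_update_of_notMem (hF2 i) (by simp [ha])]
      congr 1
      funext z
      simp only [Function.comp_apply]
      rw [hD i a hi]
    have hGi : ∀ i, a ∈ D i → ∫⁻ y, G i y ∂μ =
        lmarginal (fun _ => μ) (insert a s ∩ D i) (fun x => F i x ^ (2 : ℝ)) x := by
      intro i hi
      rw [Finset.insert_inter_of_mem hi, lmarginal_insert _ (hF2 i) (by simp [ha])]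
    -- After the induction hypothesis only the factors `i₁` and `i₂` depend on the variable `a`; the
    -- others leave the integral, and Cauchy-Schwarz is applied to these two.
    refine (lintegral_mono fun y => ih (Function.update x a y)).trans ?_
    change ∫⁻ y, ∏ i, G i y ^ (1 / 2 : ℝ) ∂μ ≤ _
    have hsplit : ∀ g : ι → ℝ≥0∞, ∏ i, g i =
        (g i₁ * g i₂) * ∏ i ∈ (Finset.univ.erase i₁).erase i₂, g i := fun g => by
      rw [mul_assoc, Finset.mul_prod_erase _ _ (Finset.mem_erase.2 ⟨hne.symm, Finset.mem_univ _⟩),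
        Finset.mul_prod_erase _ _ (Finset.mem_univ _)]
    have hrest : ∀ y, ∏ i ∈ (Finset.univ.erase i₁).erase i₂, G i y ^ (1 / 2 : ℝ) =
        ∏ i ∈ (Finset.univ.erase i₁).erase i₂,
          (lmarginal (fun _ => μ) (insert a s ∩ D i) (fun x => F i x ^ (2 : ℝ)) x) ^ (1 / 2 : ℝ) := by
      intro y
      refine Finset.prod_congr rfl fun i hi => ?_
      simp only [Finset.mem_erase, Finset.mem_univ, and_true] at hi
      rw [hGc i fun h => by rcases (h2a i).1 h with h | h <;> simp_all]
    rw [hsplit]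
    simp_rw [hsplit (fun i => G i _ ^ (1 / 2 : ℝ)), hrest]
    rw [lintegral_mul_const _ (by
      exact ((hGm _).pow_const _).mul ((hGm _).pow_const _))]
    gcongr ?_ * _
    rw [← hGi i₁ ((h2a _).2 (Or.inl rfl)), ← hGi i₂ ((h2a _).2 (Or.inr rfl))]
    have hCS := ENNReal.lintegral_mul_le_Lp_mul_Lq μ Real.HolderConjugate.two_two
      ((hGm i₁).pow_const (1 / 2 : ℝ)).aemeasurable ((hGm i₂).pow_const (1 / 2 : ℝ)).aemeasurable
    have e : ∀ i y, (G i y ^ (1 / 2 : ℝ)) ^ (2 : ℝ) = G i y := fun i y => by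
      rw [← ENNReal.rpow_mul]; norm_num
    simp only [Pi.mul_apply, e] at hCS
    exact hCS

/-- Without fixed points, the variable `x_a` occurs in exactly two factors, those with index `a` and
`σ⁻¹ a`. -/
lemma lintegral_prod_perm_le [Fintype ι] (μ : Measure X) [SigmaFinite μ] (k : X → X → ℝ≥0∞)
    (hk : Measurable (Function.uncurry k)) (σ : Equiv.Perm ι) (hσ : ∀ i, σ i ≠ i) :
    ∫⁻ x : ι → X, ∏ i, k (x (σ i)) (x i) ∂(Measure.pi fun _ => μ) ≤
      ((∫⁻ x, ∫⁻ y, k x y ^ (2 : ℝ) ∂μ ∂μ) ^ (1 / 2 : ℝ)) ^ Fintype.card ι := by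
  rcases isEmpty_or_nonempty (ι → X) with hX | ⟨⟨x₀⟩⟩
  · rw [lintegral_of_isEmpty]; exact zero_le
  have hm : ∀ i, Measurable fun x : ι → X => k (x (σ i)) (x i) := fun i => by
    have := hk.comp ((measurable_pi_apply (X := fun _ : ι => X) (σ i)).prodMk (measurable_pi_apply i))
    exact this
  rw [lintegral_eq_lmarginal_univ x₀]
  refine (lmarginal_prod_le μ (fun i x => k (x (σ i)) (x i)) hm (fun i => {σ i, i}) ?_ ?_
    Finset.univ x₀).trans_eq ?_
  · intro i a ha x y
    simp only [Finset.mem_insert, Finset.mem_singleton, not_or] at ha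
    rw [Function.update_of_ne (Ne.symm ha.1), Function.update_of_ne (Ne.symm ha.2)]
  · intro a
    refine ⟨σ.symm a, a, fun h => hσ a ((Equiv.eq_symm_apply σ).1 h.symm), fun i => ?_⟩
    · simp only [Finset.mem_insert, Finset.mem_singleton, Equiv.eq_symm_apply]
      exact or_congr eq_comm eq_comm
  · rw [← Finset.card_univ, ← Finset.prod_const]
    refine Finset.prod_congr rfl fun i _ => ?_
    congr 1
    rw [Finset.univ_inter, lmarginal_insert _ ((hm i).pow_const _) (by simpa using hσ i)]
    refine lintegral_congr fun y => ?_
    rw [lmarginal_singleton]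
    refine lintegral_congr fun z => ?_
    rw [Function.update_self, Function.update_of_ne (hσ i), Function.update_self]

end Finner

/-! ### Determinants with the diagonal removed, and the regularized Fredholm determinant -/

section DetExpansion

variable {ι X : Type*} [Fintype ι] [DecidableEq ι] [MeasurableSpace X]

open scoped ENNReal

/-- The matrix `K(x_i, x_j)` with the diagonal replaced by zeros. -/
def zeroDiag (K : X → X → ℂ) (x : ι → X) : Matrix ι ι ℂ :=
  Matrix.of fun i j => if i = j then 0 else K (x i) (x j)

/-- The squared Hilbert-Schmidt norm of the kernel `g(x) K(x, y)`. -/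
def hilbertSchmidtSq (μ : Measure X) (K : X → X → ℂ) (g : X → ℂ) : ℝ≥0∞ :=
  ∫⁻ x, ∫⁻ y, (‖g x‖ₑ * ‖K x y‖ₑ) ^ (2 : ℝ) ∂μ ∂μ

lemma measurable_det {M : X → Matrix ι ι ℂ} (hM : ∀ i j, Measurable fun x => M x i j) :
    Measurable fun x => (M x).det := by
  simp only [Matrix.det_apply]
  refine Finset.measurable_fun_sum _ fun σ _ => ?_
  exact (Finset.measurable_fun_prod _ fun i _ => hM _ _).const_smul _

omit [Fintype ι] in
lemma measurable_zeroDiag {K : X → X → ℂ} (hK : Measurable (Function.uncurry K)) (i j : ι) :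
    Measurable fun x : ι → X => zeroDiag K x i j := by
  by_cases h : i = j
  · simp [zeroDiag, h]
  · simp only [zeroDiag, Matrix.of_apply, h, if_false]
    have := hK.comp ((measurable_pi_apply (X := fun _ : ι => X) i).prodMk (measurable_pi_apply j))
    exact this

omit [DecidableEq ι] in
lemma enorm_prod_eq (f : ι → ℂ) : ‖∏ i, f i‖ₑ = ∏ i, ‖f i‖ₑ := by
  simp [enorm, nnnorm_prod]

/-- With the diagonal removed only derangements survive in the Leibniz formula, each contributes at
most the `n`-th power of the Hilbert-Schmidt norm, and there are at most `n!` of them. No trace of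
`g K` enters, which is the purpose of the regularization. -/
lemma lintegral_zeroDiag_le (μ : Measure X) [SigmaFinite μ] {K : X → X → ℂ}
    (hK : Measurable (Function.uncurry K)) {g : X → ℂ} (hg : Measurable g) :
    ∫⁻ x : ι → X, ‖(∏ i, g (x i)) * (zeroDiag K x).det‖ₑ ∂(Measure.pi fun _ => μ) ≤
      ((Fintype.card ι).factorial : ℝ≥0∞) *
        (hilbertSchmidtSq μ K g ^ (1 / 2 : ℝ)) ^ Fintype.card ι := by
  have hk : Measurable (Function.uncurry fun x y => ‖g x‖ₑ * ‖K x y‖ₑ) :=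
    (hg.comp measurable_fst).enorm.mul hK.enorm
  have hpt : ∀ x : ι → X, ‖(∏ i, g (x i)) * (zeroDiag K x).det‖ₑ ≤
      ∑ σ : Equiv.Perm ι, if ∀ i, σ i ≠ i then ∏ i, (‖g (x (σ i))‖ₑ * ‖K (x (σ i)) (x i)‖ₑ)
        else 0 := by
    intro x
    rw [Matrix.det_apply, Finset.mul_sum]
    refine (enorm_sum_le _ _).trans (Finset.sum_le_sum fun σ _ => ?_)
    split_ifs with h
    · have hs : ‖Equiv.Perm.sign σ • ∏ i, zeroDiag K x (σ i) i‖ₑ = ∏ i, ‖K (x (σ i)) (x i)‖ₑ := by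
        have h1 : ∏ i, zeroDiag K x (σ i) i = ∏ i, K (x (σ i)) (x i) :=
          Finset.prod_congr rfl fun i _ => by simp [zeroDiag, h i]
        rw [h1]
        rcases Int.units_eq_one_or (Equiv.Perm.sign σ) with hs | hs <;>
          simp [hs, enorm_prod_eq]
      rw [enorm_mul, hs, Finset.prod_mul_distrib, enorm_prod_eq,
        Equiv.prod_comp σ fun i => ‖g (x i)‖ₑ]
    · push Not at h
      obtain ⟨i, hi⟩ := h
      have h0 : ∏ i, zeroDiag K x (σ i) i = 0 :=
        Finset.prod_eq_zero (Finset.mem_univ i) (by simp [zeroDiag, hi])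
      rw [h0]
      simp
  refine (lintegral_mono hpt).trans ?_
  rw [lintegral_finsetSum]
  · refine (Finset.sum_le_sum (g := fun _ => (hilbertSchmidtSq μ K g ^ (1 / 2 : ℝ)) ^ Fintype.card ι)
      fun σ _ => ?_).trans_eq ?_
    · split_ifs with h
      · exact lintegral_prod_perm_le μ (fun x y => ‖g x‖ₑ * ‖K x y‖ₑ) hk σ h
      · simp
    · simp [Fintype.card_perm]
  · intro σ _
    split_ifs with h
    · refine Finset.measurable_fun_prod _ fun i _ => ?_
      have := hk.comp ((measurable_pi_apply (X := fun _ : ι => X) (σ i)).prodMk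
        (measurable_pi_apply i))
      exact this
    · exact measurable_const

/-- Each row is split into its off-diagonal part and its diagonal entry, and the determinant is
expanded by multilinearity. `S` is the set of rows where the off-diagonal part is chosen; the other
rows split off as a diagonal block. -/
lemma det_eq_sum_zeroDiag {R : Type*} [CommRing R] (A : Matrix ι ι R) :
    A.det = ∑ S : Finset ι, (∏ i : {i // i ∉ S}, A i i) *
      (Matrix.of fun i j : {i // i ∈ S} => if i = j then 0 else A i j).det := by
  have h1 : A = ((fun i => (fun j => if i = j then 0 else A i j)) +
      fun i => Pi.single i (A i i) : ι → ι → R) := by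
    funext i j
    change A i j = (if i = j then 0 else A i j) + (Pi.single i (A i i) : ι → R) j
    rcases eq_or_ne i j with rfl | h
    · rw [if_pos rfl, Pi.single_eq_same, zero_add]
    · rw [if_neg h, Pi.single_eq_of_ne h.symm, add_zero]
  have h2 := (Matrix.detRowAlternating (n := ι) (R := R)).toMultilinearMap.map_add_univ
    (fun i => (fun j => if i = j then 0 else A i j)) fun i => Pi.single i (A i i)
  refine (congrArg Matrix.det h1).trans (h2.trans (Finset.sum_congr rfl fun S _ => ?_))
  let M : Matrix ι ι R := Matrix.of fun i j =>
    if i ∈ S then (if i = j then 0 else A i j) else if i = j then A i i else 0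
  have hM : S.piecewise (fun i => (fun j => if i = j then 0 else A i j))
      (fun i => Pi.single i (A i i)) = (fun i j => M i j) := by
    funext i j
    by_cases hi : i ∈ S
    · simp only [Finset.piecewise_eq_of_mem _ _ _ hi, M, Matrix.of_apply, hi, if_true]
    · simp only [Finset.piecewise_eq_of_notMem _ _ _ hi, M, Matrix.of_apply, hi, if_false,
        Pi.single_apply, eq_comm]
  rw [hM]
  change M.det = _
  have e1 : (M.toSquareBlockProp fun i => ¬ i ∈ S) =
      Matrix.diagonal fun i : {i // i ∉ S} => A i i := by
    ext i j
    simp only [Matrix.toSquareBlockProp_def, Matrix.of_apply, M, i.2, if_false,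
      Matrix.diagonal_apply, Subtype.ext_iff]
  have e2 : (M.toSquareBlockProp fun i => i ∈ S) =
      Matrix.of fun i j : {i // i ∈ S} => if i = j then 0 else A i j := by
    ext i j
    simp only [Matrix.toSquareBlockProp_def, Matrix.of_apply, M, i.2, if_true, Subtype.ext_iff]
  rw [Matrix.twoBlockTriangular_det M (· ∈ S), mul_comm, e1, e2, Matrix.det_diagonal]
  · congr!
  · intro i hi j hj
    have hij : i ≠ j := by rintro rfl; exact hi hj
    simp only [Matrix.of_apply, M, hi, hij, if_false]

/-- The coefficients of the regularized Fredholm determinant of `g K`, up to `n!`. -/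
def regCoeff (μ : Measure X) (K : X → X → ℂ) (g : X → ℂ) (n : ℕ) : ℂ :=
  ∫ x : Fin n → X, (∏ i, g (x i)) * (zeroDiag K x).det ∂(Measure.pi fun _ => μ)

lemma regCoeff_eq (μ : Measure X) [SigmaFinite μ] (K : X → X → ℂ) (g : X → ℂ) :
    ∫ x : ι → X, (∏ i, g (x i)) * (zeroDiag K x).det ∂(Measure.pi fun _ => μ) =
      regCoeff μ K g (Fintype.card ι) := by
  let e := (Fintype.equivFin ι).symm
  rw [regCoeff, ← (measurePreserving_piCongrLeft (fun _ : ι => μ) e).integral_comp']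
  refine integral_congr_ae (Eventually.of_forall fun x => ?_)
  have hx : ∀ j, MeasurableEquiv.piCongrLeft (fun _ : ι => X) e x (e j) = x j := fun j => by
    rw [MeasurableEquiv.coe_piCongrLeft, Equiv.piCongrLeft_apply_apply]
  simp only
  rw [← e.prod_comp, ← Matrix.det_submatrix_equiv_self e]
  congr 1
  · simp only [hx]
  · congr 1
    ext i j
    simp only [zeroDiag, Matrix.submatrix_apply, Matrix.of_apply, hx, e.injective.eq_iff]

lemma integrable_zeroDiag (μ : Measure X) [SigmaFinite μ] {K : X → X → ℂ}
    (hK : Measurable (Function.uncurry K)) {g : X → ℂ} (hg : Measurable g)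
    (hV : hilbertSchmidtSq μ K g ≠ ∞) :
    Integrable (fun x : ι → X => (∏ i, g (x i)) * (zeroDiag K x).det) (Measure.pi fun _ => μ) := by
  refine ⟨?_, (lintegral_zeroDiag_le μ hK hg).trans_lt ?_⟩
  · refine Measurable.aestronglyMeasurable (Measurable.mul ?_
      (measurable_det (measurable_zeroDiag hK)))
    exact Finset.measurable_fun_prod _ fun i _ => hg.comp (measurable_pi_apply i)
  · refine ENNReal.mul_lt_top (ENNReal.natCast_lt_top _) (ENNReal.pow_lt_top ?_)
    exact ENNReal.rpow_lt_top_of_nonneg (by norm_num) hV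

lemma norm_regCoeff_le (μ : Measure X) [SigmaFinite μ] {K : X → X → ℂ}
    (hK : Measurable (Function.uncurry K)) {g : X → ℂ} (hg : Measurable g)
    (hV : hilbertSchmidtSq μ K g ≠ ∞) (n : ℕ) :
    ‖regCoeff μ K g n‖ ≤ n.factorial * √(hilbertSchmidtSq μ K g).toReal ^ n := by
  refine (norm_integral_le_lintegral_norm _).trans ?_
  have h1 := lintegral_zeroDiag_le (ι := Fin n) μ hK hg
  rw [Fintype.card_fin] at h1
  simp only [ofReal_norm]
  refine (ENNReal.toReal_mono ?_ h1).trans_eq ?_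
  · refine (ENNReal.mul_lt_top (ENNReal.natCast_lt_top _) (ENNReal.pow_lt_top ?_)).ne
    exact ENNReal.rpow_lt_top_of_nonneg (by norm_num) hV
  · rw [ENNReal.toReal_mul, ENNReal.toReal_pow, ENNReal.toReal_natCast, ← ENNReal.toReal_rpow,
      Real.sqrt_eq_rpow]

/-- This is `det (1 + gK) = exp (Tr gK) det₂ (1 + gK)` at the level of coefficients. By Fubini the
variables outside `S` contribute one trace each, and the remaining integral depends only on the
cardinality of `S`. -/
lemma integral_det_eq_sum (μ : Measure X) [SigmaFinite μ] {K : X → X → ℂ}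
    (hK : Measurable (Function.uncurry K)) {g : X → ℂ} (hg : Measurable g)
    (hV : hilbertSchmidtSq μ K g ≠ ∞) (hz : Integrable (fun x => g x * K x x) μ) (n : ℕ) :
    ∫ x : Fin n → X, (∏ i, g (x i)) * (Matrix.of fun i j => K (x i) (x j)).det
        ∂(Measure.pi fun _ => μ) =
      ∑ k ∈ Finset.range (n + 1), n.choose k •
        ((∫ x, g x * K x x ∂μ) ^ (n - k) * regCoeff μ K g k) := by
  let Φ : (S : Finset (Fin n)) → ({i // i ∈ S} → X) → ℂ := fun S y =>
    (∏ i, g (y i)) * (zeroDiag K y).det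
  let Ψ : (S : Finset (Fin n)) → ({i // ¬ i ∈ S} → X) → ℂ := fun S y => ∏ i, g (y i) * K (y i) (y i)
  have hexp : ∀ x : Fin n → X, (∏ i, g (x i)) * (Matrix.of fun i j => K (x i) (x j)).det =
      ∑ S : Finset (Fin n), Φ S (fun i => x i) * Ψ S (fun i => x i) := by
    intro x
    rw [det_eq_sum_zeroDiag, Finset.mul_sum]
    refine Finset.sum_congr rfl fun S _ => ?_
    have h1 : ∏ i, g (x i) = (∏ i : {i // i ∈ S}, g (x i)) * ∏ i : {i // ¬ i ∈ S}, g (x i) := by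
      convert! (Fintype.prod_subtype_mul_prod_subtype (· ∈ S) fun i => g (x i)).symm
    have h2 : (Matrix.of fun i j : {i // i ∈ S} => if i = j then 0 else
        (Matrix.of fun i j => K (x i) (x j)) i j) = zeroDiag K fun i : {i // i ∈ S} => x i := rfl
    rw [h1, h2]
    simp only [Φ, Ψ, Matrix.of_apply]
    rw [Finset.prod_mul_distrib]
    ring
  have hmp : ∀ S : Finset (Fin n), MeasurePreserving
      (MeasurableEquiv.piEquivPiSubtypeProd (fun _ : Fin n => X) (· ∈ S))
      (Measure.pi fun _ => μ) ((Measure.pi fun _ => μ).prod (Measure.pi fun _ => μ)) := fun S => by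
    convert! measurePreserving_piEquivPiSubtypeProd (fun _ : Fin n => μ) (· ∈ S)
  have hint : ∀ S : Finset (Fin n), Integrable (fun x : Fin n → X =>
      Φ S (fun i => x i) * Ψ S (fun i => x i)) (Measure.pi fun _ => μ) := by
    intro S
    have h1 : Integrable (Φ S) (Measure.pi fun _ => μ) := integrable_zeroDiag μ hK hg hV
    have h2 : Integrable (Ψ S) (Measure.pi fun _ => μ) :=
      Integrable.fintype_prod (f := fun _ x => g x * K x x) fun _ => hz
    exact ((hmp S).integrable_comp_emb (MeasurableEquiv.measurableEmbedding _)).2 (h1.mul_prod h2)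
  have hval : ∀ S : Finset (Fin n), ∫ x : Fin n → X,
      Φ S (fun i => x i) * Ψ S (fun i => x i) ∂(Measure.pi fun _ => μ) =
      (∫ x, g x * K x x ∂μ) ^ (n - S.card) * regCoeff μ K g S.card := by
    intro S
    have h3 := (hmp S).integral_comp' (fun p => Φ S p.1 * Ψ S p.2)
    refine h3.trans ?_
    rw [integral_prod_mul, mul_comm]
    congr 1
    · simp only [Ψ]
      rw [integral_fintype_prod_eq_pow (fun x => g x * K x x)]
      congr 1
      rw [Fintype.card_subtype_compl, Fintype.card_fin, Fintype.card_coe]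
    · simp only [Φ]
      rw [regCoeff_eq μ K g, Fintype.card_coe]
  simp_rw [hexp]
  rw [integral_finsetSum _ fun S _ => hint S]
  simp_rw [hval]
  have := Finset.sum_powerset_apply_card (x := (Finset.univ : Finset (Fin n)))
    fun k => (∫ x, g x * K x x ∂μ) ^ (n - k) * regCoeff μ K g k
  rw [Finset.powerset_univ, Finset.card_univ, Fintype.card_fin] at this
  exact this

end DetExpansion

end

section


variable {E : Set ℝ}

/-! ### Multiplicative functionals as sums over tuples -/

lemma card_filter_injective_image {α : Type*} [DecidableEq α] (n : ℕ) (s T : Finset α)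
    (hTs : T ⊆ s) (hT : T.card = n) :
    ((Fintype.piFinset fun _ : Fin n => s).filter fun x =>
      Function.Injective x ∧ Finset.univ.image x = T).card = n.factorial := by
  have h1 : Fintype.card (Fin n ↪ T) = n.factorial := by
    rw [Fintype.card_embedding_eq, Fintype.card_coe, Fintype.card_fin, hT, Nat.descFactorial_self]
  rw [← h1, ← Finset.card_univ]
  symm
  refine Finset.card_bij (fun e _ i => (e i : α)) ?_ ?_ ?_
  · intro e _
    have hinj : Function.Injective fun i => (e i : α) :=
      Subtype.val_injective.comp e.injective
    rw [Finset.mem_filter, Fintype.mem_piFinset]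
    refine ⟨fun i => hTs (e i).2, hinj, Finset.eq_of_subset_of_card_le ?_ ?_⟩
    · intro y hy
      obtain ⟨i, -, rfl⟩ := Finset.mem_image.1 hy
      exact (e i).2
    · rw [Finset.card_image_of_injective _ hinj, Finset.card_univ, Fintype.card_fin, hT]
  · intro e _ e' _ h
    ext i
    exact congrFun h i
  · intro x hx
    rw [Finset.mem_filter] at hx
    refine ⟨⟨fun i => ⟨x i, hx.2.2 ▸ Finset.mem_image_of_mem _ (Finset.mem_univ i)⟩, fun i j h => ?_⟩,
      Finset.mem_univ _, rfl⟩
    exact hx.2.1 (congrArg Subtype.val h)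

open Classical in
lemma tupleSum_prod_eq (g : E → ℂ) (X : Configuration E) (s : Finset E) (hs : ↑s ⊆ X.1)
    (hg : ∀ x ∈ X.1, x ∉ s → g x = 0) (n : ℕ) :
    tupleSum (fun x : Fin n → E => ∏ i, g (x i)) X =
      n.factorial * ∑ T ∈ s.powersetCard n, ∏ x ∈ T, g x := by
  have h1 : tupleSum (fun x : Fin n → E => ∏ i, g (x i)) X =
      ∑ x ∈ (Fintype.piFinset fun _ : Fin n => s).filter Function.Injective, ∏ i, g (x i) := by
    refine (tsum_subtype {x : Fin n → E | Function.Injective x ∧ ∀ i, x i ∈ X.1}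
      (fun x => ∏ i, g (x i))).trans ?_
    rw [tsum_eq_sum (s := Fintype.piFinset fun _ : Fin n => s), Finset.sum_filter]
    · refine Finset.sum_congr rfl fun x hx => ?_
      rw [Fintype.mem_piFinset] at hx
      rw [Set.indicator_apply]
      congr 1
      simp only [Set.mem_ofPred_eq, eq_iff_iff, and_iff_left_iff_imp]
      exact fun _ i => hs (hx i)
    · intro x hx
      rw [Fintype.mem_piFinset] at hx
      push Not at hx
      obtain ⟨i, hi⟩ := hx
      rw [Set.indicator_apply_eq_zero]
      intro h
      exact Finset.prod_eq_zero (Finset.mem_univ i) (hg _ (h.2 i) hi)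
  rw [h1, ← Finset.sum_fiberwise_of_maps_to (g := fun x : Fin n → E => Finset.univ.image x)
    (t := s.powersetCard n), Finset.mul_sum]
  · refine Finset.sum_congr rfl fun T hT => ?_
    rw [Finset.mem_powersetCard] at hT
    rw [Finset.filter_filter, ← card_filter_injective_image n s T hT.1 hT.2, ← nsmul_eq_mul,
      ← Finset.sum_const]
    refine Finset.sum_congr rfl fun x hx => ?_
    rw [Finset.mem_filter] at hx
    rw [← hx.2.2, Finset.prod_image fun i _ j _ h => hx.2.1 h]
  · intro x hx
    rw [Finset.mem_filter, Fintype.mem_piFinset] at hx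
    rw [Finset.mem_powersetCard]
    refine ⟨fun y hy => ?_, ?_⟩
    · obtain ⟨i, -, rfl⟩ := Finset.mem_image.1 hy
      exact hx.1 i
    · rw [Finset.card_image_of_injective _ hx.2, Finset.card_univ, Fintype.card_fin]

/-- Each `n`-element subset is listed by `n!` injective tuples, so the terms are the elementary
symmetric polynomials of the values of `g`, whose sum is the product. -/
lemma hasSum_tupleSum (g : E → ℂ) (X : Configuration E) (s : Finset E) (hs : ↑s ⊆ X.1)
    (hg : ∀ x ∈ X.1, x ∉ s → g x = 0) :
    HasSum (fun n : ℕ => (n.factorial : ℂ)⁻¹ * tupleSum (fun x : Fin n → E => ∏ i, g (x i)) X)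
      (∏ x ∈ s, (1 + g x)) := by
  have h1 : ∀ n : ℕ, (n.factorial : ℂ)⁻¹ * tupleSum (fun x : Fin n → E => ∏ i, g (x i)) X =
      ∑ T ∈ s.powersetCard n, ∏ x ∈ T, g x := fun n => by
    rw [tupleSum_prod_eq g X s hs hg, inv_mul_cancel_left₀]
    exact Nat.cast_ne_zero.2 n.factorial_ne_zero
  simp_rw [h1]
  rw [Finset.prod_one_add, Finset.sum_powerset]
  refine hasSum_sum_of_ne_finset_zero fun n hn => ?_
  rw [Finset.powersetCard_eq_empty.2, Finset.sum_empty]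
  simp only [Finset.mem_range, not_lt] at hn
  omega

/-- Domination by the sum for `|g|`. Since that sum is a nonnegative real, the integral of its norm
is again a determinantal integral, now with `|g|`. -/
lemma norm_tupleSum_le (g : E → ℂ) (X : Configuration E) (s : Finset E) (hs : ↑s ⊆ X.1)
    (hg : ∀ x ∈ X.1, x ∉ s → g x = 0) (n : ℕ) :
    ‖tupleSum (fun x : Fin n → E => ∏ i, g (x i)) X‖ ≤
      ‖tupleSum (fun x : Fin n → E => ∏ i, (‖g (x i)‖ : ℂ)) X‖ ∧
    tupleSum (fun x : Fin n → E => ∏ i, (‖g (x i)‖ : ℂ)) X =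
      (‖tupleSum (fun x : Fin n → E => ∏ i, (‖g (x i)‖ : ℂ)) X‖ : ℂ) := by
  rw [tupleSum_prod_eq g X s hs hg,
    tupleSum_prod_eq (fun x => (‖g x‖ : ℂ)) X s hs (fun x hx h => by simp [hg x hx h])]
  have h1 : (n.factorial : ℂ) * ∑ T ∈ s.powersetCard n, ∏ x ∈ T, (‖g x‖ : ℂ) =
      ((n.factorial * ∑ T ∈ s.powersetCard n, ∏ x ∈ T, ‖g x‖ : ℝ) : ℂ) := by push_cast; rfl
  have h2 : (0 : ℝ) ≤ n.factorial * ∑ T ∈ s.powersetCard n, ∏ x ∈ T, ‖g x‖ := by positivity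
  rw [h1, Complex.norm_real, Real.norm_of_nonneg h2]
  refine ⟨?_, rfl⟩
  rw [norm_mul, Complex.norm_natCast]
  gcongr
  refine (norm_sum_le _ _).trans (Finset.sum_le_sum fun T _ => ?_)
  rw [norm_prod]

/-- The points of `X` in a compact set. -/
lemma exists_finset_of_compact {g : E → ℂ} (hg : HasCompactSupport g) (X : Configuration E) :
    ∃ s : Finset E, ↑s ⊆ X.1 ∧ ∀ x ∈ X.1, x ∉ s → g x = 0 := by
  refine ⟨(X.finite_inter (B := tsupport g) hg.isCompact.isBounded).toFinset, ?_, ?_⟩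
  · intro x hx
    rw [Set.Finite.coe_toFinset] at hx
    exact hx.1
  · intro x hx h
    rw [Set.Finite.mem_toFinset] at h
    by_contra h0
    exact h ⟨hx, subset_tsupport g h0⟩

lemma hasCompactSupport_prod {g : E → ℂ} (hg : HasCompactSupport g) (n : ℕ) :
    HasCompactSupport fun x : Fin n → E => ∏ i, g (x i) := by
  refine HasCompactSupport.intro (isCompact_univ_pi fun _ : Fin n => hg.isCompact) fun x hx => ?_
  simp only [Set.mem_pi, Set.mem_univ, true_implies, not_forall] at hx
  obtain ⟨i, hi⟩ := hx
  exact Finset.prod_eq_zero (Finset.mem_univ i) (image_eq_zero_of_notMem_tsupport hi)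

/-! ### Expectations of multiplicative functionals -/

section Fredholm

variable {P : Measure (Configuration E)} {μ : Measure E} {K : E → E → ℂ}

lemma IsDeterminantal.tupleSum_prod (hdet : IsDeterminantal P μ K) {g : E → ℂ} (hg : Measurable g)
    (hb : ∃ C : ℝ, ∀ x, ‖g x‖ ≤ C) (hc : HasCompactSupport g) (n : ℕ) :
    Integrable (tupleSum fun x : Fin n → E => ∏ i, g (x i)) P ∧
    ∫ X, tupleSum (fun x : Fin n → E => ∏ i, g (x i)) X ∂P =
      ∫ x, (∏ i, g (x i)) * (Matrix.of fun i j => K (x i) (x j)).det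
        ∂(Measure.pi fun _ : Fin n => μ) := by
  obtain ⟨C, hC⟩ := hb
  obtain ⟨h1, -, h2⟩ := hdet n (fun x => ∏ i, g (x i))
    (Finset.measurable_fun_prod _ fun i _ => hg.comp (measurable_pi_apply i))
    ⟨C ^ n, fun x => by
      rw [norm_prod]
      refine (Finset.prod_le_prod (fun _ _ => norm_nonneg _) fun i _ => hC (x i)).trans_eq ?_
      simp⟩ (hasCompactSupport_prod hc n)
  exact ⟨h1, h2⟩

lemma inv_factorial_mul_sum_choose (z : ℂ) (c : ℕ → ℂ) (n : ℕ) :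
    (n.factorial : ℂ)⁻¹ * ∑ k ∈ Finset.range (n + 1), n.choose k • (z ^ (n - k) * c k) =
      ∑ p ∈ Finset.HasAntidiagonal.antidiagonal n,
        (c p.1 / p.1.factorial) * (z ^ p.2 / p.2.factorial) := by
  rw [Finset.Nat.sum_antidiagonal_eq_sum_range_succ_mk, Finset.mul_sum]
  refine Finset.sum_congr rfl fun k hk => ?_
  have hk' : k ≤ n := Nat.lt_succ_iff.1 (Finset.mem_range.1 hk)
  have h1 := Nat.choose_mul_factorial_mul_factorial hk'
  have h2 : (n.choose k : ℂ) * k.factorial * (n - k).factorial = n.factorial := by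
    exact_mod_cast h1
  have h3 : (k.factorial : ℂ) ≠ 0 := Nat.cast_ne_zero.2 k.factorial_ne_zero
  have h4 : ((n - k).factorial : ℂ) ≠ 0 := Nat.cast_ne_zero.2 (n - k).factorial_ne_zero
  have h5 : (n.factorial : ℂ) ≠ 0 := Nat.cast_ne_zero.2 n.factorial_ne_zero
  rw [nsmul_eq_mul]
  field_simp
  rw [← h2]; ring

lemma summable_regCoeff [SigmaFinite μ] (hK : Measurable (Function.uncurry K)) {g : E → ℂ}
    (hg : Measurable g) (hV : hilbertSchmidtSq μ K g < 1) :
    (∀ n, ‖regCoeff μ K g n / n.factorial‖ ≤ √(hilbertSchmidtSq μ K g).toReal ^ n) ∧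
    √(hilbertSchmidtSq μ K g).toReal < 1 := by
  have hV' : hilbertSchmidtSq μ K g ≠ ⊤ := (hV.trans ENNReal.one_lt_top).ne
  refine ⟨fun n => ?_, ?_⟩
  · rw [norm_div, Complex.norm_natCast, div_le_iff₀ (by positivity), mul_comm]
    exact norm_regCoeff_le μ hK hg hV' n
  · rw [Real.sqrt_lt' one_pos, one_pow]
    have := (ENNReal.toReal_lt_toReal hV' ENNReal.one_ne_top).2 hV
    simpa using this

lemma integrable_of_hasSum {Ω : Type*} [MeasurableSpace Ω] {Q : Measure Ω} {F : ℕ → Ω → ℂ}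
    (hF : ∀ n, Integrable (F n) Q) (hs : Summable fun n => ∫ x, ‖F n x‖ ∂Q) {G : Ω → ℂ}
    (hG : ∀ x, HasSum (fun n => F n x) (G x)) : Integrable G Q := by
  refine ⟨?_, ?_⟩
  · exact aestronglyMeasurable_of_tendsto_ae atTop
      (f := fun N x => ∑ n ∈ Finset.range N, F n x)
      (fun N => Finset.aestronglyMeasurable_fun_sum _ fun n _ => (hF n).1)
      (Eventually.of_forall fun x => (hG x).tendsto_sum_nat)
  · have h1 : ∀ x, ‖G x‖ₑ ≤ ∑' n, ‖F n x‖ₑ := fun x => by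
      rw [← (hG x).tsum_eq]; exact enorm_tsum_le_tsum_enorm
    refine (lintegral_mono h1).trans_lt ?_
    rw [lintegral_tsum fun n => (hF n).1.enorm]
    have h2 : ∀ n, ∫⁻ x, ‖F n x‖ₑ ∂Q = ENNReal.ofReal (∫ x, ‖F n x‖ ∂Q) := fun n => by
      rw [ofReal_integral_norm_eq_lintegral_enorm (hF n)]
    simp_rw [h2]
    rw [← ENNReal.ofReal_tsum_of_nonneg (fun n => integral_nonneg fun _ => norm_nonneg _) hs]
    exact ENNReal.ofReal_lt_top

/-- The expectation of a multiplicative functional, in terms of the regularized Fredholm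
determinant. -/
lemma IsDeterminantal.expectation_exp [SigmaFinite μ] (hdet : IsDeterminantal P μ K)
    (hK : Measurable (Function.uncurry K)) {g : E → ℂ} (hg : Measurable g)
    (hb : ∃ C : ℝ, ∀ x, ‖g x‖ ≤ C) (hc : HasCompactSupport g)
    (hz : Integrable (fun x => g x * K x x) μ) (hV : hilbertSchmidtSq μ K g < 1)
    (Φ : Configuration E → ℂ)
    (hΦ : ∀ X (s : Finset E), ↑s ⊆ X.1 → (∀ x ∈ X.1, x ∉ s → g x = 0) → Φ X = ∏ x ∈ s, (1 + g x)) :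
    Integrable Φ P ∧ ∫ X, Φ X ∂P = Complex.exp (∫ x, g x * K x x ∂μ) *
      ∑' n, regCoeff μ K g n / n.factorial := by
  have hV' : hilbertSchmidtSq μ K g ≠ ⊤ := (hV.trans ENNReal.one_lt_top).ne
  set F : ℕ → Configuration E → ℂ := fun n X =>
    (n.factorial : ℂ)⁻¹ * tupleSum (fun x : Fin n → E => ∏ i, g (x i)) X with hF
  have hsum : ∀ X, HasSum (fun n => F n X) (Φ X) := fun X => by
    obtain ⟨s, hs, hs0⟩ := exists_finset_of_compact hc X
    rw [hΦ X s hs hs0]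
    exact hasSum_tupleSum g X s hs hs0
  have hFint : ∀ n, Integrable (F n) P := fun n =>
    (hdet.tupleSum_prod hg hb hc n).1.const_mul _
  have hFval : ∀ n, ∫ X, F n X ∂P = ∑ p ∈ Finset.HasAntidiagonal.antidiagonal n,
      (regCoeff μ K g p.1 / p.1.factorial) *
        ((∫ x, g x * K x x ∂μ) ^ p.2 / p.2.factorial) := fun n => by
    rw [← inv_factorial_mul_sum_choose, ← integral_det_eq_sum μ hK hg hV' hz,
      ← (hdet.tupleSum_prod hg hb hc n).2, ← integral_const_mul]
  obtain ⟨hr, hv⟩ := summable_regCoeff hK hg hV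
  have hgeo : Summable fun n : ℕ => √(hilbertSchmidtSq μ K g).toReal ^ n :=
    summable_geometric_of_lt_one (Real.sqrt_nonneg _) hv
  have hexp : ∀ z : ℂ, Summable fun n : ℕ => ‖z ^ n / n.factorial‖ :=
    fun z => NormedSpace.norm_expSeries_div_summable z
  have hsr : Summable fun n => ‖regCoeff μ K g n / n.factorial‖ :=
    Summable.of_nonneg_of_le (fun _ => norm_nonneg _) hr hgeo
  have hgn : Measurable fun x => (‖g x‖ : ℂ) := Complex.measurable_ofReal.comp hg.norm
  have hbn : ∃ C : ℝ, ∀ x, ‖(‖g x‖ : ℂ)‖ ≤ C := by simpa using hb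
  have hcn : HasCompactSupport fun x => (‖g x‖ : ℂ) :=
    hc.comp_left (g := fun z : ℂ => ((‖z‖ : ℝ) : ℂ)) (by simp)
  have hVn : hilbertSchmidtSq μ K (fun x => (‖g x‖ : ℂ)) = hilbertSchmidtSq μ K g := by
    simp [hilbertSchmidtSq, ← ofReal_norm]
  have hKd : Measurable fun x => K x x := hK.comp (measurable_id.prodMk measurable_id)
  have hzn : Integrable (fun x => (‖g x‖ : ℂ) * K x x) μ :=
    hz.mono (hgn.mul hKd).aestronglyMeasurable (Eventually.of_forall fun x => by simp)
  obtain ⟨hrn, -⟩ := summable_regCoeff hK hgn (hVn ▸ hV)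
  rw [hVn] at hrn
  -- Absolute convergence comes from the same expansion for `|g|`, whose Hilbert-Schmidt norm is
  -- that of `g`: its coefficients form the Cauchy product of a geometrically dominated series and
  -- an exponential series.
  have hnorm : ∀ n, ∫ X, ‖F n X‖ ∂P ≤ ‖∑ p ∈ Finset.HasAntidiagonal.antidiagonal n,
      (regCoeff μ K (fun x => (‖g x‖ : ℂ)) p.1 / p.1.factorial) *
        ((∫ x, (‖g x‖ : ℂ) * K x x ∂μ) ^ p.2 / p.2.factorial)‖ := fun n => by
    obtain ⟨i1, e1⟩ := hdet.tupleSum_prod hgn hbn hcn n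
    have hpt : ∀ X, ‖tupleSum (fun x : Fin n → E => ∏ i, g (x i)) X‖ ≤
        ‖tupleSum (fun x : Fin n → E => ∏ i, (‖g (x i)‖ : ℂ)) X‖ ∧
        tupleSum (fun x : Fin n → E => ∏ i, (‖g (x i)‖ : ℂ)) X =
          (‖tupleSum (fun x : Fin n → E => ∏ i, (‖g (x i)‖ : ℂ)) X‖ : ℂ) := fun X => by
      obtain ⟨s, hs, hs0⟩ := exists_finset_of_compact hc X
      exact norm_tupleSum_le g X s hs hs0 n
    have hle : ∫ X, ‖F n X‖ ∂P ≤ (n.factorial : ℝ)⁻¹ *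
        ∫ X, ‖tupleSum (fun x : Fin n → E => ∏ i, (‖g (x i)‖ : ℂ)) X‖ ∂P := by
      rw [← integral_const_mul]
      refine integral_mono (hFint n).norm (i1.norm.const_mul _) fun X => ?_
      simp only [hF, norm_mul, norm_inv, Complex.norm_natCast]
      gcongr
      exact (hpt X).1
    refine hle.trans_eq ?_
    rw [← inv_factorial_mul_sum_choose, ← integral_det_eq_sum μ hK hgn (hVn ▸ hV') hzn, ← e1,
      norm_mul, norm_inv, Complex.norm_natCast]
    congr 1
    have e2 : ∫ X, tupleSum (fun x : Fin n → E => ∏ i, (‖g (x i)‖ : ℂ)) X ∂P =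
        ((∫ X, ‖tupleSum (fun x : Fin n → E => ∏ i, (‖g (x i)‖ : ℂ)) X‖ ∂P : ℝ) : ℂ) := by
      rw [← integral_complex_ofReal]
      exact integral_congr_ae (Eventually.of_forall fun X => (hpt X).2)
    rw [e2, Complex.norm_real, Real.norm_of_nonneg (integral_nonneg fun _ => norm_nonneg _)]
  have hsumm : Summable fun n => ∫ X, ‖F n X‖ ∂P := by
    refine Summable.of_nonneg_of_le (fun n => integral_nonneg fun _ => norm_nonneg _) hnorm ?_
    exact summable_norm_sum_mul_antidiagonal_of_summable_norm
      (f := fun k => regCoeff μ K (fun x => (‖g x‖ : ℂ)) k / k.factorial)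
      (g := fun k => (∫ x, (‖g x‖ : ℂ) * K x x ∂μ) ^ k / k.factorial)
      (Summable.of_nonneg_of_le (fun _ => norm_nonneg _) hrn hgeo) (hexp _)
  have hI := hasSum_integral_of_summable_integral_norm hFint hsumm
  have htsum : ∀ X, ∑' n, F n X = Φ X := fun X => (hsum X).tsum_eq
  simp only [htsum] at hI
  refine ⟨integrable_of_hasSum hFint hsumm hsum, ?_⟩
  rw [← hI.tsum_eq]
  simp_rw [hFval]
  rw [← tsum_mul_tsum_eq_tsum_sum_antidiagonal_of_summable_norm
      (f := fun k => regCoeff μ K g k / k.factorial)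
      (g := fun k => (∫ x, g x * K x x ∂μ) ^ k / k.factorial) hsr (hexp _), mul_comm,
    Complex.exp_eq_exp_ℂ, NormedSpace.exp_eq_tsum_div]

end Fredholm

end

section


variable {E : Set ℝ} {P : Measure (Configuration E)} {μ : Measure E} {K : E → E → ℂ}

/-! ### Exponential moments of linear statistics -/

lemma IsProjectionKernel.measurable_uncurry (hK : IsProjectionKernel μ K) :
    Measurable (Function.uncurry K) := hK.measurable

lemma IsProjectionKernel.measurable_diag (hK : IsProjectionKernel μ K) :
    Measurable fun x => K x x :=
  hK.measurable.comp (measurable_id.prodMk measurable_id)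

lemma IsProjectionKernel.diag_eq (hK : IsProjectionKernel μ K) :
    ∀ᵐ x ∂μ, K x x = ((K x x).re : ℂ) ∧ 0 ≤ (K x x).re ∧
      ∫⁻ y, ‖K x y‖ₑ ^ (2 : ℝ) ∂μ = ENNReal.ofReal (K x x).re := by
  filter_upwards [hK.diagonal] with x ⟨h1, h2⟩
  have h3 : (K x x).re = ∫ y, ‖K x y‖ ^ 2 ∂μ := by rw [h2, Complex.ofReal_re]
  refine ⟨by rw [h3, ← h2], by rw [h3]; exact integral_nonneg fun _ => by positivity, ?_⟩
  rw [h3, ofReal_integral_eq_lintegral_ofReal h1 (Eventually.of_forall fun _ => by positivity)]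
  refine lintegral_congr fun y => ?_
  rw [← ofReal_norm, ENNReal.ofReal_rpow_of_nonneg (norm_nonneg _) (by norm_num)]
  norm_num

/-- The reproducing identity `K(x,x) = ∫ |K(x,y)|² dμ(y)` carries out the inner integration. The
size of the regularized determinant is thus governed by the integrals occurring in the hypotheses.
-/
lemma IsProjectionKernel.hilbertSchmidtSq_eq [SigmaFinite μ] (hK : IsProjectionKernel μ K)
    {g : E → ℂ} (hi : Integrable (fun x => ‖g x‖ ^ 2 * (K x x).re) μ) :
    hilbertSchmidtSq μ K g = ENNReal.ofReal (∫ x, ‖g x‖ ^ 2 * (K x x).re ∂μ) := by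
  rw [ofReal_integral_eq_lintegral_ofReal hi]
  · refine lintegral_congr_ae ?_
    filter_upwards [hK.diag_eq] with x hx
    obtain ⟨-, h1, h2⟩ := hx
    have hm : Measurable fun y => ‖K x y‖ₑ ^ (2 : ℝ) :=
      ((hK.measurable.comp (measurable_prodMk_left (x := x))).enorm).pow_const _
    simp_rw [ENNReal.mul_rpow_of_nonneg _ _ (show (0 : ℝ) ≤ 2 by norm_num)]
    rw [lintegral_const_mul _ hm, h2, ENNReal.ofReal_mul (by positivity), ← ofReal_norm,
      ENNReal.ofReal_rpow_of_nonneg (norm_nonneg _) (by norm_num)]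
    norm_num
  · filter_upwards [hK.diag_eq] with x hx
    have h1 := hx.2.1
    change 0 ≤ ‖g x‖ ^ 2 * (K x x).re
    positivity

lemma IsProjectionKernel.integrable_mul (hK : IsProjectionKernel μ K) {g : E → ℂ}
    (hg : Measurable g) {C : ℝ} (hC : ∀ x, ‖g x‖ ≤ C) {B : Set E} (hB : MeasurableSet B)
    (hb : Bornology.IsBounded B) (h0 : ∀ x, x ∉ B → g x = 0) :
    Integrable (fun x => g x * K x x) μ := by
  have h1 : Integrable (B.indicator fun x => K x x) μ :=
    (hK.locallyTraceClass B hB hb).integrable_indicator hB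
  have h2 := h1.bdd_mul (c := C) hg.aestronglyMeasurable (Eventually.of_forall hC)
  refine h2.congr (Eventually.of_forall fun x => ?_)
  by_cases hx : x ∈ B
  · simp [hx]
  · simp [h0 x hx]

lemma IsProjectionKernel.integrable_real_mul (hK : IsProjectionKernel μ K) {φ : E → ℝ}
    (hφ : Measurable φ) {C : ℝ} (hC : ∀ x, |φ x| ≤ C) {B : Set E} (hB : MeasurableSet B)
    (hb : Bornology.IsBounded B) (h0 : ∀ x, x ∉ B → φ x = 0) :
    Integrable (fun x => φ x * (K x x).re) μ := by
  have h1 := (hK.integrable_mul (g := fun x => (φ x : ℂ)) (Complex.measurable_ofReal.comp hφ)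
    (by simpa using hC) hB hb (by simpa using h0)).re
  simpa using h1

/-- The sum of a real function over a configuration. -/
def realStatistic (φ : E → ℝ) (X : Configuration E) : ℝ := ∑' x : X.1, φ x

lemma tsum_subtype_eq_sum {A : Type*} [AddCommMonoid A] [TopologicalSpace A] {φ : E → A}
    {X : Configuration E} {s : Finset E} (hs : ↑s ⊆ X.1) (h0 : ∀ x ∈ X.1, x ∉ s → φ x = 0) :
    ∑' x : X.1, φ x = ∑ x ∈ s, φ x := by
  classical
  refine (tsum_subtype X.1 φ).trans ?_
  rw [tsum_eq_sum (s := s)]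
  · exact Finset.sum_congr rfl fun x hx => Set.indicator_of_mem (hs hx) _
  · intro x hx
    by_cases hX : x ∈ X.1
    · rw [Set.indicator_of_mem hX, h0 x hX hx]
    · exact Set.indicator_of_notMem hX _

lemma sum_regCoeff_norm_le [SigmaFinite μ] (hK : Measurable (Function.uncurry K)) {g : E → ℂ}
    (hg : Measurable g) (hV : hilbertSchmidtSq μ K g ≤ ENNReal.ofReal (1 / 4)) :
    ‖∑' n, regCoeff μ K g n / n.factorial‖ ≤ 1 + 2 * (hilbertSchmidtSq μ K g).toReal := by
  have hV1 : hilbertSchmidtSq μ K g < 1 := hV.trans_lt (by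
    rw [← ENNReal.ofReal_one]; exact ENNReal.ofReal_lt_ofReal_iff one_pos |>.2 (by norm_num))
  obtain ⟨hr, hv⟩ := summable_regCoeff hK hg hV1
  set v := √(hilbertSchmidtSq μ K g).toReal with hvdef
  have hv0 : 0 ≤ v := Real.sqrt_nonneg _
  have hvsq : v ^ 2 = (hilbertSchmidtSq μ K g).toReal := Real.sq_sqrt ENNReal.toReal_nonneg
  have hvhalf : v ≤ 1 / 2 := by
    refine abs_le_of_sq_le_sq' ?_ (by norm_num) |>.2
    rw [hvsq]
    exact (ENNReal.toReal_le_of_le_ofReal (by norm_num) hV).trans (by norm_num)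
  have hgeo := summable_geometric_of_lt_one hv0 hv
  have hsr : Summable fun n => ‖regCoeff μ K g n / n.factorial‖ :=
    Summable.of_nonneg_of_le (fun _ => norm_nonneg _) hr hgeo
  -- The `1 × 1` matrix without its diagonal is zero. With no linear term the error is of order
  -- `v²`, the squared norm, instead of `v`.
  have h1 : regCoeff μ K g 1 = 0 := by
    refine integral_eq_zero_of_ae (Eventually.of_forall fun x => ?_)
    simp [Matrix.det_unique, zeroDiag]
  refine (norm_tsum_le_tsum_norm hsr).trans ?_
  rw [← hsr.sum_add_tsum_nat_add 2, Finset.sum_range_succ, Finset.sum_range_one, h1]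
  have h0 := hr 0
  rw [pow_zero] at h0
  have h2 : ∑' n, ‖regCoeff μ K g (n + 2) / (n + 2).factorial‖ ≤ ∑' n, v ^ 2 * v ^ n := by
    refine Summable.tsum_le_tsum (fun n => (hr (n + 2)).trans_eq (by ring)) ?_ (hgeo.mul_left _)
    exact (summable_nat_add_iff 2).2 hsr
  rw [tsum_mul_left, tsum_geometric_of_lt_one hv0 hv] at h2
  have h3 : (1 - v)⁻¹ ≤ 2 := by
    rw [inv_le_comm₀ (by linarith) (by norm_num)]; linarith
  have h4 : v ^ 2 * (1 - v)⁻¹ ≤ v ^ 2 * 2 := by gcongr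
  rw [← hvsq]
  simp only [zero_div, norm_zero, add_zero]
  linarith

lemma exp_mul_le {V : ℝ} (h0 : 0 ≤ V) (h1 : V ≤ 1 / 16) :
    Real.exp V * (1 + 8 * V) ≤ 1 + 10 * V := by
  have h2 := Real.abs_exp_sub_one_sub_id_le (x := V) (by rw [abs_of_nonneg h0]; linarith)
  have h3 : Real.exp V ≤ 1 + V + V ^ 2 := by have := (abs_le.1 h2).2; linarith
  calc Real.exp V * (1 + 8 * V) ≤ (1 + V + V ^ 2) * (1 + 8 * V) := by gcongr
    _ ≤ 1 + 10 * V := by nlinarith [mul_nonneg h0 h0]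

/-- For `γ = e^φ - 1` and `|φ| ≤ 1`, the inequality `γ - φ ≤ φ²` leaves at most `e^V` of the trace
factor after centering. From `|γ| ≤ 2|φ|` the squared Hilbert-Schmidt norm is at most `4V ≤ 1/4`, so
the regularized determinant is at most `1 + 8V`. -/
lemma realStatistic_exp_bound [SigmaFinite μ] (hK : IsProjectionKernel μ K)
    (hdet : IsDeterminantal P μ K) {φ : E → ℝ} (hφ : Measurable φ) (h1 : ∀ x, |φ x| ≤ 1)
    (hc : HasCompactSupport φ) (hV : ∫ x, φ x ^ 2 * (K x x).re ∂μ ≤ 1 / 16) :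
    Integrable (fun X => Real.exp (realStatistic φ X - ∫ x, φ x * (K x x).re ∂μ)) P ∧
    ∫ X, Real.exp (realStatistic φ X - ∫ x, φ x * (K x x).re ∂μ) ∂P ≤
      1 + 10 * ∫ x, φ x ^ 2 * (K x x).re ∂μ := by
  set B := tsupport φ
  have hB : MeasurableSet B := (isClosed_tsupport φ).measurableSet
  have hb : Bornology.IsBounded B := hc.isCompact.isBounded
  have hB0 : ∀ x, x ∉ B → φ x = 0 := fun x hx => image_eq_zero_of_notMem_tsupport hx
  have hge : ∀ᵐ x ∂μ, 0 ≤ (K x x).re := hK.diag_eq.mono fun x h => h.2.1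
  have i1 : Integrable (fun x => φ x * (K x x).re) μ := hK.integrable_real_mul hφ h1 hB hb hB0
  have i2 : Integrable (fun x => φ x ^ 2 * (K x x).re) μ :=
    hK.integrable_real_mul (C := 1) (hφ.pow_const 2)
      (fun x => by rw [abs_pow]; exact pow_le_one₀ (abs_nonneg _) (h1 x)) hB hb
      fun x hx => by simp [hB0 x hx]
  have hV0 : 0 ≤ ∫ x, φ x ^ 2 * (K x x).re ∂μ :=
    integral_nonneg_of_ae (hge.mono fun x hx => by change 0 ≤ φ x ^ 2 * (K x x).re; positivity)
  set V := ∫ x, φ x ^ 2 * (K x x).re ∂μ with hVdef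
  set m := ∫ x, φ x * (K x x).re ∂μ with hm
  set γ : E → ℝ := fun x => Real.exp (φ x) - 1 with hγ
  have hγm : Measurable γ := (Real.measurable_exp.comp hφ).sub_const 1
  have hγ2 : ∀ x, |γ x| ≤ 2 * |φ x| := fun x => Real.abs_exp_sub_one_le (h1 x)
  have hγC : ∀ x, |γ x| ≤ 2 := fun x => (hγ2 x).trans (by linarith [h1 x])
  have hγ0 : ∀ x, φ x = 0 → γ x = 0 := fun x hx => by simp [hγ, hx]
  have i3 : Integrable (fun x => γ x * (K x x).re) μ :=
    hK.integrable_real_mul hγm hγC hB hb fun x hx => hγ0 x (hB0 x hx)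
  have i4 : Integrable (fun x => γ x ^ 2 * (K x x).re) μ :=
    hK.integrable_real_mul (C := 4) (hγm.pow_const 2)
      (fun x => by rw [abs_pow]; nlinarith [abs_nonneg (γ x), hγC x]) hB hb
      fun x hx => by simp [hγ0 x (hB0 x hx)]
  set g : E → ℂ := fun x => (γ x : ℂ) with hg
  have hgm : Measurable g := Complex.measurable_ofReal.comp hγm
  have hgb : ∀ x, ‖g x‖ ≤ 2 := fun x => by simpa [hg] using hγC x
  have hgc : HasCompactSupport g :=
    hc.comp_left (g := fun t : ℝ => ((Real.exp t - 1 : ℝ) : ℂ)) (by simp)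
  have hgz : Integrable (fun x => g x * K x x) μ :=
    hK.integrable_mul hgm hgb hB hb fun x hx => by simp [hg, hγ0 x (hB0 x hx)]
  have hHS : hilbertSchmidtSq μ K g = ENNReal.ofReal (∫ x, γ x ^ 2 * (K x x).re ∂μ) := by
    rw [hK.hilbertSchmidtSq_eq (by simpa [hg] using i4)]
    simp [hg]
  have hW : ∫ x, γ x ^ 2 * (K x x).re ∂μ ≤ 4 * V := by
    rw [hVdef, ← integral_const_mul]
    refine integral_mono_ae i4 (i2.const_mul 4) ?_
    filter_upwards [hge] with x hx
    have : γ x ^ 2 ≤ 4 * φ x ^ 2 := by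
      rw [← sq_abs (γ x), ← sq_abs (φ x)]
      nlinarith [hγ2 x, abs_nonneg (γ x), abs_nonneg (φ x)]
    nlinarith
  have hHS4 : hilbertSchmidtSq μ K g ≤ ENNReal.ofReal (1 / 4) := by
    rw [hHS]; exact ENNReal.ofReal_le_ofReal (by linarith)
  have hHS1 : hilbertSchmidtSq μ K g < 1 := hHS4.trans_lt (by
    rw [← ENNReal.ofReal_one]; exact ENNReal.ofReal_lt_ofReal_iff one_pos |>.2 (by norm_num))
  obtain ⟨hΦi, hΦ⟩ := hdet.expectation_exp hK.measurable_uncurry hgm ⟨2, hgb⟩ hgc hgz hHS1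
    (fun X => (Real.exp (realStatistic φ X) : ℂ)) (by
      intro X s hs h0
      have h0' : ∀ x ∈ X.1, x ∉ s → φ x = 0 := fun x hx hxs => by
        have := h0 x hx hxs
        simp only [hg, hγ, Complex.ofReal_eq_zero, sub_eq_zero, Real.exp_eq_one_iff] at this
        exact this
      rw [realStatistic, tsum_subtype_eq_sum hs h0', Real.exp_sum]
      push_cast
      refine Finset.prod_congr rfl fun x _ => ?_
      simp [hg, hγ])
  have hz : ∫ x, g x * K x x ∂μ = ((∫ x, γ x * (K x x).re ∂μ : ℝ) : ℂ) := by
    rw [← integral_complex_ofReal]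
    refine integral_congr_ae ?_
    filter_upwards [hK.diag_eq] with x hx
    simp only [hg]
    push_cast
    rw [← hx.1]
  have iS : Integrable (fun X => Real.exp (realStatistic φ X)) P := by
    have h := hΦi.re
    exact h
  have hE : ∫ X, Real.exp (realStatistic φ X) ∂P ≤
      Real.exp (∫ x, γ x * (K x x).re ∂μ) * (1 + 8 * V) := by
    have e1 : ‖∫ X, (Real.exp (realStatistic φ X) : ℂ) ∂P‖ =
        ∫ X, Real.exp (realStatistic φ X) ∂P := by
      have := integral_complex_ofReal (μ := P) (f := fun X => Real.exp (realStatistic φ X))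
      rw [this, Complex.norm_real,
        Real.norm_of_nonneg (integral_nonneg fun _ => (Real.exp_pos _).le)]
    rw [← e1, hΦ, norm_mul, hz, ← Complex.ofReal_exp, Complex.norm_real,
      Real.norm_of_nonneg (Real.exp_pos _).le]
    gcongr
    refine (sum_regCoeff_norm_le hK.measurable_uncurry hgm hHS4).trans ?_
    rw [hHS, ENNReal.toReal_ofReal]
    · linarith
    · exact integral_nonneg_of_ae (hge.mono fun x hx => by
        change 0 ≤ γ x ^ 2 * (K x x).re; positivity)
  have hdiff : (∫ x, γ x * (K x x).re ∂μ) - m ≤ V := by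
    rw [hm, ← integral_sub i3 i1, hVdef]
    refine integral_mono_ae (i3.sub i1) i2 ?_
    filter_upwards [hge] with x hx
    have h2 := (abs_le.1 (Real.abs_exp_sub_one_sub_id_le (h1 x))).2
    have : γ x - φ x ≤ φ x ^ 2 := h2
    nlinarith
  have hfac : ∀ X, Real.exp (realStatistic φ X - m) =
      Real.exp (-m) * Real.exp (realStatistic φ X) := fun X => by
    rw [← Real.exp_add]; congr 1; ring
  simp_rw [hfac]
  refine ⟨iS.const_mul _, ?_⟩
  rw [integral_const_mul]
  calc Real.exp (-m) * ∫ X, Real.exp (realStatistic φ X) ∂P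
      ≤ Real.exp (-m) * (Real.exp (∫ x, γ x * (K x x).re ∂μ) * (1 + 8 * V)) := by gcongr
    _ = Real.exp ((∫ x, γ x * (K x x).re ∂μ) - m) * (1 + 8 * V) := by
        rw [← mul_assoc, ← Real.exp_add]; congr 2; ring
    _ ≤ Real.exp V * (1 + 8 * V) := by gcongr
    _ ≤ 1 + 10 * V := exp_mul_le hV0 hV

/-- Exponential concentration for bounded functions of compact support. -/
lemma realStatistic_cosh_bound_of_compact [SigmaFinite μ] (hK : IsProjectionKernel μ K)
    (hdet : IsDeterminantal P μ K) {φ : E → ℝ} (hφ : Measurable φ) (h1 : ∀ x, |φ x| ≤ 1)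
    (hc : HasCompactSupport φ) (hV : ∫ x, φ x ^ 2 * (K x x).re ∂μ ≤ 1 / 16) :
    Integrable (fun X => Real.cosh (realStatistic φ X - ∫ x, φ x * (K x x).re ∂μ)) P ∧
    ∫ X, Real.cosh (realStatistic φ X - ∫ x, φ x * (K x x).re ∂μ) ∂P ≤
      1 + 10 * ∫ x, φ x ^ 2 * (K x x).re ∂μ := by
  obtain ⟨i1, b1⟩ := realStatistic_exp_bound hK hdet hφ h1 hc hV
  obtain ⟨i2, b2⟩ := realStatistic_exp_bound hK hdet (φ := fun x => -φ x) hφ.neg (by simpa using h1)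
    (hc.comp_left (g := fun t : ℝ => -t) (by simp)) (by simpa using hV)
  have e : ∀ X, realStatistic (fun x => -φ x) X - ∫ x, -φ x * (K x x).re ∂μ =
      -(realStatistic φ X - ∫ x, φ x * (K x x).re ∂μ) := fun X => by
    simp only [realStatistic, tsum_neg, neg_mul, integral_neg]; ring
  simp only [e, neg_sq] at i2 b2
  simp only [Real.cosh_eq]
  refine ⟨(i1.add i2).div_const 2, ?_⟩
  rw [integral_div, integral_add i1 i2]
  linarith

end

section


variable {E : Set ℝ} {P : Measure (Configuration E)} {μ : Measure E} {K : E → E → ℂ}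

/-! ### Linear statistics of integrable functions -/

/-- Local compactness supplies the compact exhaustion along which functions are truncated. A set
without accumulation points is closed. -/
lemma IsGroundSet.locallyCompactSpace (hE : IsGroundSet E) : LocallyCompactSpace E := by
  rcases hE with h | ⟨-, h⟩
  · exact h.locallyCompactSpace
  · have : IsClosed E := isClosed_iff_accPt.2 fun a ha => absurd ha (h a)
    exact this.locallyCompactSpace

lemma linearStatistic_ofReal (φ : E → ℝ) (X : Configuration E) :
    linearStatistic (fun x => (φ x : ℂ)) X = (realStatistic φ X : ℂ) :=
  (Complex.ofReal_tsum (fun x : X.1 => φ x)).symm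

/-- Campbell's formula for bounded functions of compact support. -/
lemma realStatistic_campbell_of_compact [SigmaFinite μ] (hK : IsProjectionKernel μ K)
    (hdet : IsDeterminantal P μ K) {φ : E → ℝ} (hφ : Measurable φ) {C : ℝ} (hC : ∀ x, |φ x| ≤ C)
    (hc : HasCompactSupport φ) :
    Integrable (realStatistic φ) P ∧ ∫ X, realStatistic φ X ∂P = ∫ x, φ x * (K x x).re ∂μ := by
  set g : E → ℂ := fun x => (φ x : ℂ)
  have hgc : HasCompactSupport g := hc.comp_left (g := fun t : ℝ => (t : ℂ)) (by simp)
  obtain ⟨i1, e1⟩ := hdet.tupleSum_prod (g := g) (Complex.measurable_ofReal.comp hφ)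
    ⟨C, by simpa [g] using hC⟩ hgc 1
  have h1 : ∀ X, tupleSum (fun x : Fin 1 → E => ∏ i, g (x i)) X = (realStatistic φ X : ℂ) := by
    intro X
    obtain ⟨s, hs, h0⟩ := exists_finset_of_compact hgc X
    rw [tupleSum_prod_eq g X s hs h0, ← linearStatistic_ofReal, linearStatistic,
      tsum_subtype_eq_sum (φ := fun x => (φ x : ℂ)) hs h0, Finset.powersetCard_one]
    simp [g]
  have h2 : ∫ x : Fin 1 → E, (∏ i, g (x i)) * (Matrix.of fun i j => K (x i) (x j)).det
      ∂(Measure.pi fun _ => μ) = ((∫ x, φ x * (K x x).re ∂μ : ℝ) : ℂ) := by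
    have h3 := integral_fintype_prod_eq_pow (ι := Fin 1) (μ := μ) fun x => g x * K x x
    rw [Fintype.card_fin, pow_one] at h3
    have h4 : ∀ x : Fin 1 → E, (∏ i, g (x i)) * (Matrix.of fun i j => K (x i) (x j)).det =
        ∏ i, (g (x i) * K (x i) (x i)) := fun x => by simp [Matrix.det_unique]
    simp_rw [h4]
    rw [h3, ← integral_complex_ofReal]
    refine integral_congr_ae ?_
    filter_upwards [hK.diag_eq] with x hx
    push_cast
    rw [← hx.1]
  simp only [h1] at i1 e1
  have i2 : Integrable (fun X => (realStatistic φ X : ℂ)) P := by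
    refine i1.congr (Eventually.of_forall fun X => h1 X)
  refine ⟨by have := i2.re; exact this, ?_⟩
  rw [h2, integral_complex_ofReal] at e1
  exact_mod_cast e1

/-! ### From compact support to functions integrable against `K(x,x)` -/

section Exhaustion

variable [LocallyCompactSpace E]

/-- Truncation to the `j`-th set of a compact exhaustion of `E`. -/
def truncate {A : Type*} [Zero A] (φ : E → A) (j : ℕ) : E → A :=
  ((CompactExhaustion.choice E) j).indicator φ

lemma measurable_truncate {φ : E → ℝ} (hφ : Measurable φ) (j : ℕ) : Measurable (truncate φ j) :=
  hφ.indicator ((CompactExhaustion.choice E).isCompact j).measurableSet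

lemma hasCompactSupport_truncate (φ : E → ℝ) (j : ℕ) : HasCompactSupport (truncate φ j) :=
  HasCompactSupport.intro ((CompactExhaustion.choice E).isCompact j) fun _ hx =>
    Set.indicator_of_notMem hx _

lemma abs_truncate_le (φ : E → ℝ) (j : ℕ) (x : E) : |truncate φ j x| ≤ |φ x| := by
  unfold truncate Set.indicator
  split_ifs <;> simp

lemma eventually_truncate (φ : E → ℝ) (x : E) : ∀ᶠ j in atTop, truncate φ j x = φ x := by
  obtain ⟨j, hj⟩ := (CompactExhaustion.choice E).exists_mem x
  filter_upwards [eventually_ge_atTop j] with i hi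
  exact Set.indicator_of_mem ((CompactExhaustion.choice E).subset hi hj) _

lemma truncate_mono {φ : E → ℝ} (h0 : ∀ x, 0 ≤ φ x) (x : E) : Monotone fun j => truncate φ j x := by
  intro i j hij
  exact Set.indicator_le_indicator_of_subset ((CompactExhaustion.choice E).subset hij) h0 x

lemma exists_finset_truncate (φ : E → ℝ) (j : ℕ) (X : Configuration E) :
    ∃ s : Finset E, ↑s ⊆ X.1 ∧ ∀ x ∈ X.1, x ∉ s → truncate φ j x = 0 := by
  have hc : HasCompactSupport fun x => ((truncate φ j x : ℝ) : ℂ) :=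
    HasCompactSupport.intro ((CompactExhaustion.choice E).isCompact j) fun x hx => by
      rw [truncate, Set.indicator_of_notMem hx, Complex.ofReal_zero]
  obtain ⟨s, hs, hs0⟩ := exists_finset_of_compact hc X
  exact ⟨s, hs, fun x hx hxs => Complex.ofReal_eq_zero.1 (hs0 x hx hxs)⟩

omit [LocallyCompactSpace E] in
lemma tsum_ofReal_eq {ψ : E → ℝ} (h0 : ∀ x, 0 ≤ ψ x) {X : Configuration E} {s : Finset E}
    (hs : ↑s ⊆ X.1) (hs0 : ∀ x ∈ X.1, x ∉ s → ψ x = 0) :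
    ∑' x : X.1, ENNReal.ofReal (ψ x) = ENNReal.ofReal (realStatistic ψ X) := by
  have e1 : realStatistic ψ X = _ := tsum_subtype_eq_sum (φ := ψ) hs hs0
  have e2 := tsum_subtype_eq_sum (φ := fun x => ENNReal.ofReal (ψ x)) hs
    (fun x hx hxs => by rw [hs0 x hx hxs, ENNReal.ofReal_zero])
  rw [e1, ENNReal.ofReal_sum_of_nonneg fun x _ => h0 x]
  exact e2

lemma ofReal_realStatistic_truncate {φ : E → ℝ} (h0 : ∀ x, 0 ≤ φ x) (j : ℕ) (X : Configuration E) :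
    ∑' x : X.1, ENNReal.ofReal (truncate φ j x) =
      ENNReal.ofReal (realStatistic (truncate φ j) X) := by
  obtain ⟨s, hs, hs0⟩ := exists_finset_truncate φ j X
  exact tsum_ofReal_eq (fun x => Set.indicator_nonneg (fun x _ => h0 x) x) hs hs0

/-- Monotone convergence along the exhaustion. The sum is taken in `[0, ∞]` because almost sure
summability is only a consequence of this bound. -/
lemma lintegral_tsum_le [SigmaFinite μ] (hK : IsProjectionKernel μ K)
    (hdet : IsDeterminantal P μ K) {φ : E → ℝ} (hφ : Measurable φ) {C : ℝ} (hC : ∀ x, |φ x| ≤ C)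
    (h0 : ∀ x, 0 ≤ φ x) (hi : Integrable (fun x => φ x * (K x x).re) μ) :
    AEMeasurable (fun X : Configuration E => ∑' x : X.1, ENNReal.ofReal (φ x)) P ∧
    ∫⁻ X, ∑' x : X.1, ENNReal.ofReal (φ x) ∂P ≤ ENNReal.ofReal (∫ x, φ x * (K x x).re ∂μ) := by
  have hge : ∀ᵐ x ∂μ, 0 ≤ (K x x).re := hK.diag_eq.mono fun x h => h.2.1
  have hcamp := fun j => realStatistic_campbell_of_compact hK hdet (measurable_truncate hφ j)
    (fun x => (abs_truncate_le φ j x).trans (hC x)) (hasCompactSupport_truncate φ j)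
  have hn : ∀ j x, 0 ≤ truncate φ j x := fun j x => Set.indicator_nonneg (fun x _ => h0 x) x
  have hsup : ∀ X : Configuration E, ∑' x : X.1, ENNReal.ofReal (φ x) =
      ⨆ j, ∑' x : X.1, ENNReal.ofReal (truncate φ j x) := by
    intro X
    refine le_antisymm ?_ (iSup_le fun j => ENNReal.tsum_le_tsum fun x =>
      ENNReal.ofReal_le_ofReal ?_)
    · rw [ENNReal.tsum_eq_iSup_sum]
      refine iSup_le fun t => ?_
      have : ∀ᶠ j in atTop, ∀ x ∈ t, truncate φ j (x : E) = φ x :=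
        (Finset.eventually_all t).2 fun x _ => eventually_truncate φ x
      obtain ⟨j, hj⟩ := this.exists
      refine le_iSup_of_le j ?_
      rw [← Finset.sum_congr rfl fun x hx => congrArg ENNReal.ofReal (hj x hx)]
      exact ENNReal.sum_le_tsum t
    · have := abs_truncate_le φ j x
      rwa [abs_of_nonneg (hn j x), abs_of_nonneg (h0 x)] at this
  have hm : ∀ j, AEMeasurable (fun X : Configuration E =>
      ∑' x : X.1, ENNReal.ofReal (truncate φ j x)) P := fun j => by
    simp_rw [ofReal_realStatistic_truncate h0]
    exact (hcamp j).1.1.aemeasurable.ennreal_ofReal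
  simp_rw [hsup]
  refine ⟨AEMeasurable.iSup hm, ?_⟩
  rw [lintegral_iSup' hm]
  · refine iSup_le fun j => ?_
    simp_rw [ofReal_realStatistic_truncate h0]
    rw [← ofReal_integral_eq_lintegral_ofReal (hcamp j).1
      (Eventually.of_forall fun X => tsum_nonneg fun x => hn j x), (hcamp j).2]
    refine ENNReal.ofReal_le_ofReal (integral_mono_of_nonneg ?_ hi ?_)
    · filter_upwards [hge] with x hx
      exact mul_nonneg (hn j x) hx
    · filter_upwards [hge] with x hx
      have := abs_truncate_le φ j x
      rw [abs_of_nonneg (hn j x), abs_of_nonneg (h0 x)] at this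
      exact mul_le_mul_of_nonneg_right this hx
  · refine Eventually.of_forall fun X i j hij => ENNReal.tsum_le_tsum fun x => ?_
    exact ENNReal.ofReal_le_ofReal (truncate_mono h0 x hij)

lemma ae_summable [SigmaFinite μ] (hK : IsProjectionKernel μ K)
    (hdet : IsDeterminantal P μ K) {φ : E → ℝ} (hφ : Measurable φ) {C : ℝ} (hC : ∀ x, |φ x| ≤ C)
    (hi : Integrable (fun x => φ x * (K x x).re) μ) :
    (∀ᵐ X ∂P, Summable fun x : X.1 => |φ x|) ∧ Integrable (realStatistic fun x => |φ x|) P := by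
  have hge : ∀ᵐ x ∂μ, 0 ≤ (K x x).re := hK.diag_eq.mono fun x h => h.2.1
  have hi' : Integrable (fun x => |φ x| * (K x x).re) μ := by
    refine hi.norm.congr ?_
    filter_upwards [hge] with x hx
    rw [Real.norm_eq_abs, abs_mul, abs_of_nonneg hx]
  obtain ⟨hm, hl⟩ := lintegral_tsum_le hK hdet (φ := fun x => |φ x|) (continuous_abs.measurable.comp hφ)
    (by simpa using hC) (fun x => abs_nonneg _) hi'
  have hs : ∀ᵐ X ∂P, Summable fun x : X.1 => |φ x| := by
    filter_upwards [ae_lt_top' hm (hl.trans_lt ENNReal.ofReal_lt_top).ne] with X hX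
    have h1 : Summable fun x : X.1 => (|φ x|).toNNReal :=
      ENNReal.tsum_coe_ne_top_iff_summable.1 hX.ne
    refine (NNReal.summable_coe.2 h1).congr fun x => ?_
    rw [Real.coe_toNNReal _ (abs_nonneg _)]
  have heq : ∀ᵐ X ∂P, ∑' x : X.1, ENNReal.ofReal |φ x| =
      ENNReal.ofReal (realStatistic (fun x => |φ x|) X) := by
    filter_upwards [hs] with X hX
    rw [realStatistic, ENNReal.ofReal_tsum_of_nonneg (fun x => abs_nonneg _) hX]
  have heq2 : ∀ᵐ X ∂P, (∑' x : X.1, ENNReal.ofReal |φ x|).toReal =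
      realStatistic (fun x => |φ x|) X := by
    filter_upwards [heq] with X hX
    have h0 : 0 ≤ realStatistic (fun x => |φ x|) X :=
      tsum_nonneg (g := fun x : X.1 => |φ x|) fun x => abs_nonneg _
    rw [hX, ENNReal.toReal_ofReal h0]
  refine ⟨hs, ?_⟩
  exact (integrable_toReal_of_lintegral_ne_top hm (hl.trans_lt ENNReal.ofReal_lt_top).ne).congr heq2

lemma ae_tendsto_truncate [SigmaFinite μ] (hK : IsProjectionKernel μ K)
    (hdet : IsDeterminantal P μ K) {φ : E → ℝ} (hφ : Measurable φ) {C : ℝ} (hC : ∀ x, |φ x| ≤ C)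
    (hi : Integrable (fun x => φ x * (K x x).re) μ) :
    ∀ᵐ X ∂P, Tendsto (fun j => realStatistic (truncate φ j) X) atTop (𝓝 (realStatistic φ X)) := by
  filter_upwards [(ae_summable hK hdet hφ hC hi).1] with X hX
  refine tendsto_tsum_of_dominated_convergence hX (fun x => ?_) (Eventually.of_forall fun j x => ?_)
  · exact tendsto_const_nhds.congr' ((eventually_truncate φ x).mono fun j h => h.symm)
  · exact abs_truncate_le φ j x

lemma tendsto_integral_truncate (hK : IsProjectionKernel μ K) {φ : E → ℝ} (hφ : Measurable φ)
    (hi : Integrable (fun x => φ x * (K x x).re) μ) :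
    Tendsto (fun j => ∫ x, truncate φ j x * (K x x).re ∂μ) atTop
      (𝓝 (∫ x, φ x * (K x x).re ∂μ)) := by
  refine tendsto_integral_of_dominated_convergence (fun x => ‖φ x * (K x x).re‖) (fun j => ?_)
    hi.norm (fun j => Eventually.of_forall fun x => ?_) (Eventually.of_forall fun x => ?_)
  · exact ((measurable_truncate hφ j).mul
      (Complex.measurable_re.comp hK.measurable_diag)).aestronglyMeasurable
  · rw [norm_mul, norm_mul]
    exact mul_le_mul_of_nonneg_right (abs_truncate_le φ j x) (norm_nonneg _)
  · exact tendsto_const_nhds.congr' ((eventually_truncate φ x).mono fun j h => by simp only [h])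

/-- Campbell's formula. -/
lemma realStatistic_campbell [SigmaFinite μ] (hK : IsProjectionKernel μ K)
    (hdet : IsDeterminantal P μ K) {φ : E → ℝ} (hφ : Measurable φ) {C : ℝ} (hC : ∀ x, |φ x| ≤ C)
    (hi : Integrable (fun x => φ x * (K x x).re) μ) :
    Integrable (realStatistic φ) P ∧ ∫ X, realStatistic φ X ∂P = ∫ x, φ x * (K x x).re ∂μ := by
  have hcamp := fun j => realStatistic_campbell_of_compact hK hdet (measurable_truncate hφ j)
    (fun x => (abs_truncate_le φ j x).trans (hC x)) (hasCompactSupport_truncate φ j)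
  obtain ⟨hs, hint⟩ := ae_summable hK hdet hφ hC hi
  have hlim := ae_tendsto_truncate hK hdet hφ hC hi
  have hdom : ∀ j, ∀ᵐ X ∂P, ‖realStatistic (truncate φ j) X‖ ≤ realStatistic (fun x => |φ x|) X := by
    intro j
    filter_upwards [hs] with X hX
    have h1 : Summable fun x : X.1 => ‖truncate φ j x‖ :=
      Summable.of_nonneg_of_le (fun _ => norm_nonneg _) (fun x => abs_truncate_le φ j x) hX
    exact (norm_tsum_le_tsum_norm h1).trans (h1.tsum_le_tsum (fun x => abs_truncate_le φ j x) hX)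
  have hm : AEStronglyMeasurable (realStatistic φ) P :=
    aestronglyMeasurable_of_tendsto_ae atTop (fun j => (hcamp j).1.1) hlim
  refine ⟨hint.mono' hm ?_, ?_⟩
  · filter_upwards [hlim, ae_all_iff.2 hdom] with X h1 h2
    exact le_of_tendsto h1.norm (Eventually.of_forall h2)
  · have h1 := tendsto_integral_of_dominated_convergence _ (fun j => (hcamp j).1.1) hint hdom hlim
    simp_rw [fun j => (hcamp j).2] at h1
    exact tendsto_nhds_unique h1 (tendsto_integral_truncate hK hφ hi)

/-- Exponential concentration of linear statistics. -/
lemma realStatistic_cosh_bound [SigmaFinite μ] (hK : IsProjectionKernel μ K)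
    (hdet : IsDeterminantal P μ K) {φ : E → ℝ} (hφ : Measurable φ) (h1 : ∀ x, |φ x| ≤ 1)
    (hi : Integrable (fun x => φ x * (K x x).re) μ)
    (hV : ∫ x, φ x ^ 2 * (K x x).re ∂μ ≤ 1 / 16) :
    Integrable (fun X => Real.cosh (realStatistic φ X - ∫ x, φ x * (K x x).re ∂μ)) P ∧
    ∫ X, Real.cosh (realStatistic φ X - ∫ x, φ x * (K x x).re ∂μ) ∂P ≤
      1 + 10 * ∫ x, φ x ^ 2 * (K x x).re ∂μ := by
  have hge : ∀ᵐ x ∂μ, 0 ≤ (K x x).re := hK.diag_eq.mono fun x h => h.2.1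
  have hm1 : Measurable fun x => (K x x).re := Complex.measurable_re.comp hK.measurable_diag
  have i2 : Integrable (fun x => φ x ^ 2 * (K x x).re) μ := by
    refine hi.mono ((hφ.pow_const 2).mul hm1).aestronglyMeasurable (Eventually.of_forall fun x => ?_)
    rw [norm_mul, norm_mul, norm_pow, Real.norm_eq_abs]
    gcongr
    exact pow_le_of_le_one (abs_nonneg _) (h1 x) two_ne_zero
  set V := ∫ x, φ x ^ 2 * (K x x).re ∂μ with hVdef
  have hVj : ∀ j, ∫ x, truncate φ j x ^ 2 * (K x x).re ∂μ ≤ V := fun j => by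
    refine integral_mono_of_nonneg ?_ i2 ?_
    · filter_upwards [hge] with x hx
      change 0 ≤ truncate φ j x ^ 2 * (K x x).re
      positivity
    · filter_upwards [hge] with x hx
      exact mul_le_mul_of_nonneg_right (sq_le_sq.2 (abs_truncate_le φ j x)) hx
  have hV0 : 0 ≤ V := integral_nonneg_of_ae (hge.mono fun x hx => by
    change 0 ≤ φ x ^ 2 * (K x x).re; positivity)
  have hb := fun j => realStatistic_cosh_bound_of_compact hK hdet (measurable_truncate hφ j)
    (fun x => (abs_truncate_le φ j x).trans (h1 x)) (hasCompactSupport_truncate φ j)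
    ((hVj j).trans hV)
  set F : ℕ → Configuration E → ℝ := fun j X =>
    Real.cosh (realStatistic (truncate φ j) X - ∫ x, truncate φ j x * (K x x).re ∂μ)
  set G : Configuration E → ℝ := fun X =>
    Real.cosh (realStatistic φ X - ∫ x, φ x * (K x x).re ∂μ)
  have hlim : ∀ᵐ X ∂P, Tendsto (fun j => F j X) atTop (𝓝 (G X)) := by
    filter_upwards [ae_tendsto_truncate hK hdet hφ h1 hi] with X hX
    exact (Real.continuous_cosh.tendsto _).comp (hX.sub (tendsto_integral_truncate hK hφ hi))
  have hGm : AEStronglyMeasurable G P :=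
    aestronglyMeasurable_of_tendsto_ae atTop (fun j => (hb j).1.1) hlim
  -- Fatou's lemma carries the bound, uniform over the truncations, to the limit.
  have hfat : ∫⁻ X, ENNReal.ofReal (G X) ∂P ≤ ENNReal.ofReal (1 + 10 * V) := by
    have e1 : ∫⁻ X, ENNReal.ofReal (G X) ∂P =
        ∫⁻ X, liminf (fun j => ENNReal.ofReal (F j X)) atTop ∂P := by
      refine lintegral_congr_ae ?_
      filter_upwards [hlim] with X hX
      exact ((ENNReal.tendsto_ofReal hX).liminf_eq).symm
    rw [e1]
    refine (lintegral_liminf_le' fun j => (hb j).1.1.aemeasurable.ennreal_ofReal).trans ?_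
    refine liminf_le_of_le (by isBoundedDefault) fun b hbb => ?_
    obtain ⟨j, hj⟩ := hbb.exists
    refine hj.trans ?_
    rw [← ofReal_integral_eq_lintegral_ofReal (hb j).1
      (Eventually.of_forall fun X => (Real.cosh_pos _).le)]
    refine ENNReal.ofReal_le_ofReal ((hb j).2.trans ?_)
    linarith [hVj j]
  have hGi : Integrable G P := by
    refine ⟨hGm, ?_⟩
    rw [hasFiniteIntegral_iff_ofReal (Eventually.of_forall fun X => (Real.cosh_pos _).le)]
    exact hfat.trans_lt ENNReal.ofReal_lt_top
  refine ⟨hGi, ?_⟩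
  rw [← ofReal_integral_eq_lintegral_ofReal hGi
    (Eventually.of_forall fun X => (Real.cosh_pos _).le)] at hfat
  exact (ENNReal.ofReal_le_ofReal_iff (by linarith)).1 hfat

end Exhaustion

end

section


variable {E : Set ℝ} {P : Measure (Configuration E)} {μ : Measure E} {K : E → E → ℂ}

/-! ### Moments of centered linear statistics -/

lemma one_add_sq_le_cosh (x : ℝ) : 1 + x ^ 2 / 2 ≤ Real.cosh x := by
  have h1 : Real.cosh x = 1 + 2 * Real.sinh (x / 2) ^ 2 := by
    have h2 := Real.cosh_two_mul (x / 2)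
    have h3 := Real.cosh_sq (x / 2)
    rw [mul_div_cancel₀ x two_ne_zero] at h2
    linarith
  have h4 : (x / 2) ^ 2 ≤ Real.sinh (x / 2) ^ 2 := by
    rw [← sq_abs (x / 2), ← sq_abs (Real.sinh (x / 2)), Real.abs_sinh]
    have := Real.self_le_sinh_iff.2 (abs_nonneg (x / 2))
    gcongr
  rw [h1]; nlinarith

lemma abs_pow_le_cosh (x : ℝ) (p : ℕ) : |x| ^ p ≤ p.factorial * (2 * Real.cosh x) := by
  have h1 := Real.pow_div_factorial_le_exp |x| (abs_nonneg x) p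
  rw [div_le_iff₀ (by positivity)] at h1
  have h2 : Real.exp |x| ≤ 2 * Real.cosh x := by
    rw [← Real.cosh_abs, Real.cosh_eq]
    have := Real.exp_pos (-|x|)
    linarith
  calc |x| ^ p ≤ Real.exp |x| * p.factorial := h1
    _ ≤ 2 * Real.cosh x * p.factorial := by gcongr
    _ = _ := by ring

section Bounds

variable [LocallyCompactSpace E] [SigmaFinite μ]

/-- Division by `C` reduces to `|ψ| ≤ 1` and `V / C² ≤ 1/16`. The bound by `p!` only gives
boundedness of the moments. For the second moment `x²/2 ≤ cosh x - 1` is used instead: the 1 cancels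
in expectation, and the remaining bound tends to 0 with `V`. -/
lemma realStatistic_moments [IsProbabilityMeasure P] (hK : IsProjectionKernel μ K)
    (hdet : IsDeterminantal P μ K)
    {φ : E → ℝ} (hφ : Measurable φ) {C : ℝ} (hC0 : 0 < C) (hC : ∀ x, |φ x| ≤ C)
    (hi : Integrable (fun x => φ x * (K x x).re) μ) {V : ℝ} (hV : V ≤ C ^ 2 / 16)
    (hφV : ∫ x, φ x ^ 2 * (K x x).re ∂μ ≤ V) :
    (∀ p : ℕ, ∫⁻ X, ‖realStatistic φ X - ∫ x, φ x * (K x x).re ∂μ‖ₑ ^ (p : ℝ) ∂P ≤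
      ENNReal.ofReal (C ^ p * (4 * p.factorial))) ∧
    ∫⁻ X, ‖realStatistic φ X - ∫ x, φ x * (K x x).re ∂μ‖ₑ ^ (2 : ℝ) ∂P ≤
      ENNReal.ofReal (20 * V) := by
  have hC2 : 0 < C ^ 2 := by positivity
  set ψ : E → ℝ := fun x => φ x / C
  have hψV : ∫ x, ψ x ^ 2 * (K x x).re ∂μ = (∫ x, φ x ^ 2 * (K x x).re ∂μ) / C ^ 2 := by
    rw [← integral_div]
    congr 1; funext x; simp only [ψ]; ring
  have hψm : ∫ x, ψ x * (K x x).re ∂μ = (∫ x, φ x * (K x x).re ∂μ) / C := by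
    rw [← integral_div]
    congr 1; funext x; simp only [ψ]; ring
  have hψS : ∀ X, realStatistic ψ X = realStatistic φ X / C := fun X => by
    simp only [realStatistic, ψ]; rw [tsum_div_const]
  have hψV' : ∫ x, ψ x ^ 2 * (K x x).re ∂μ ≤ V / C ^ 2 := by rw [hψV]; gcongr
  have hV16 : V / C ^ 2 ≤ 1 / 16 := by rw [div_le_iff₀ hC2]; linarith
  obtain ⟨i1, b1⟩ := realStatistic_cosh_bound hK hdet (φ := ψ) (hφ.div_const C)
    (fun x => by simp only [ψ]; rw [abs_div, abs_of_pos hC0, div_le_one hC0]; exact hC x)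
    ((hi.div_const C).congr (Eventually.of_forall fun x => by simp only [ψ]; ring))
    (hψV'.trans hV16)
  simp only [hψS, hψm, ← sub_div] at i1 b1
  set Z : Configuration E → ℝ := fun X => realStatistic φ X - ∫ x, φ x * (K x x).re ∂μ with hZ
  have b2 : ∫ X, Real.cosh (Z X / C) ∂P ≤ 1 + 10 * (V / C ^ 2) :=
    b1.trans (by linarith)
  have hpow : ∀ (X) (p : ℕ), ‖Z X‖ₑ ^ (p : ℝ) = ENNReal.ofReal (|Z X| ^ p) := fun X p => by
    rw [← ofReal_norm, ENNReal.rpow_natCast, ← ENNReal.ofReal_pow (norm_nonneg _), Real.norm_eq_abs]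
  constructor
  · intro p
    have h1 : ∀ X, ‖Z X‖ₑ ^ (p : ℝ) ≤
        ENNReal.ofReal (C ^ p * (p.factorial * (2 * Real.cosh (Z X / C)))) := fun X => by
      rw [hpow]
      refine ENNReal.ofReal_le_ofReal ?_
      have := abs_pow_le_cosh (Z X / C) p
      rw [abs_div, div_pow, abs_of_pos hC0, div_le_iff₀ (by positivity)] at this
      linarith
    refine (lintegral_mono h1).trans ?_
    rw [← ofReal_integral_eq_lintegral_ofReal]
    · refine ENNReal.ofReal_le_ofReal ?_
      simp_rw [integral_const_mul]
      gcongr ?_ * ?_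
      -- The constant 4 dominates `2 (1 + 10/16)`.
      have h2 : (0 : ℝ) < p.factorial := by positivity
      nlinarith
    · exact ((i1.const_mul 2).const_mul _).const_mul _
    · exact Eventually.of_forall fun X => by
        have := Real.cosh_pos (Z X / C)
        change 0 ≤ C ^ p * (p.factorial * (2 * Real.cosh (Z X / C)))
        positivity
  · have h1 : ∀ X, ‖Z X‖ₑ ^ (2 : ℝ) ≤
        ENNReal.ofReal (C ^ 2 * (2 * (Real.cosh (Z X / C) - 1))) := fun X => by
      have h3 := hpow X 2
      rw [Nat.cast_ofNat] at h3
      rw [h3]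
      refine ENNReal.ofReal_le_ofReal ?_
      have := one_add_sq_le_cosh (Z X / C)
      rw [div_pow] at this
      rw [sq_abs]
      have h4 : Z X ^ 2 = C ^ 2 * (Z X ^ 2 / C ^ 2) := by field_simp
      rw [h4]
      gcongr
      linarith
    refine (lintegral_mono h1).trans ?_
    rw [← ofReal_integral_eq_lintegral_ofReal]
    · refine ENNReal.ofReal_le_ofReal ?_
      simp_rw [integral_const_mul]
      rw [integral_sub i1 (integrable_const 1), integral_const]
      simp only [probReal_univ, one_smul]
      have h5 : C ^ 2 * (V / C ^ 2) = V := by field_simp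
      nlinarith
    · exact ((i1.sub (integrable_const 1)).const_mul 2).const_mul _
    · exact Eventually.of_forall fun X => by
        have := Real.one_le_cosh (Z X / C)
        have h6 : 0 ≤ Real.cosh (Z X / C) - 1 := by linarith
        change 0 ≤ C ^ 2 * (2 * (Real.cosh (Z X / C) - 1))
        positivity

omit [LocallyCompactSpace E] [SigmaFinite μ] in
lemma integrable_part (hK : IsProjectionKernel μ K) {f : E → ℂ}
    (hi : Integrable (fun x => ‖f x‖ * (K x x).re) μ) {φ : E → ℝ} (hφ : Measurable φ)
    (hle : ∀ x, |φ x| ≤ ‖f x‖) : Integrable (fun x => φ x * (K x x).re) μ := by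
  refine hi.mono (hφ.mul (Complex.measurable_re.comp hK.measurable_diag)).aestronglyMeasurable
    (Eventually.of_forall fun x => ?_)
  rw [norm_mul, norm_mul, norm_norm, Real.norm_eq_abs (φ x)]
  exact mul_le_mul_of_nonneg_right (hle x) (norm_nonneg _)

lemma linearStatistic_campbell (hK : IsProjectionKernel μ K)
    (hdet : IsDeterminantal P μ K) {f : E → ℂ} (hf : Measurable f) {C : ℝ} (hC : ∀ x, ‖f x‖ ≤ C)
    (hi : Integrable (fun x => ‖f x‖ * (K x x).re) μ) :
    (∀ᵐ X ∂P, Summable fun x : X.1 => f x) ∧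
    (∀ᵐ X ∂P, linearStatistic f X = (realStatistic (fun x => (f x).re) X : ℂ) +
      realStatistic (fun x => (f x).im) X * Complex.I) ∧
    Integrable (linearStatistic f) P ∧
    ∫ X, linearStatistic f X ∂P = ((∫ x, (f x).re * (K x x).re ∂μ : ℝ) : ℂ) +
      ((∫ x, (f x).im * (K x x).re ∂μ : ℝ) : ℂ) * Complex.I := by
  have hrm : Measurable fun x => (f x).re := Complex.measurable_re.comp hf
  have him : Measurable fun x => (f x).im := Complex.measurable_im.comp hf
  have hir := integrable_part hK hi hrm fun x => Complex.abs_re_le_norm _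
  have hii := integrable_part hK hi him fun x => Complex.abs_im_le_norm _
  have hCr : ∀ x, |(f x).re| ≤ C := fun x => (Complex.abs_re_le_norm _).trans (hC x)
  have hCi : ∀ x, |(f x).im| ≤ C := fun x => (Complex.abs_im_le_norm _).trans (hC x)
  obtain ⟨cr1, cr2⟩ := realStatistic_campbell hK hdet hrm hCr hir
  obtain ⟨ci1, ci2⟩ := realStatistic_campbell hK hdet him hCi hii
  have hs : ∀ᵐ X ∂P, (Summable fun x : X.1 => ((f x).re : ℂ)) ∧
      Summable fun x : X.1 => ((f x).im : ℂ) := by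
    filter_upwards [(ae_summable hK hdet hrm hCr hir).1, (ae_summable hK hdet him hCi hii).1]
      with X h1 h2
    exact ⟨Complex.summable_ofReal.2 h1.of_abs, Complex.summable_ofReal.2 h2.of_abs⟩
  have hdec : ∀ X : Configuration E, (fun x : X.1 => f x) =
      fun x : X.1 => ((f x).re : ℂ) + ((f x).im : ℂ) * Complex.I := fun X => by
    funext x; exact (Complex.re_add_im _).symm
  have heq : ∀ᵐ X ∂P, linearStatistic f X = (realStatistic (fun x => (f x).re) X : ℂ) +
      realStatistic (fun x => (f x).im) X * Complex.I := by
    filter_upwards [hs] with X hX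
    rw [linearStatistic, hdec X, hX.1.tsum_add (hX.2.mul_right _), tsum_mul_right,
      ← linearStatistic_ofReal, ← linearStatistic_ofReal]
    rfl
  have hint : Integrable (fun X => (realStatistic (fun x => (f x).re) X : ℂ) +
      realStatistic (fun x => (f x).im) X * Complex.I) P :=
    cr1.ofReal.add (ci1.ofReal.mul_const _)
  refine ⟨?_, heq, hint.congr (heq.mono fun X h => h.symm), ?_⟩
  · filter_upwards [hs] with X hX
    rw [hdec X]
    exact hX.1.add (hX.2.mul_right _)
  · rw [integral_congr_ae heq, integral_add cr1.ofReal (ci1.ofReal.mul_const _), integral_mul_const,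
      ← cr2, ← ci2]
    congr 1
    · exact integral_ofReal
    · congr 1; exact integral_ofReal

/-- The centered linear statistic. -/
def centeredStat (P : Measure (Configuration E)) (f : E → ℂ) (X : Configuration E) : ℂ :=
  linearStatistic f X - ∫ Z, linearStatistic f Z ∂P

lemma eLpNorm_centeredStat_le [IsProbabilityMeasure P] (hK : IsProjectionKernel μ K)
    (hdet : IsDeterminantal P μ K) {f : E → ℂ} (hf : Measurable f) {C : ℝ} (hC0 : 0 < C)
    (hC : ∀ x, ‖f x‖ ≤ C) (hi : Integrable (fun x => ‖f x‖ * (K x x).re) μ)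
    (hV : ∫ x, ‖f x‖ ^ 2 * (K x x).re ∂μ ≤ C ^ 2 / 16) :
    (∀ p : ℕ, 1 ≤ p → eLpNorm (centeredStat P f) p P ≤
      2 * ENNReal.ofReal (C ^ p * (4 * p.factorial)) ^ (1 / (p : ℝ))) ∧
    eLpNorm (centeredStat P f) 2 P ≤
      2 * ENNReal.ofReal (20 * ∫ x, ‖f x‖ ^ 2 * (K x x).re ∂μ) ^ (1 / 2 : ℝ) := by
  have hge : ∀ᵐ x ∂μ, 0 ≤ (K x x).re := hK.diag_eq.mono fun x h => h.2.1
  have hkm : Measurable fun x => (K x x).re := Complex.measurable_re.comp hK.measurable_diag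
  obtain ⟨-, heq, -, hmean⟩ := linearStatistic_campbell hK hdet hf hC hi
  have i2 : Integrable (fun x => ‖f x‖ ^ 2 * (K x x).re) μ := by
    refine (hi.const_mul C).mono ((hf.norm.pow_const 2).mul hkm).aestronglyMeasurable
      (Eventually.of_forall fun x => ?_)
    rw [norm_mul, norm_mul, norm_mul, ← mul_assoc, norm_pow, norm_norm, sq, Real.norm_of_nonneg hC0.le]
    gcongr
    exact hC x
  have hpart : ∀ φ : E → ℝ, Measurable φ → (∀ x, |φ x| ≤ ‖f x‖) →
      (∀ p : ℕ, 1 ≤ p →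
        eLpNorm (fun X => realStatistic φ X - ∫ x, φ x * (K x x).re ∂μ) p P ≤
          ENNReal.ofReal (C ^ p * (4 * p.factorial)) ^ (1 / (p : ℝ))) ∧
      eLpNorm (fun X => realStatistic φ X - ∫ x, φ x * (K x x).re ∂μ) 2 P ≤
        ENNReal.ofReal (20 * ∫ x, ‖f x‖ ^ 2 * (K x x).re ∂μ) ^ (1 / 2 : ℝ) ∧
      AEStronglyMeasurable (fun X => realStatistic φ X - ∫ x, φ x * (K x x).re ∂μ) P := by
    intro φ hφ hle
    have hiφ := integrable_part hK hi hφ hle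
    have hCφ : ∀ x, |φ x| ≤ C := fun x => (hle x).trans (hC x)
    have hVφ : ∫ x, φ x ^ 2 * (K x x).re ∂μ ≤ ∫ x, ‖f x‖ ^ 2 * (K x x).re ∂μ := by
      refine integral_mono_of_nonneg ?_ i2 ?_
      · filter_upwards [hge] with x hx
        change 0 ≤ φ x ^ 2 * (K x x).re
        positivity
      · filter_upwards [hge] with x hx
        refine mul_le_mul_of_nonneg_right ?_ hx
        rw [← sq_abs]
        gcongr
        exact hle x
    obtain ⟨m1, m2⟩ := realStatistic_moments hK hdet hφ hC0 hCφ hiφ hV hVφ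
    refine ⟨fun p hp => ?_, ?_,
      ((realStatistic_campbell hK hdet hφ hCφ hiφ).1.sub (integrable_const _)).1⟩
    · rw [eLpNorm_eq_lintegral_rpow_enorm_toReal (by positivity) (ENNReal.natCast_ne_top p),
        ENNReal.toReal_natCast]
      exact ENNReal.rpow_le_rpow (m1 p) (by positivity)
    · rw [eLpNorm_eq_lintegral_rpow_enorm_toReal (by norm_num) (by norm_num), ENNReal.toReal_ofNat]
      exact ENNReal.rpow_le_rpow m2 (by positivity)
  obtain ⟨r1, r2, r3⟩ := hpart (fun x => (f x).re) (Complex.measurable_re.comp hf) fun x => Complex.abs_re_le_norm _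
  obtain ⟨s1, s2, s3⟩ := hpart (fun x => (f x).im) (Complex.measurable_im.comp hf) fun x => Complex.abs_im_le_norm _
  set A : Configuration E → ℝ := fun X =>
    realStatistic (fun x => (f x).re) X - ∫ x, (f x).re * (K x x).re ∂μ
  set B : Configuration E → ℝ := fun X =>
    realStatistic (fun x => (f x).im) X - ∫ x, (f x).im * (K x x).re ∂μ
  have hAB : centeredStat P f =ᵐ[P] (fun X => (A X : ℂ)) + fun X => (B X : ℂ) * Complex.I := by
    filter_upwards [heq] with X hX
    rw [centeredStat, hX, hmean]
    simp only [A, B, Pi.add_apply]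
    push_cast; ring
  have hsum : ∀ q : ENNReal, 1 ≤ q → eLpNorm (centeredStat P f) q P ≤
      eLpNorm A q P + eLpNorm B q P := by
    intro q hq
    rw [eLpNorm_congr_ae hAB]
    refine (eLpNorm_add_le (Complex.continuous_ofReal.comp_aestronglyMeasurable r3)
      ((Complex.continuous_ofReal.comp_aestronglyMeasurable s3).mul_const _) hq).trans_eq ?_
    congr 1
    · exact eLpNorm_congr_norm_ae (Eventually.of_forall fun X => by simp)
    · exact eLpNorm_congr_norm_ae (Eventually.of_forall fun X => by simp)
  refine ⟨fun p hp => ?_, ?_⟩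
  · refine (hsum p (by exact_mod_cast hp)).trans ?_
    rw [two_mul]
    exact add_le_add (r1 p hp) (s1 p hp)
  · refine (hsum 2 (by norm_num)).trans ?_
    rw [two_mul]
    exact add_le_add r2 s2

end Bounds

end

section


variable {E : Set ℝ} {P : Measure (Configuration E)} {μ : Measure E} {K : E → E → ℂ}

/-! ### Regularized sums -/

lemma measurableSet_window (E : Set ℝ) (T : ℝ) : MeasurableSet (window E T) :=
  measurableSet_le (measurable_subtype_coe.norm) measurable_const

lemma isBounded_window (E : Set ℝ) (T : ℝ) : Bornology.IsBounded (window E T) := by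
  refine Metric.isBounded_iff.2 ⟨2 * T, fun x hx y hy => ?_⟩
  rw [Subtype.dist_eq, Real.dist_eq]
  change |(x : ℝ)| ≤ T at hx
  change |(y : ℝ)| ≤ T at hy
  have := abs_sub (x : ℝ) y
  linarith

lemma window_mono (E : Set ℝ) {S T : ℝ} (h : S ≤ T) : window E S ⊆ window E T :=
  fun _ hx => le_trans hx h

lemma linearStatistic_restrict (W : Set E) (φ : E → ℂ) (X : Configuration E) :
    linearStatistic φ (X.restrict W) = linearStatistic (W.indicator φ) X := by
  rw [linearStatistic, linearStatistic, tsum_subtype X.1 (W.indicator φ), Set.indicator_indicator]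
  exact tsum_subtype (X.1 ∩ W) φ

lemma centeredStat_window (φ : E → ℂ) (T : ℝ) :
    centeredStat P ((window E T).indicator φ) = fun X =>
      linearStatistic φ (X.restrict (window E T)) -
        ∫ Z, linearStatistic φ (Z.restrict (window E T)) ∂P := by
  funext X
  simp only [centeredStat, linearStatistic_restrict]

lemma integrable_norm_window (hK : IsProjectionKernel μ K) {f : E → ℂ} (hf : Measurable f) {C : ℝ}
    (hC : ∀ x, ‖f x‖ ≤ C) (T : ℝ) :
    Integrable (fun x => ‖(window E T).indicator f x‖ * (K x x).re) μ := by
  have hC0 : ∀ x : E, ‖(window E T).indicator f x‖ ≤ C := fun x =>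
    (norm_indicator_le_norm_self f x).trans (hC x)
  refine hK.integrable_real_mul (hf.indicator (measurableSet_window E T)).norm (C := C)
    (fun x => by rw [abs_norm]; exact hC0 x) (measurableSet_window E T) (isBounded_window E T) ?_
  intro x hx
  rw [Set.indicator_of_notMem hx, norm_zero]

section Bounds

variable [LocallyCompactSpace E] [SigmaFinite μ]

lemma memLp_linearStatistic [IsProbabilityMeasure P] (hK : IsProjectionKernel μ K)
    (hdet : IsDeterminantal P μ K) {f : E → ℂ} (hf : Measurable f) {C : ℝ} (hC : ∀ x, ‖f x‖ ≤ C)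
    (hi : Integrable (fun x => ‖f x‖ * (K x x).re) μ) {p : ℕ} (hp : 1 ≤ p) :
    MemLp (centeredStat P f) p P ∧ MemLp (linearStatistic f) p P := by
  set V := ∫ x, ‖f x‖ ^ 2 * (K x x).re ∂μ
  have h1 : MemLp (centeredStat P f) p P := by
    -- The bound on `f` may be enlarged freely; here it is made so large that `V` is at most its
    -- square over 16, thanks to the cross term `2 · 16|V|` of the square.
    obtain ⟨h1, -⟩ := eLpNorm_centeredStat_le hK hdet hf (C := |C| + 1 + 16 * |V|) (by positivity)
      (fun x => (hC x).trans (by nlinarith [le_abs_self C, abs_nonneg V])) hi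
      (by nlinarith [le_abs_self V, abs_nonneg V, abs_nonneg C,
        mul_nonneg (abs_nonneg V) (abs_nonneg C), sq_nonneg (16 * |V|)])
    refine ⟨((linearStatistic_campbell hK hdet hf hC hi).2.2.1.sub (integrable_const _)).1,
      (h1 p hp).trans_lt ?_⟩
    exact ENNReal.mul_lt_top (by norm_num) (ENNReal.rpow_lt_top_of_nonneg (by positivity)
      ENNReal.ofReal_ne_top)
  refine ⟨h1, (h1.add (memLp_const (∫ Z, linearStatistic f Z ∂P))).ae_eq
    (Eventually.of_forall fun X => ?_)⟩
  simp [centeredStat]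

lemma centeredStat_sub [IsProbabilityMeasure P] (hK : IsProjectionKernel μ K)
    (hdet : IsDeterminantal P μ K) {f g : E → ℂ} (hf : Measurable f) (hg : Measurable g) {C : ℝ}
    (hC : ∀ x, ‖f x‖ ≤ C) (hC' : ∀ x, ‖g x‖ ≤ C)
    (hi : Integrable (fun x => ‖f x‖ * (K x x).re) μ)
    (hi' : Integrable (fun x => ‖g x‖ * (K x x).re) μ) :
    centeredStat P f - centeredStat P g =ᵐ[P] centeredStat P (f - g) := by
  obtain ⟨sf, -, if1, -⟩ := linearStatistic_campbell hK hdet hf hC hi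
  obtain ⟨sg, -, ig1, -⟩ := linearStatistic_campbell hK hdet hg hC' hi'
  have h : linearStatistic (f - g) =ᵐ[P] linearStatistic f - linearStatistic g := by
    filter_upwards [sf, sg] with X h1 h2
    exact h1.tsum_sub h2
  filter_upwards [h] with X hX
  simp only [centeredStat, Pi.sub_apply, hX]
  rw [integral_congr_ae h]
  simp only [Pi.sub_apply]
  rw [integral_sub if1 ig1]
  ring

/-- The centered sums over windows of a bounded function that is square integrable against the
first correlation measure form a Cauchy family in `L²`. -/
lemma exists_bound_window [IsProbabilityMeasure P] (hK : IsProjectionKernel μ K)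
    (hdet : IsDeterminantal P μ K) {f : E → ℂ} (hf : Measurable f) {C : ℝ} (hC : ∀ x, ‖f x‖ ≤ C)
    (hi : Integrable (fun x => ‖f x‖ ^ 2 * (K x x).re) μ) :
    (∃ b : ℝ → ENNReal, (∀ S T N : ℝ, N ≤ S → N ≤ T →
      eLpNorm (centeredStat P ((window E S).indicator f) -
        centeredStat P ((window E T).indicator f)) 2 P ≤ b N) ∧ Tendsto b atTop (𝓝 0)) ∧
    ∀ p : ℕ, 1 ≤ p → ∃ M : ENNReal, M < ⊤ ∧
      ∀ T, eLpNorm (centeredStat P ((window E T).indicator f)) p P ≤ M := by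
  have hge : ∀ᵐ x ∂μ, 0 ≤ (K x x).re := hK.diag_eq.mono fun x h => h.2.1
  have hkm : Measurable fun x => (K x x).re := Complex.measurable_re.comp hK.measurable_diag
  set V := ∫ x, ‖f x‖ ^ 2 * (K x x).re ∂μ
  have hV0 : 0 ≤ V := integral_nonneg_of_ae (hge.mono fun x hx => by
    change 0 ≤ ‖f x‖ ^ 2 * (K x x).re
    positivity)
  set D : ℝ := |C| + 1 + 16 * V with hD
  have hD0 : 0 < D := by positivity
  have hVD : V ≤ D ^ 2 / 16 := by
    nlinarith [mul_nonneg hV0 (abs_nonneg C), sq_nonneg (16 * V), abs_nonneg C]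
  have hCD : C ≤ D := by nlinarith [le_abs_self C]
  have hsq : ∀ (g : E → ℂ) (A : Set E), Measurable g → MeasurableSet A →
      (∀ x, ‖g x‖ ^ 2 ≤ A.indicator (fun x => ‖f x‖ ^ 2) x) →
      ∫ x, ‖g x‖ ^ 2 * (K x x).re ∂μ ≤ ∫ x in A, ‖f x‖ ^ 2 * (K x x).re ∂μ := by
    intro g A hg hA hle
    rw [← integral_indicator hA]
    refine integral_mono_of_nonneg ?_ (hi.indicator hA) ?_
    · filter_upwards [hge] with x hx
      change 0 ≤ ‖g x‖ ^ 2 * (K x x).re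
      positivity
    · filter_upwards [hge] with x hx
      have := mul_le_mul_of_nonneg_right (hle x) hx
      refine this.trans_eq ?_
      by_cases h : x ∈ A <;> simp [h]
  have hle : ∀ (A : Set E), MeasurableSet A → ∫ x in A, ‖f x‖ ^ 2 * (K x x).re ∂μ ≤ V := by
    intro A hA
    refine setIntegral_le_integral hi (hge.mono fun x hx => ?_)
    change 0 ≤ ‖f x‖ ^ 2 * (K x x).re
    positivity
  have hw : ∀ T, Measurable ((window E T).indicator f) := fun T =>
    hf.indicator (measurableSet_window E T)
  have hwC : ∀ T x, ‖(window E T).indicator f x‖ ≤ C := fun T x =>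
    (norm_indicator_le_norm_self f x).trans (hC x)
  have hwi := integrable_norm_window hK hf hC
  -- The modulus `b N` comes from the mass of `|f|² K(x,x)` outside the `N`-th window, since the
  -- difference of two larger windowed functions is supported there and dominated by `|f|`.
  refine ⟨⟨fun N => 2 * ENNReal.ofReal
    (20 * ∫ x in (window E N)ᶜ, ‖f x‖ ^ 2 * (K x x).re ∂μ) ^ (1 / 2 : ℝ), ?_, ?_⟩, ?_⟩
  · intro S T N hS hT
    rw [eLpNorm_congr_ae (centeredStat_sub hK hdet (hw S) (hw T) (hwC S) (hwC T) (hwi S) (hwi T))]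
    have hval : ∀ x, ‖((window E S).indicator f - (window E T).indicator f) x‖ ≤
        (window E N)ᶜ.indicator (fun x => ‖f x‖) x := by
      intro x
      rw [Pi.sub_apply]
      by_cases hN : x ∈ window E N
      · rw [Set.indicator_of_mem (window_mono E hS hN), Set.indicator_of_mem (window_mono E hT hN),
          sub_self, norm_zero]
        exact Set.indicator_nonneg (fun _ _ => norm_nonneg _) _
      · rw [Set.indicator_of_mem (s := (window E N)ᶜ) hN]
        by_cases h1 : x ∈ window E S <;> by_cases h2 : x ∈ window E T <;> simp [h1, h2]
    have hnorm : ∀ x, ‖((window E S).indicator f - (window E T).indicator f) x‖ ≤ ‖f x‖ :=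
      fun x => (hval x).trans (Set.indicator_le_self' (fun _ _ => norm_nonneg _) x)
    have hsqle := hsq _ (window E N)ᶜ ((hw S).sub (hw T)) (measurableSet_window E N).compl
      fun x => by
        refine (pow_le_pow_left₀ (norm_nonneg _) (hval x) 2).trans_eq ?_
        by_cases h : x ∈ (window E N)ᶜ <;> simp [h]
    have hint : Integrable (fun x => ‖((window E S).indicator f - (window E T).indicator f) x‖ *
        (K x x).re) μ := by
      refine ((hwi S).add (hwi T)).mono (((hw S).sub (hw T)).norm.mul hkm).aestronglyMeasurable ?_
      filter_upwards [hge] with x hx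
      simp only [Pi.add_apply]
      rw [← add_mul, norm_mul, norm_mul, norm_norm]
      refine mul_le_mul_of_nonneg_right ((norm_sub_le _ _).trans ?_) (norm_nonneg _)
      exact le_abs_self _
    refine ((eLpNorm_centeredStat_le hK hdet ((hw S).sub (hw T)) hD0
      (fun x => (hnorm x).trans ((hC x).trans hCD)) hint
      (hsqle.trans ((hle _ (measurableSet_window E N).compl).trans hVD))).2).trans ?_
    exact mul_le_mul_right (ENNReal.rpow_le_rpow (ENNReal.ofReal_le_ofReal
      (mul_le_mul_of_nonneg_left hsqle (by norm_num))) (by norm_num)) _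
  · have h1 : Tendsto (fun N => ∫ x in (window E N)ᶜ, ‖f x‖ ^ 2 * (K x x).re ∂μ) atTop (𝓝 0) := by
      have h2 := tendsto_setIntegral_of_antitone (μ := μ) (s := fun N : ℝ => (window E N)ᶜ)
        (f := fun x => ‖f x‖ ^ 2 * (K x x).re)
        (fun N => (measurableSet_window E N).compl)
        (fun S T h => Set.compl_subset_compl.2 (window_mono E h)) ⟨0, hi.integrableOn⟩
      have h3 : ⋂ N : ℝ, (window E N)ᶜ = ∅ := by
        ext x
        simp only [Set.mem_iInter, Set.mem_compl_iff, Set.mem_empty_iff_false, iff_false, not_forall,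
          not_not]
        exact ⟨|(x : ℝ)|, le_refl |(x : ℝ)|⟩
      rwa [h3, Measure.restrict_empty, integral_zero_measure] at h2
    have h4 : Tendsto (fun N => ENNReal.ofReal
        (20 * ∫ x in (window E N)ᶜ, ‖f x‖ ^ 2 * (K x x).re ∂μ) ^ (1 / 2 : ℝ)) atTop (𝓝 0) := by
      have h5 := (ENNReal.continuous_rpow_const (y := (1 / 2 : ℝ))).continuousAt.tendsto.comp
        (ENNReal.tendsto_ofReal (h1.const_mul 20))
      simpa [Function.comp_def] using h5
    simpa using ENNReal.Tendsto.const_mul h4 (Or.inr (by norm_num : (2 : ENNReal) ≠ ⊤))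
  · intro p hp
    refine ⟨2 * ENNReal.ofReal (D ^ p * (4 * p.factorial)) ^ (1 / (p : ℝ)),
      ENNReal.mul_lt_top (by norm_num) (ENNReal.rpow_lt_top_of_nonneg (by positivity)
        ENNReal.ofReal_ne_top), fun T => ?_⟩
    refine (eLpNorm_centeredStat_le hK hdet (hw T) hD0 (fun x => (hwC T x).trans hCD) (hwi T)
      ((hsq _ (window E T) (hw T) (measurableSet_window E T) fun x => ?_).trans
        ((hle _ (measurableSet_window E T)).trans hVD))).1 p hp
    by_cases h : x ∈ window E T <;> simp [h]

/-- The limit is found by completeness of `L²`, and convergence in `L²` of a probability measure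
implies convergence in `L¹`. -/
lemma exists_isCenteredSum [IsProbabilityMeasure P] (hK : IsProjectionKernel μ K)
    (hdet : IsDeterminantal P μ K) {f : E → ℂ} (hf : Measurable f) {C : ℝ} (hC : ∀ x, ‖f x‖ ≤ C)
    (hi : Integrable (fun x => ‖f x‖ ^ 2 * (K x x).re) μ) :
    ∃ Y : Configuration E → ℂ, IsCenteredSum P f Y := by
  obtain ⟨⟨b, hb, hb0⟩, -⟩ := exists_bound_window hK hdet hf hC hi
  have hm : ∀ T, MemLp (centeredStat P ((window E T).indicator f)) 2 P := fun T => by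
    have := (memLp_linearStatistic hK hdet (hf.indicator (measurableSet_window E T))
      (fun x => (norm_indicator_le_norm_self f x).trans (hC x))
      (integrable_norm_window hK hf hC T) (p := 2) (by norm_num)).1
    exact_mod_cast this
  have hcauchy : CauchySeq fun T => (hm T).toLp := by
    refine EMetric.cauchySeq_iff_le_tendsto_0.2 ⟨b, fun S T N hS hT => ?_, hb0⟩
    rw [Lp.edist_toLp_toLp]
    exact hb S T N hS hT
  obtain ⟨Y, hY⟩ := cauchySeq_tendsto_of_complete hcauchy
  have hYm := Lp.memLp Y
  refine ⟨Y, hYm.integrable (by norm_num), ?_⟩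
  have h1 : Tendsto (fun T => eLpNorm (centeredStat P ((window E T).indicator f) - (Y : Configuration E → ℂ)) 2 P) atTop
      (𝓝 0) := by
    have h2 := (Lp.tendsto_Lp_iff_tendsto_eLpNorm' _ _).1 hY
    refine h2.congr fun T => eLpNorm_congr_ae ?_
    filter_upwards [(hm T).coeFn_toLp] with X hX
    simp only [Pi.sub_apply, hX]
  refine tendsto_of_tendsto_of_tendsto_of_le_of_le tendsto_const_nhds h1 (fun _ => zero_le) fun T => ?_
  rw [centeredStat_window]
  refine eLpNorm_le_eLpNorm_of_exponent_le (by norm_num) ?_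
  have h3 := ((hm T).sub hYm).1
  rw [centeredStat_window] at h3
  exact h3

/-- `Y` is an arbitrary `L¹` limit. The windowed sums are bounded in `L^p` uniformly in `T`, and
convergence in measure transfers such a bound to the limit. -/
lemma IsCenteredSum.memLp [IsProbabilityMeasure P] (hK : IsProjectionKernel μ K)
    (hdet : IsDeterminantal P μ K) {f : E → ℂ} (hf : Measurable f) {C : ℝ} (hC : ∀ x, ‖f x‖ ≤ C)
    (hi : Integrable (fun x => ‖f x‖ ^ 2 * (K x x).re) μ) {Y : Configuration E → ℂ}
    (hY : IsCenteredSum P f Y) {p : ℕ} (hp : 1 ≤ p) : MemLp Y p P := by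
  obtain ⟨-, hM⟩ := exists_bound_window hK hdet hf hC hi
  obtain ⟨M, hMt, hM⟩ := hM p hp
  have hm : ∀ T, AEStronglyMeasurable (centeredStat P ((window E T).indicator f)) P := fun T =>
    (memLp_linearStatistic hK hdet (hf.indicator (measurableSet_window E T))
      (fun x => (norm_indicator_le_norm_self f x).trans (hC x))
      (integrable_norm_window hK hf hC T) hp).1.1
  refine ⟨hY.1.1, (eLpNorm_le_of_tendstoInMeasure (u := (atTop : Filter ℝ))
    (Eventually.of_forall hM)
    (tendstoInMeasure_of_tendsto_eLpNorm one_ne_zero hm hY.1.1 ?_) hm).trans_lt hMt⟩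
  simp only [centeredStat_window]
  exact hY.2

end Bounds

/-! ### Moments of specializations -/

/-- Products are controlled by Hölder's inequality with exponents `2p` and `2p`, so the induction
has to carry all `p` at once. -/
lemma memLp_specialize [IsProbabilityMeasure P] {a : ℕ+ → Configuration E → ℂ}
    (h : ∀ (k : ℕ+) (p : ℕ), 1 ≤ p → MemLp (a k) p P) (F : SymFunc) :
    ∀ p : ℕ, 1 ≤ p → MemLp (specialize a F) p P := by
  induction F using MvPolynomial.induction_on with
  | C c =>
    intro p _
    have : specialize a (MvPolynomial.C c) = fun _ => c := by
      funext X
      simp [specialize]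
    rw [this]
    exact memLp_const c
  | add F G hF hG =>
    intro p hp
    rw [map_add]
    exact (hF p hp).add (hG p hp)
  | mul_X F k hF =>
    intro p hp
    have hX : specialize a (MvPolynomial.X k) = a k := MvPolynomial.aeval_X _ _
    rw [map_mul, hX]
    have hp' : (p : ENNReal) ≠ 0 := by positivity
    have : ENNReal.HolderTriple ((2 * p : ℕ) : ENNReal) ((2 * p : ℕ) : ENNReal) (p : ENNReal) :=
      ⟨by
        push_cast
        rw [ENNReal.mul_inv (Or.inl (by norm_num)) (Or.inl (by norm_num)), ← add_mul,
          ENNReal.inv_two_add_inv_two, one_mul]⟩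
    exact (h k (2 * p) (by omega)).mul (hF (2 * p) (by omega))

end

section


variable {E : Set ℝ} {P : Measure (Configuration E)} {μ : Measure E} {K : E → E → ℂ}

/-! ### Measurability of linear statistics -/

lemma sigmaOn_mono {W W' : Set E} (h : W ⊆ W') : sigmaOn W ≤ sigmaOn W' :=
  iSup₂_mono' fun B hB => ⟨B, ⟨hB.1.trans h, hB.2⟩, le_rfl⟩

lemma sigmaOn_le (W : Set E) : sigmaOn W ≤ (inferInstance : MeasurableSpace (Configuration E)) :=
  sigmaOn_mono (Set.subset_univ W)

lemma measurable_count_sigmaOn {W B : Set E} (hBW : B ⊆ W) (hB : MeasurableSet B)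
    (hb : Bornology.IsBounded B) : Measurable[sigmaOn W] (count B : Configuration E → ℕ) := by
  have h : MeasurableSpace.comap (count B) ⊤ ≤ (sigmaOn W : MeasurableSpace (Configuration E)) :=
    le_iSup₂_of_le (f := fun (B : Set E)
      (_ : B ⊆ W ∧ MeasurableSet B ∧ Bornology.IsBounded B) =>
        MeasurableSpace.comap (count B) ⊤) B ⟨hBW, hB, hb⟩ le_rfl
  exact fun s _ => h _ ⟨s, trivial, rfl⟩

lemma linearStatistic_indicator_eq_sum {W : Set E} (hb : Bornology.IsBounded W) (φ : E → ℂ)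
    (X : Configuration E) :
    linearStatistic (W.indicator φ) X = ∑ x ∈ (X.finite_inter hb).toFinset, φ x := by
  rw [linearStatistic, tsum_subtype_eq_sum (s := (X.finite_inter hb).toFinset)]
  · refine Finset.sum_congr rfl fun x hx => Set.indicator_of_mem ?_ _
    exact ((X.finite_inter hb).mem_toFinset.1 hx).2
  · intro x hx
    exact ((X.finite_inter hb).mem_toFinset.1 hx).1
  · intro x hx hx'
    refine Set.indicator_of_notMem (fun hxW => hx' ?_) _
    exact (X.finite_inter hb).mem_toFinset.2 ⟨hx, hxW⟩

lemma linearStatistic_simpleFunc {W : Set E} (hb : Bornology.IsBounded W) (s : SimpleFunc E ℂ)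
    (X : Configuration E) : linearStatistic (W.indicator s) X =
      ∑ y ∈ s.range, (count (W ∩ s ⁻¹' {y}) X : ℂ) * y := by
  classical
  rw [linearStatistic_indicator_eq_sum hb,
    ← Finset.sum_fiberwise_of_maps_to (g := s) (t := s.range) fun x _ => s.mem_range_self x]
  refine Finset.sum_congr rfl fun y _ => ?_
  rw [Finset.sum_congr rfl (g := fun _ => y) fun x hx => (Finset.mem_filter.1 hx).2,
    Finset.sum_const, nsmul_eq_mul]
  congr 2
  rw [count, ← Set.ncard_coe_finset]
  congr 1
  ext x
  simp only [Finset.coe_filter, Set.Finite.mem_toFinset, Set.mem_ofPred_eq, Set.mem_inter_iff,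
    Set.mem_preimage, Set.mem_singleton_iff]
  tauto

/-- For a simple function the sum is a finite combination of counts. Only finitely many points lie
in `W`, so pointwise approximation of `φ` suffices. -/
lemma measurable_linearStatistic {W W' : Set E} (hW : MeasurableSet W) (hb : Bornology.IsBounded W)
    (hWW : W ⊆ W') {φ : E → ℂ} (hφ : Measurable φ) :
    Measurable[sigmaOn W'] (linearStatistic (W.indicator φ)) := by
  have hs := hφ.stronglyMeasurable
  refine @measurable_of_tendsto_metrizable _ _ (sigmaOn W') _ _ _ _
    (fun n => linearStatistic (W.indicator (hs.approx n))) _ (fun n => ?_) ?_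
  · rw [funext (linearStatistic_simpleFunc hb (hs.approx n))]
    refine @Finset.measurable_fun_sum _ _ _ _ _ _ (sigmaOn W') _ _ fun y _ => ?_
    have h1 : Measurable[sigmaOn W'] fun X : Configuration E =>
        (count (W ∩ hs.approx n ⁻¹' {y}) X : ℂ) :=
      (measurable_from_top (f := fun n : ℕ => (n : ℂ))).comp
        (measurable_count_sigmaOn (Set.inter_subset_left.trans hWW)
          (hW.inter ((hs.approx n).measurableSet_preimage _)) (hb.subset Set.inter_subset_left))
    exact h1.mul_const y
  · refine tendsto_pi_nhds.2 fun X => ?_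
    simp only [linearStatistic_indicator_eq_sum hb]
    exact tendsto_finsetSum _ fun x _ => hs.tendsto_approx x

lemma linearStatistic_window_split {S T : ℝ} (h : S ≤ T) (φ : E → ℂ) (X : Configuration E) :
    linearStatistic ((window E T).indicator φ) X = linearStatistic ((window E S).indicator φ) X +
      linearStatistic ((window E T \ window E S).indicator φ) X := by
  classical
  have hb := isBounded_window E T
  rw [linearStatistic_indicator_eq_sum hb, linearStatistic_indicator_eq_sum (isBounded_window E S),
    linearStatistic_indicator_eq_sum (hb.subset Set.sdiff_subset), ← Finset.sum_union]
  · refine Finset.sum_congr ?_ fun _ _ => rfl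
    ext x
    simp only [Set.Finite.mem_toFinset, Finset.mem_union, Set.mem_inter_iff, Set.mem_sdiff]
    have := @window_mono E S T h x
    tauto
  · rw [Finset.disjoint_left]
    intro x hx hx'
    exact ((Set.Finite.mem_toFinset _).1 hx').2.2 ((Set.Finite.mem_toFinset _).1 hx).2

/-- A limit of recentered sums over windows is the sum over a fixed window plus a function of the
configuration outside of it. -/
lemma exists_outer_part {f : E → ℂ} (hf : Measurable f)
    {Y : Configuration E → ℂ} {t : ℕ → ℝ} (ht : Tendsto t atTop atTop) {c : ℕ → ℂ}
    (hY : ∀ᵐ X ∂P, Tendsto (fun n => linearStatistic ((window E (t n)).indicator f) X - c n) atTop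
      (𝓝 (Y X))) (T : ℝ) :
    ∃ O : Configuration E → ℂ, StronglyMeasurable[sigmaOn (window E T)ᶜ] O ∧
      ∀ᵐ X ∂P, Y X = linearStatistic f (X.restrict (window E T)) + O X := by
  have hg : ∀ n, StronglyMeasurable[sigmaOn (window E T)ᶜ] fun X : Configuration E =>
      linearStatistic ((window E (t n) \ window E T).indicator f) X - c n := fun n =>
    (measurable_linearStatistic ((measurableSet_window E _).diff (measurableSet_window E T))
      ((isBounded_window E _).subset Set.sdiff_subset) (fun x hx => hx.2) hf).stronglyMeasurable.sub
      stronglyMeasurable_const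
  -- `limUnder` is defined on every configuration, so the outer part is measurable without
  -- completing the σ-algebra; almost surely it is the true limit.
  have hlim : ∀ {m : MeasurableSpace (Configuration E)} {g : ℕ → Configuration E → ℂ},
      (∀ n, StronglyMeasurable[m] (g n)) →
        StronglyMeasurable[m] fun X => limUnder atTop fun n => g n X :=
    fun h => StronglyMeasurable.limUnder h
  refine ⟨_, hlim hg, ?_⟩
  filter_upwards [hY] with X hX
  have h1 : Tendsto (fun n => linearStatistic ((window E (t n) \ window E T).indicator f) X - c n)
      atTop (𝓝 (Y X - linearStatistic ((window E T).indicator f) X)) := by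
    refine (hX.sub_const _).congr' ?_
    filter_upwards [ht.eventually_ge_atTop T] with n hn
    rw [linearStatistic_window_split hn]
    ring
  rw [linearStatistic_restrict, h1.limUnder_eq]
  ring

lemma tendsto_linearStatistic_window {f : E → ℂ} {X : Configuration E}
    (h : Summable fun x : X.1 => f x) {t : ℕ → ℝ} (ht : Tendsto t atTop atTop) :
    Tendsto (fun n => linearStatistic ((window E (t n)).indicator f) X) atTop
      (𝓝 (linearStatistic f X)) := by
  refine tendsto_tsum_of_dominated_convergence (bound := fun x : X.1 => ‖f x‖) h.norm (fun x => ?_)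
    (Eventually.of_forall fun n x => norm_indicator_le_norm_self f x)
  refine tendsto_const_nhds.congr' ?_
  filter_upwards [ht.eventually_ge_atTop |((x : E) : ℝ)|] with n hn
  exact (Set.indicator_of_mem (show (x : E) ∈ window E (t n) from hn) f).symm

/-- Convergence in `L¹` gives almost sure convergence along a subsequence of integer windows, which
is the form that can be split into inside and outside. The constants are the means of the windowed
sums. -/
lemma IsCenteredSum.exists_seq [LocallyCompactSpace E] [SigmaFinite μ] [IsProbabilityMeasure P]
    (hK : IsProjectionKernel μ K)
    (hdet : IsDeterminantal P μ K) {f : E → ℂ} (hf : Measurable f) {C : ℝ} (hC : ∀ x, ‖f x‖ ≤ C)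
    {Y : Configuration E → ℂ} (hY : IsCenteredSum P f Y) :
    ∃ t : ℕ → ℝ, Tendsto t atTop atTop ∧ ∃ c : ℕ → ℂ, ∀ᵐ X ∂P,
      Tendsto (fun n => linearStatistic ((window E (t n)).indicator f) X - c n) atTop
        (𝓝 (Y X)) := by
  have hm : ∀ T, AEStronglyMeasurable (centeredStat P ((window E T).indicator f)) P := fun T =>
    (memLp_linearStatistic hK hdet (hf.indicator (measurableSet_window E T))
      (fun x => (norm_indicator_le_norm_self f x).trans (hC x))
      (integrable_norm_window hK hf hC T) le_rfl).1.1
  have h1 : TendstoInMeasure P (fun n : ℕ => centeredStat P ((window E n).indicator f)) atTop Y := by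
    refine tendstoInMeasure_of_tendsto_eLpNorm one_ne_zero (fun n => hm n) hY.1.1 ?_
    simp only [centeredStat_window]
    exact hY.2.comp tendsto_natCast_atTop_atTop
  obtain ⟨ns, hns, h2⟩ := h1.exists_seq_tendsto_ae
  exact ⟨fun n => ns n, tendsto_natCast_atTop_atTop.comp hns.tendsto_atTop, _, h2⟩

/-! ### Conditioning -/

section Kernel

open ProbabilityTheory

variable {Ω : Type*} {m mΩ : MeasurableSpace Ω} [StandardBorelSpace Ω] {Q : Measure Ω}
  [IsProbabilityMeasure Q]

lemma ae_condExpKernel_of_ae (hm : m ≤ mΩ) {p : Ω → Prop} (h : ∀ᵐ ω ∂Q, p ω) :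
    ∀ᵐ ω ∂Q, ∀ᵐ z ∂(condExpKernel Q m ω), p z := by
  rw [← condExpKernel_comp_trim (μ := Q) hm] at h
  exact ae_of_ae_trim hm (Measure.ae_ae_of_ae_comp h)

/-- For one `m`-measurable event the kernel gives its indicator almost surely; the preimages of a
countable basis of `ℂ` are enough to pin down the value of `O`. -/
lemma ae_condExpKernel_eq (hm : m ≤ mΩ) {O : Ω → ℂ} (hO : StronglyMeasurable[m] O) :
    ∀ᵐ ω ∂Q, ∀ᵐ z ∂(condExpKernel Q m ω), O z = O ω := by
  have h1 : ∀ U ∈ TopologicalSpace.countableBasis ℂ, ∀ᵐ ω ∂Q, O ω ∈ U →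
      ∀ᵐ z ∂(condExpKernel Q m ω), O z ∈ U := by
    intro U hU
    have hA : MeasurableSet[m] (O ⁻¹' U) := hO.measurable
      (TopologicalSpace.isOpen_of_mem_countableBasis hU).measurableSet
    have h2 := condExpKernel_ae_eq_condExp (μ := Q) hm (hm _ hA)
    rw [condExp_of_stronglyMeasurable hm ((stronglyMeasurable_const).indicator hA)
      ((integrable_const _).indicator (hm _ hA))] at h2
    filter_upwards [h2] with ω hω hωU
    rw [Set.indicator_of_mem (show ω ∈ O ⁻¹' U from hωU), measureReal_def,
      ENNReal.toReal_eq_one_iff] at hω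
    exact (mem_ae_iff_prob_eq_one (hm _ hA)).2 hω
  filter_upwards [(ae_ball_iff (TopologicalSpace.countable_countableBasis ℂ)).2 h1] with ω hω
  have h3 : ∀ᵐ z ∂(condExpKernel Q m ω), ∀ U ∈ TopologicalSpace.countableBasis ℂ, O ω ∈ U →
      O z ∈ U := by
    refine (ae_ball_iff (TopologicalSpace.countable_countableBasis ℂ)).2 fun U hU => ?_
    by_cases h : O ω ∈ U
    · filter_upwards [hω U hU h] with z hz _ using hz
    · exact Eventually.of_forall fun z hz => absurd hz h
  filter_upwards [h3] with z hz
  by_contra hne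
  obtain ⟨U, hU, hωU, hsub⟩ := (TopologicalSpace.isBasis_countableBasis ℂ).exists_subset_of_mem_open
    (show O ω ∈ ({O z}ᶜ : Set ℂ) from fun h => hne h.symm) isOpen_compl_singleton
  exact hsub (hz U hU hωU) rfl

end Kernel

lemma specialize_apply (a : ℕ+ → Configuration E → ℂ) (F : SymFunc) (X : Configuration E) :
    specialize a F X = MvPolynomial.aeval (fun k => a k X) F := by
  have h : (Pi.evalAlgHom ℂ (fun _ : Configuration E => ℂ) X).comp (specialize a) =
      MvPolynomial.aeval (fun k => a k X) := by
    refine MvPolynomial.algHom_ext fun k => ?_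
    simp [specialize]
  exact DFunLike.congr_fun h F

/-- Giambelli compatibility of the conditional measures passes to conditional expectations. -/
lemma condExp_schur [IsProbabilityMeasure P] (hE : MeasurableSet E) {T : ℝ} {f : ℕ+ → E → ℂ}
    (hcond : ∀ᵐ X ∂P, GiambelliCompatible (conditionalMeasure hE P T X) (uncentered f))
    {a O : ℕ+ → Configuration E → ℂ}
    (hO : ∀ k, StronglyMeasurable[sigmaOn (window E T)ᶜ] (O k))
    (haO : ∀ k, ∀ᵐ X ∂P, a k X = linearStatistic (f k) (X.restrict (window E T)) + O k X)
    (hint : IsL1Specialization P (specialize a)) (lam : YoungDiagram) :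
    ∀ᵐ X ∂P, (P[specialize a (schur lam) | sigmaOn (window E T)ᶜ]) X =
      Matrix.det (Matrix.of fun i j : Fin (diagLength lam) =>
        (P[specialize a (schur (hook (frobP lam i) (frobQ lam j))) | sigmaOn (window E T)ᶜ]) X) := by
  have : StandardBorelSpace (Configuration E) := standardBorelSpace_configuration hE
  have hm := sigmaOn_le (window E T)ᶜ
  have hker : ∀ F : SymFunc, P[specialize a F | sigmaOn (window E T)ᶜ] =ᵐ[P] fun X =>
      ∫ Z, specialize a F Z ∂(ProbabilityTheory.condExpKernel P (sigmaOn (window E T)ᶜ) X) :=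
    fun F => ProbabilityTheory.condExp_ae_eq_integral_condExpKernel hm (hint F)
  have h1 := ae_condExpKernel_of_ae (Q := P) hm (ae_all_iff.2 haO)
  have h2 : ∀ᵐ X ∂P, ∀ k, ∀ᵐ Z ∂(ProbabilityTheory.condExpKernel P (sigmaOn (window E T)ᶜ) X),
      O k Z = O k X := ae_all_iff.2 fun k => ae_condExpKernel_eq hm (hO k)
  have h3 : ∀ᵐ X ∂P, ∀ i j : Fin (diagLength lam),
      (P[specialize a (schur (hook (frobP lam i) (frobQ lam j))) | sigmaOn (window E T)ᶜ]) X =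
      ∫ Z, specialize a (schur (hook (frobP lam i) (frobQ lam j))) Z
        ∂(ProbabilityTheory.condExpKernel P (sigmaOn (window E T)ᶜ) X) :=
    ae_all_iff.2 fun i => ae_all_iff.2 fun j => hker _
  filter_upwards [hcond, h1, h2, h3, hker (schur lam)] with X hX h1 h2 h3 h4
  -- Under the kernel at `X` the outer parts are the constants `O k X`, so `a` is a translate of the
  -- uncentered power sums by deterministic quantities.
  have hX' := (show GiambelliCompatible (conditionalMeasure hE P T X)
    (specialize fun k => linearStatistic (f k)) from hX).translate fun k => O k X
  have h5 : ∀ F : SymFunc,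
      ∫ Z, specialize a F Z ∂(ProbabilityTheory.condExpKernel P (sigmaOn (window E T)ᶜ) X) =
      ∫ Z, specialize (fun k X' => linearStatistic (f k) X' + O k X) F Z
        ∂(conditionalMeasure hE P T X) := by
    intro F
    have h6 := (hX'.1 F).1
    rw [conditionalMeasure] at h6 ⊢
    rw [integral_map (measurable_restrict (measurableSet_window E T)).aemeasurable h6]
    refine integral_congr_ae ?_
    filter_upwards [h1, ae_all_iff.2 h2] with Z hZ1 hZ2
    rw [specialize_apply, specialize_apply]
    congr 2
    funext k
    rw [hZ1, hZ2]
  rw [h4, h5, hX'.2]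
  congr 1
  ext i j
  rw [Matrix.of_apply, Matrix.of_apply, h3, h5]

end

section


/-! ### Conditional expectations along a decreasing sequence with trivial limit -/

section Tail

variable {Ω : Type*} {mΩ : MeasurableSpace Ω} {Q : Measure Ω} [IsProbabilityMeasure Q]

/-- Every preimage `w ⁻¹' U` lies in all the completions, hence has probability 0 or 1; since `ℂ` is
countably separated, `w` is almost surely constant. -/
lemma exists_ae_eq_const {G : ℕ → MeasurableSpace Ω}
    (htriv : ∀ A, (∀ n, MeasurableSet[eventuallyMeasurableSpace (G n) (ae Q)] A) →
      Q A = 0 ∨ Q A = 1) {w : Ω → ℂ} (hw : Measurable w)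
    (hwG : ∀ n, AEStronglyMeasurable[G n] w Q) : ∃ c : ℂ, w =ᵐ[Q] fun _ => c := by
  refine exists_eventuallyEq_const_of_forall_separating MeasurableSet fun U hU => ?_
  have h1 : ∀ n, MeasurableSet[eventuallyMeasurableSpace (G n) (ae Q)] (w ⁻¹' U) := fun n => by
    obtain ⟨v, hv, hwv⟩ := hwG n
    refine ⟨v ⁻¹' U, hv.measurable hU, ?_⟩
    filter_upwards [hwv] with ω hω
    exact congrArg (· ∈ U) hω
  rcases htriv _ h1 with h | h
  · right
    exact measure_eq_zero_iff_ae_notMem.1 h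
  · left
    exact (mem_ae_iff_prob_eq_one (hw hU)).2 h

/-- Backward martingale convergence in Hilbert space form: conditional expectations are orthogonal
projections onto decreasing closed subspaces and converge strongly. The limit lies in every
subspace, so by triviality it is constant, and preservation of the mean identifies the constant. -/
lemma tendsto_condExp_of_trivial {G : ℕ → MeasurableSpace Ω} (hG : ∀ n, G n ≤ mΩ)
    (hanti : Antitone G)
    (htriv : ∀ A, (∀ n, MeasurableSet[eventuallyMeasurableSpace (G n) (ae Q)] A) →
      Q A = 0 ∨ Q A = 1) {Z : Ω → ℂ} (hZ : MemLp Z 2 Q) :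
    Tendsto (fun n => eLpNorm (Q[Z | G n] - fun _ => ∫ ω, Z ω ∂Q) 2 Q) atTop (𝓝 0) := by
  have : ∀ n, Fact (G n ≤ mΩ) := fun n => ⟨hG n⟩
  let U : ℕ → Submodule ℂ (Lp ℂ 2 Q) := fun n => lpMeas ℂ ℂ (G n) 2 Q
  have hU : ∀ n, (U n).HasOrthogonalProjection := fun n => by
    have : CompleteSpace (U n) := inferInstanceAs (CompleteSpace (lpMeas ℂ ℂ (G n) 2 Q))
    infer_instance
  have hUc : ∀ n, IsClosed (U n : Set (Lp ℂ 2 Q)) := fun n => by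
    have : CompleteSpace (U n) := inferInstanceAs (CompleteSpace (lpMeas ℂ ℂ (G n) 2 Q))
    exact (completeSpace_coe_iff_isComplete.1 this).isClosed
  have hUanti : Antitone U := fun m n hmn F hF => by
    obtain ⟨v, hv, hFv⟩ := mem_lpMeas_iff_aestronglyMeasurable.1 hF
    exact mem_lpMeas_iff_aestronglyMeasurable.2 ⟨v, hv.mono (hanti hmn), hFv⟩
  obtain ⟨w, hw⟩ : ∃ w, Tendsto (fun n => (U n).starProjection hZ.toLp) atTop (𝓝 w) := by
    -- The orthogonal complements increase, so their projections converge; subtracting from the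
    -- identity gives the decreasing case.
    have h1 := Submodule.starProjection_tendsto_closure_iSup (fun n => (U n)ᗮ)
      (fun m n hmn => Submodule.orthogonal_le (hUanti hmn)) hZ.toLp
    refine ⟨_, (h1.const_sub hZ.toLp).congr fun n => ?_⟩
    rw [Submodule.starProjection_orthogonal']
    simp
  have hwU : ∀ n, w ∈ U n := fun n => (hUc n).mem_of_tendsto hw
    ((eventually_ge_atTop n).mono fun m hm => hUanti hm (Submodule.starProjection_apply_mem _ _))
  obtain ⟨c, hc⟩ := exists_ae_eq_const htriv (Lp.stronglyMeasurable w).measurable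
    fun n => mem_lpMeas_iff_aestronglyMeasurable.1 (hwU n)
  have h2 : Tendsto (fun n => eLpNorm (Q[Z | G n] - fun _ => c) 2 Q) atTop (𝓝 0) := by
    refine ((Lp.tendsto_Lp_iff_tendsto_eLpNorm' _ _).1 hw).congr fun n => eLpNorm_congr_ae ?_
    have h3 : (U n).starProjection hZ.toLp =ᵐ[Q] Q[Z | G n] :=
      hZ.condExpL2_ae_eq_condExp (𝕜 := ℂ) (hG n)
    exact h3.sub hc
  have h4 : ∫ ω, Z ω ∂Q = c := by
    have h5 := tendsto_integral_of_L1' (μ := Q) (fun _ => c) aestronglyMeasurable_const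
      (F := fun n => Q[Z | G n]) (l := atTop) (Eventually.of_forall fun n => integrable_condExp) ?_
    · simp only [integral_condExp (hG _), integral_const, probReal_univ, one_smul] at h5
      exact tendsto_nhds_unique tendsto_const_nhds h5
    · refine tendsto_of_tendsto_of_tendsto_of_le_of_le tendsto_const_nhds h2 (fun _ => zero_le)
        fun n => eLpNorm_le_eLpNorm_of_exponent_le (by norm_num) ?_
      exact integrable_condExp.1.sub aestronglyMeasurable_const
  rw [h4]
  exact h2

/-- The sum of the finitely many errors tends to 0 in `L²`, so a single subsequence works for all
indices. -/
lemma exists_seq_condExp_tendsto {G : ℕ → MeasurableSpace Ω} (hG : ∀ n, G n ≤ mΩ)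
    (hanti : Antitone G)
    (htriv : ∀ A, (∀ n, MeasurableSet[eventuallyMeasurableSpace (G n) (ae Q)] A) →
      Q A = 0 ∨ Q A = 1) {ι : Type*} [Fintype ι] {Z : ι → Ω → ℂ} (hZ : ∀ i, MemLp (Z i) 2 Q) :
    ∃ ns : ℕ → ℕ, ∀ᵐ ω ∂Q, ∀ i,
      Tendsto (fun n => (Q[Z i | G (ns n)]) ω) atTop (𝓝 (∫ ω, Z i ω ∂Q)) := by
  let D : ι → ℕ → Ω → ℂ := fun i n => Q[Z i | G n] - fun _ => ∫ ω, Z i ω ∂Q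
  have hD : ∀ i n, AEStronglyMeasurable (D i n) Q := fun i n =>
    integrable_condExp.1.sub aestronglyMeasurable_const
  have h1 : Tendsto (fun n => eLpNorm (∑ i, fun ω => ‖D i n ω‖) 2 Q) atTop (𝓝 0) := by
    have h2 : Tendsto (fun n => ∑ i, eLpNorm (D i n) 2 Q) atTop (𝓝 0) := by
      have := tendsto_finsetSum (Finset.univ : Finset ι) fun i _ =>
        tendsto_condExp_of_trivial hG hanti htriv (hZ i)
      simpa using this
    refine tendsto_of_tendsto_of_tendsto_of_le_of_le tendsto_const_nhds h2 (fun _ => zero_le)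
      fun n => (eLpNorm_sum_le (fun i _ => (hD i n).norm) (by norm_num)).trans_eq ?_
    exact Finset.sum_congr rfl fun i _ => eLpNorm_norm _
  have h3 : TendstoInMeasure Q (fun n => ∑ i, fun ω => ‖D i n ω‖) atTop (0 : Ω → ℝ) := by
    refine tendstoInMeasure_of_tendsto_eLpNorm (p := 2) (by norm_num)
      (fun n => Finset.aestronglyMeasurable_sum _ fun i _ => (hD i n).norm)
      aestronglyMeasurable_zero ?_
    simpa using h1
  obtain ⟨ns, -, h4⟩ := h3.exists_seq_tendsto_ae
  refine ⟨ns, ?_⟩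
  filter_upwards [h4] with ω hω i
  rw [tendsto_iff_norm_sub_tendsto_zero]
  refine squeeze_zero (fun _ => norm_nonneg _) (fun n => ?_) hω
  rw [Finset.sum_apply]
  exact Finset.single_le_sum (f := fun i => ‖D i (ns n) ω‖) (fun _ _ => norm_nonneg _)
    (Finset.mem_univ i)

end Tail

/-! ### From conditional to unconditional Giambelli compatibility -/

variable {E : Set ℝ} {P : Measure (Configuration E)} {μ : Measure E} {K : E → E → ℂ}

/-- Monotonicity in `T` reduces the tail to a sequence of windows. The radii `n + 1` are positive
also for `n = 0`, as the hypothesis on conditional measures requires. -/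
lemma IsTailTrivial.eq_zero_or_one (h : IsTailTrivial P) (A : Set (Configuration E))
    (hA : ∀ n : ℕ, MeasurableSet[eventuallyMeasurableSpace
      (sigmaOn (window E ((n : ℝ) + 1))ᶜ) (ae P)] A) : P A = 0 ∨ P A = 1 := by
  refine h A ?_
  rw [tailSigma]
  simp only [MeasurableSpace.measurableSet_iInf]
  intro T _
  obtain ⟨n, hn⟩ := exists_nat_ge T
  obtain ⟨t, ht, hAt⟩ := hA n
  exact ⟨t, sigmaOn_mono (Set.compl_subset_compl.2 (window_mono E (by linarith))) t ht, hAt⟩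

lemma giambelliCompatible_of_tail [IsProbabilityMeasure P] (hE : MeasurableSet E)
    (htail : IsTailTrivial P) {f : ℕ+ → E → ℂ}
    (hcond : ∀ T : ℝ, 0 < T → ∀ᵐ X ∂P,
      GiambelliCompatible (conditionalMeasure hE P T X) (uncentered f))
    {a : ℕ+ → Configuration E → ℂ} (hmem : ∀ (k : ℕ+) (p : ℕ), 1 ≤ p → MemLp (a k) p P)
    (ha : ∀ k, ∃ t : ℕ → ℝ, Tendsto t atTop atTop ∧ ∃ c : ℕ → ℂ, ∀ᵐ X ∂P,
      Tendsto (fun n => linearStatistic ((window E (t n)).indicator (f k)) X - c n) atTop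
        (𝓝 (a k X))) (hf : ∀ k, Measurable (f k)) :
    GiambelliCompatible P (specialize a) := by
  have hL1 : IsL1Specialization P (specialize a) := fun F => by
    have := memLp_specialize hmem F 1 le_rfl
    rwa [Nat.cast_one, memLp_one_iff_integrable] at this
  refine ⟨hL1, fun lam => ?_⟩
  have houter : ∀ T : ℝ, ∀ k, ∃ O : Configuration E → ℂ,
      StronglyMeasurable[sigmaOn (window E T)ᶜ] O ∧
      ∀ᵐ X ∂P, a k X = linearStatistic (f k) (X.restrict (window E T)) + O X := fun T k => by
    obtain ⟨t, ht, c, hc⟩ := ha k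
    exact exists_outer_part (hf k) ht hc T
  choose O hO haO using houter
  -- The Schur function of `lam` and all its hooks form one finite family, so that they share a
  -- subsequence.
  let F : Option (Fin (diagLength lam) × Fin (diagLength lam)) → SymFunc := fun o =>
    o.elim (schur lam) fun ij => schur (hook (frobP lam ij.1) (frobQ lam ij.2))
  obtain ⟨ns, hns⟩ := exists_seq_condExp_tendsto (Q := P)
    (G := fun n : ℕ => sigmaOn (window E ((n : ℝ) + 1))ᶜ) (fun n => sigmaOn_le _)
    (fun m n hmn => sigmaOn_mono (Set.compl_subset_compl.2 (window_mono E (by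
      have : (m : ℝ) ≤ n := by exact_mod_cast hmn
      linarith)))) htail.eq_zero_or_one (Z := fun o => specialize a (F o))
    fun o => by exact_mod_cast memLp_specialize hmem (F o) 2 (by norm_num)
  have hdet : ∀ᵐ X ∂P, ∀ n : ℕ,
      (P[specialize a (schur lam) | sigmaOn (window E ((n : ℝ) + 1))ᶜ]) X =
      Matrix.det (Matrix.of fun i j : Fin (diagLength lam) =>
        (P[specialize a (schur (hook (frobP lam i) (frobQ lam j))) |
          sigmaOn (window E ((n : ℝ) + 1))ᶜ]) X) :=
    ae_all_iff.2 fun n => condExp_schur hE (hcond _ (by positivity)) (hO _) (haO _) hL1 lam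
  obtain ⟨X, hX1, hX2⟩ := (hns.and hdet).exists
  refine tendsto_nhds_unique (hX1 none) ?_
  have h1 : Tendsto (fun n : ℕ => Matrix.det (Matrix.of fun i j : Fin (diagLength lam) =>
        (P[specialize a (schur (hook (frobP lam i) (frobQ lam j))) |
          sigmaOn (window E ((ns n : ℝ) + 1))ᶜ]) X)) atTop
      (𝓝 (Matrix.det (Matrix.of fun i j : Fin (diagLength lam) =>
        ∫ X, specialize a (schur (hook (frobP lam i) (frobQ lam j))) X ∂P))) := by
    refine (Continuous.matrix_det continuous_id).continuousAt.tendsto.comp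
      (tendsto_pi_nhds.2 fun i => tendsto_pi_nhds.2 fun j => ?_)
    exact hX1 (some (i, j))
  exact h1.congr fun n => (hX2 (ns n)).symm

end

end PointProcess

end

/-! ### The theorem -/

open PointProcess

theorem mainTheorem6 {E : Set ℝ} (hE : IsGroundSet E)
    (μ : Measure E) [IsLocallyFiniteMeasure μ]
    (K : E → E → ℂ) (hK : IsProjectionKernel μ K)
    (P : Measure (Configuration E)) [IsProbabilityMeasure P]
    (hdet : IsDeterminantal P μ K) (hrigid : IsRigid P)
    (R : ℝ) (hR : 0 < R) (f : ℕ+ → E → ℂ) (hf : IsAdmissible μ K R f)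
    (htail : IsTailTrivial P)
    (hcond : ∀ T : ℝ, 0 < T → ∀ᵐ X ∂P,
      GiambelliCompatible (conditionalMeasure hE.measurableSet P T X) (uncentered f)) :
    (∃ Y : Configuration E → ℂ, IsCenteredSum P (f 1) Y) ∧
    ∀ Y : Configuration E → ℂ, IsCenteredSum P (f 1) Y →
      GiambelliCompatible P (centered P f Y) ∧ GiambelliCompatible P (semiCentered f Y) := by
  have := hE.locallyCompactSpace
  obtain ⟨C, hC⟩ := hf.bounded 1
  refine ⟨exists_isCenteredSum hK hdet (hf.measurable 1) hC hf.integrable_one, fun Y hY => ?_⟩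
  have htwo : ∀ k : ℕ+, k ≠ 1 → 2 ≤ k := fun k hk =>
    Order.succ_le_of_lt (lt_of_le_of_ne one_le (Ne.symm hk))
  have hsemi : GiambelliCompatible P (semiCentered f Y) := by
    refine giambelliCompatible_of_tail hE.measurableSet htail hcond (fun k p hp => ?_) (fun k => ?_)
      hf.measurable
    · by_cases hk : k = 1
      · simp only [hk, if_true]
        exact hY.memLp hK hdet (hf.measurable 1) hC hf.integrable_one hp
      · simp only [hk, if_false]
        obtain ⟨C', hC'⟩ := hf.bounded k
        exact (memLp_linearStatistic hK hdet (hf.measurable k) hC'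
          (hf.integrable_two k (htwo k hk)) hp).2
    · by_cases hk : k = 1
      · subst hk
        simp only [if_true]
        exact hY.exists_seq hK hdet (hf.measurable 1) hC
      · simp only [hk, if_false]
        obtain ⟨C', hC'⟩ := hf.bounded k
        -- For `k ≥ 2` the sums converge almost surely, so no recentering is needed.
        refine ⟨fun n => n, tendsto_natCast_atTop_atTop, 0, ?_⟩
        filter_upwards [(linearStatistic_campbell hK hdet (hf.measurable k) hC'
          (hf.integrable_two k (htwo k hk))).1] with X hX
        simpa using tendsto_linearStatistic_window hX
          (tendsto_natCast_atTop_atTop (R := ℝ))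
  refine ⟨?_, hsemi⟩
  -- The two specializations differ by the means of the power sums with `k ≥ 2`.
  have h1 := GiambelliCompatible.translate hsemi
    fun k => if k = 1 then 0 else -∫ Z, linearStatistic (f k) Z ∂P
  have h2 : (fun (k : ℕ+) (X : Configuration E) => (if k = 1 then Y X else linearStatistic (f k) X) +
      if k = 1 then 0 else -∫ Z, linearStatistic (f k) Z ∂P) = fun k X => if k = 1 then Y X else
        linearStatistic (f k) X - ∫ Z, linearStatistic (f k) Z ∂P := by
    funext k X
    split_ifs <;> ring
  rw [h2] at h1
  exact h1
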